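/- Let $(\mathcal S,\omega,\langle\cdot,\cdot\rangle)$ be a real vector space of dimension $2N$ with a (non-degenerate) symplectic form $\omega$ and an inner product, and let $\hbar>0$. Let $E$ be the invertible operator on $\mathcal S$ determined by $\omega(v,w)=\langle v,E^{-1}w\rangle$ and put $|E|=\sqrt{E^*E}$, $J=-E^{-1}|E|$ (a complex structure on $\mathcal S$) and $\eta(v,w)=\langle v,|E|^{-1}w\rangle$. Let $\theta$ be a smooth real one-form on $\mathcal S$ with $\omega=-\mathrm d\theta$, let $\nabla=\mathrm d+\frac{\mathrm i}{\hbar}\theta$ be the corresponding connection on the trivial line bundle $\mathcal S\times\mathbb C$, and let $\Delta=\nabla^*\nabla$ be its Bochner Laplacian, an unbounded operator on the Hilbert space $L^2(\mathcal S,\mathbb C)$ of square-integrable sections; here $\nabla$ is the closure of the connection on the smooth compactly supported sections, and volumes and norms of one-forms are those of $\langle\cdot,\cdot\rangle$. Then: 1. There are linear complex coordinates $z^i=x^i+\mathrm i y^i$, $i=1,\dots,N$, on $(\mathcal S,J)$ in which the (complex linear) operator $|E|^{-1}$ is diagonal with diagonal components $\vartheta_1,\dots,\vartheta_N>0$ and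 the inner product has components $g_{i\bar j}=\delta_{ij}/\vartheta_i$. 2. For the diagonal components $\vartheta_i$ of $|E|^{-1}$ in any linear complex coordinates in which it is diagonal, $$\operatorname{spec}(\Delta)=\Bigl\{\tfrac1\hbar\sum_{i=1}^N(2n_i+1)\,\vartheta_i \;:\; n_1,\dots,n_N\in\mathbb N=\{0,1,2,\dots\}\Bigr\}.$$ 3. The number $\lambda=\frac1{2\hbar}\operatorname{tr}|E|^{-1}$ (trace over the real vector space $\mathcal S$) is the smallest element of the spectrum and the smallest eigenvalue of $\Delta$. 4. The eigenspace $\{\psi\in\operatorname{dom}\Delta:\Delta\psi=\lambda\psi\}$ is the space of square-integrable holomorphic sections, i.e. of the $\psi\in L^2$ that are (almost everywhere equal to) a smooth section with $\nabla_v\psi+\mathrm i\nabla_{Jv}\psi=0$ for all $v\in\mathcal S$. If $\theta$ is the symmetric potential $\theta_x(v)=-\frac12\omega(x,v)$, it consists of exactly the $\psi\in L^2$ of the form $$\psi(x)=\frac{\alpha(x)}{\sqrt{2\pi\hbar}^{\,N}}\exp\Bigl(-\frac1{4\hbar}\eta(x,x)\Bigr)$$ with a function $\alpha$ that is smooth and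 holomorphic with respect to $J$ (the Fock/Bargmann space). -/

import Mathlib

open MeasureTheory Complex
open scoped Distributions

noncomputable section

/-! ### The linear algebra of a symplectic vector space with inner product -/

section LinearAlgebra

variable {S : Type*} [NormedAddCommGroup S] [InnerProductSpace ℝ S] [FiniteDimensional ℝ S]

/-- The operator `E⁻¹` relating a bilinear form `ω` to the inner product:
`ω v w = ⟪v, E⁻¹ w⟫` for all `v`, `w` (see `inner_structureInv`). -/
def structureInv (ω : LinearMap.BilinForm ℝ S) : Module.End ℝ S :=
  ((InnerProductSpace.toDual ℝ S).symm.toLinearEquiv.toLinearMap).comp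
    ((LinearMap.toContinuousLinearMap (𝕜 := ℝ) (E := S) (F' := ℝ)).toLinearMap.comp ω.flip)

theorem inner_structureInv (ω : LinearMap.BilinForm ℝ S) (v w : S) :
    inner ℝ v (structureInv ω w) = ω v w := by
  rw [real_inner_comm]
  simp [structureInv]

/-- The operator `E`, inverse of `E⁻¹` (which is invertible when `ω` is nondegenerate). -/
def structureOp (ω : LinearMap.BilinForm ℝ S) : Module.End ℝ S :=
  Ring.inverse (structureInv ω)

/-- The modulus `|T| = √(T* T)` of an endomorphism of a finite-dimensional Euclidean space: it acts
on an orthonormal basis of eigenvectors of `T* T` by the square roots of the eigenvalues. By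
`modulus_isPositive` and `modulus_comp_modulus` it is the positive square root of `T* T`. -/
def modulus (T : Module.End ℝ S) : Module.End ℝ S :=
  let h : (LinearMap.adjoint T ∘ₗ T).IsSymmetric :=
    (LinearMap.isPositive_adjoint_comp_self T).isSymmetric
  (h.eigenvectorBasis rfl).toBasis.constr ℝ
    fun i => √(h.eigenvalues rfl i) • h.eigenvectorBasis rfl i

theorem modulus_apply_eigenvectorBasis (T : Module.End ℝ S)
    (h : (LinearMap.adjoint T ∘ₗ T).IsSymmetric) (i : Fin (Module.finrank ℝ S)) :
    modulus T (h.eigenvectorBasis rfl i) = √(h.eigenvalues rfl i) • h.eigenvectorBasis rfl i := by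
  have := (h.eigenvectorBasis rfl).toBasis.constr_basis ℝ
    (fun i => √(h.eigenvalues rfl i) • h.eigenvectorBasis rfl i) i
  simpa only [modulus, OrthonormalBasis.coe_toBasis] using this

theorem modulus_isPositive (T : Module.End ℝ S) : (modulus T).IsPositive := by
  have h : (LinearMap.adjoint T ∘ₗ T).IsSymmetric :=
    (LinearMap.isPositive_adjoint_comp_self T).isSymmetric
  set b := h.eigenvectorBasis rfl with hb
  have key : ∀ v w : S, inner ℝ (modulus T v) w
      = ∑ i, √(h.eigenvalues rfl i) * (inner ℝ (b i) v * inner ℝ (b i) w) := by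
    intro v w
    conv_lhs => rw [← b.sum_repr' v]
    rw [map_sum, sum_inner]
    refine Finset.sum_congr rfl fun i _ => ?_
    rw [map_smul, hb, modulus_apply_eigenvectorBasis, inner_smul_left, inner_smul_left]
    simp
    ring
  refine ⟨fun v w => ?_, fun v => ?_⟩
  · rw [key, real_inner_comm, key]
    exact Finset.sum_congr rfl fun i _ => by ring
  · rw [key, RCLike.re_to_real]
    exact Finset.sum_nonneg fun i _ => mul_nonneg (Real.sqrt_nonneg _) (mul_self_nonneg _)

theorem modulus_comp_modulus (T : Module.End ℝ S) :
    modulus T ∘ₗ modulus T = LinearMap.adjoint T ∘ₗ T := by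
  have hp := LinearMap.isPositive_adjoint_comp_self T
  have h : (LinearMap.adjoint T ∘ₗ T).IsSymmetric := hp.isSymmetric
  refine (h.eigenvectorBasis rfl).toBasis.ext fun i => ?_
  have e := h.apply_eigenvectorBasis rfl i
  simp only [OrthonormalBasis.coe_toBasis]
  rw [e, LinearMap.comp_apply, modulus_apply_eigenvectorBasis, map_smul,
    modulus_apply_eigenvectorBasis, smul_smul, Real.mul_self_sqrt (hp.nonneg_eigenvalues rfl i)]
  rfl

/-- The operator `|E|⁻¹` of the symplectic form `ω`. -/
def invModulus (ω : LinearMap.BilinForm ℝ S) : Module.End ℝ S :=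
  Ring.inverse (modulus (structureOp ω))

/-- The complex structure `J = -E⁻¹ |E|` derived from the symplectic form and inner product. -/
def complexStructure (ω : LinearMap.BilinForm ℝ S) : Module.End ℝ S :=
  -(structureInv ω ∘ₗ modulus (structureOp ω))

/-- The symmetric bilinear form `η(v, w) = ⟪v, |E|⁻¹ w⟫`. -/
def etaForm (ω : LinearMap.BilinForm ℝ S) (v w : S) : ℝ :=
  inner ℝ v (invModulus ω w)

/-- `b` is the real basis `∂/∂x¹, …, ∂/∂xᴺ, ∂/∂y¹, …, ∂/∂yᴺ` of linear complex coordinates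
`zⁱ = xⁱ + i yⁱ` with respect to `J`, i.e. `J (∂/∂xⁱ) = ∂/∂yⁱ`, in which the (complex linear)
operator `|E|⁻¹` is diagonal with diagonal components `ϑ`. -/
def IsDiagonalCoordinates {N : ℕ} (ω : LinearMap.BilinForm ℝ S)
    (b : Module.Basis (Fin N ⊕ Fin N) ℝ S) (ϑ : Fin N → ℝ) : Prop :=
  ∀ i, b (Sum.inr i) = complexStructure ω (b (Sum.inl i)) ∧
    invModulus ω (b (Sum.inl i)) = ϑ i • b (Sum.inl i) ∧
    invModulus ω (b (Sum.inr i)) = ϑ i • b (Sum.inr i)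

/-- The component `g_{i j̄} = g(∂/∂zⁱ, ∂/∂z̄ʲ)` of the complex bilinear extension `g` of the inner
product, where `∂/∂zⁱ = (∂/∂xⁱ - i ∂/∂yⁱ) / 2` and `∂/∂z̄ʲ = (∂/∂xʲ + i ∂/∂yʲ) / 2`. -/
def metricComponent {N : ℕ} (b : Module.Basis (Fin N ⊕ Fin N) ℝ S) (i j : Fin N) : ℂ :=
  (1 / 4 : ℂ) *
    ((inner ℝ (b (Sum.inl i)) (b (Sum.inl j)) : ℝ)
      + I * (inner ℝ (b (Sum.inl i)) (b (Sum.inr j)) : ℝ)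
      - I * (inner ℝ (b (Sum.inr i)) (b (Sum.inl j)) : ℝ)
      + (inner ℝ (b (Sum.inr i)) (b (Sum.inr j)) : ℝ))

end LinearAlgebra

/-! ### Spectral notions for unbounded operators on a Hilbert space -/

section Spectrum

variable {H : Type*} [NormedAddCommGroup H] [InnerProductSpace ℂ H]

/-- The resolvent set of an unbounded operator: those `z` for which `z - D` has a bounded two-sided
inverse `R`, mapping `H` into the domain of `D`. -/
def opResolventSet (D : H →ₗ.[ℂ] H) : Set ℂ :=
  {z | ∃ R : H →L[ℂ] H,
    (∀ u : H, ∃ hu : R u ∈ D.domain, z • R u - D ⟨R u, hu⟩ = u) ∧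
    ∀ u : D.domain, R (z • (u : H) - D u) = u}

/-- The spectrum of an unbounded operator. -/
def opSpectrum (D : H →ₗ.[ℂ] H) : Set ℂ := (opResolventSet D)ᶜ

/-- The set of `u` in the domain of `D` with `D u = z u`. -/
def opEigenspace (D : H →ₗ.[ℂ] H) (z : ℂ) : Set H :=
  {u | ∃ hu : u ∈ D.domain, D ⟨u, hu⟩ = z • u}

/-- `z` is an eigenvalue of `D`. -/
def IsOpEigenvalue (D : H →ₗ.[ℂ] H) (z : ℂ) : Prop :=
  ∃ u ∈ opEigenspace D z, u ≠ 0

variable {K : Type*} [NormedAddCommGroup K] [InnerProductSpace ℂ K] [CompleteSpace H]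

open scoped LinearPMap in
/-- For a densely defined closable operator `T`, with closure `T̄`, the operator `T* T̄`, on its
natural domain of those `u` in the domain of `T̄` for which `T̄ u` is in the domain of `T*`.
Note that `T* = T̄*`. -/
def adjointCompClosure (T : H →ₗ.[ℂ] K) : H →ₗ.[ℂ] H where
  domain := (T†.domain.comap T.closure.toFun).map T.closure.domain.subtype
  toFun :=
    (T†.toFun ∘ₗ (T.closure.toFun.restrict fun _ h => h :
        T†.domain.comap T.closure.toFun →ₗ[ℂ] T†.domain)) ∘ₗ
      (Submodule.equivMapOfInjective T.closure.domain.subtype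
        (Submodule.injective_subtype _) (T†.domain.comap T.closure.toFun)).symm.toLinearMap

open scoped LinearPMap in
theorem mem_graph_adjointCompClosure (T : H →ₗ.[ℂ] K) (u w : H) :
    (u, w) ∈ (adjointCompClosure T).graph ↔
      ∃ v : K, (u, v) ∈ T.closure.graph ∧ (v, w) ∈ T†.graph := by
  have key : ∀ x : T†.domain.comap T.closure.toFun,
      ((Submodule.equivMapOfInjective T.closure.domain.subtype
        (Submodule.injective_subtype _) (T†.domain.comap T.closure.toFun)).symm
          ⟨(x : T.closure.domain), ⟨x, x.2, rfl⟩⟩) = x := fun x => by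
    rw [LinearEquiv.symm_apply_eq]
    rfl
  simp only [LinearPMap.mem_graph_iff]
  constructor
  · rintro ⟨⟨_, x, hx, rfl⟩, rfl, rfl⟩
    refine ⟨T.closure x, ⟨x, rfl, rfl⟩, ⟨⟨T.closure x, hx⟩, rfl, ?_⟩⟩
    exact congrArg (fun y : T†.domain.comap T.closure.toFun => T† ⟨T.closure y, y.2⟩)
      (key ⟨x, hx⟩).symm
  · rintro ⟨v, ⟨x, rfl, rfl⟩, ⟨y, hy, rfl⟩⟩
    have hx : x ∈ T†.domain.comap T.closure.toFun := by
      change T.closure x ∈ T†.domain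
      exact hy ▸ y.2
    have hy' : y = ⟨T.closure x, hx⟩ := Subtype.ext hy
    subst hy'
    refine ⟨⟨x, ⟨x, hx, rfl⟩⟩, rfl, ?_⟩
    exact congrArg (fun y : T†.domain.comap T.closure.toFun => T† ⟨T.closure y, y.2⟩)
      (key ⟨x, hx⟩)

end Spectrum

/-! ### The trivial quantization line bundle and its Bochner Laplacian -/

section Bundle

variable {S : Type*} [NormedAddCommGroup S] [InnerProductSpace ℝ S]

/-- The connection `∇ = d + (i/ħ) θ` on the trivial line bundle `S × ℂ`:
`covDeriv ħ θ f x v = (∇_v f)(x)`. -/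
def covDeriv (ħ : ℝ) (θ : S → S →L[ℝ] ℝ) (f : S → ℂ) (x v : S) : ℂ :=
  fderiv ℝ f x v + I / (ħ : ℂ) * (θ x v : ℂ) * f x

/-- The exterior derivative of a one-form: `(dθ)_x(u, v)`. -/
def extDerivOne (θ : S → S →L[ℝ] ℝ) (x u v : S) : ℝ :=
  fderiv ℝ θ x u v - fderiv ℝ θ x v u

/-- `f` is a smooth section that is holomorphically polarized with respect to the complex
structure `J`: it is covariantly constant along the vectors `v + i J v`, which span the
eigenspace of `J` for `-i`. -/
def IsHolomorphicSection (ħ : ℝ) (θ : S → S →L[ℝ] ℝ) (J : Module.End ℝ S) (f : S → ℂ) : Prop :=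
  ContDiff ℝ (⊤ : ℕ∞) f ∧ ∀ x v, covDeriv ħ θ f x v + I * covDeriv ħ θ f x (J v) = 0

/-- `α` is a smooth function on `S` that is holomorphic with respect to the complex structure `J`
(its derivative is complex linear). -/
def IsHolomorphicFunction (J : Module.End ℝ S) (α : S → ℂ) : Prop :=
  ContDiff ℝ (⊤ : ℕ∞) α ∧ ∀ x v, fderiv ℝ α x (J v) = I * fderiv ℝ α x v

theorem continuous_covDeriv (ħ : ℝ) {θ : S → S →L[ℝ] ℝ} (hθ : ContDiff ℝ (⊤ : ℕ∞) θ)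
    (f : 𝓓((⊤ : TopologicalSpace.Opens S), ℂ)) (v : S) :
    Continuous fun x => covDeriv ħ θ f x v := by
  have h1 : Continuous (fderiv ℝ (f : S → ℂ)) := f.contDiff.continuous_fderiv (by simp)
  have h2 : Continuous θ := hθ.continuous
  have h3 : Continuous (f : S → ℂ) := f.continuous
  unfold covDeriv
  fun_prop

theorem hasCompactSupport_covDeriv (ħ : ℝ) (θ : S → S →L[ℝ] ℝ)
    (f : 𝓓((⊤ : TopologicalSpace.Opens S), ℂ)) (v : S) :
    HasCompactSupport fun x => covDeriv ħ θ f x v := by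
  have h1 : HasCompactSupport fun x => fderiv ℝ (f : S → ℂ) x v :=
    f.hasCompactSupport.fderiv_apply ℝ v
  have h2 : HasCompactSupport fun x => I / (ħ : ℂ) * (θ x v : ℂ) * f x :=
    f.hasCompactSupport.mul_left
  exact h1.add h2

theorem covDeriv_add (ħ : ℝ) (θ : S → S →L[ℝ] ℝ)
    (f g : 𝓓((⊤ : TopologicalSpace.Opens S), ℂ)) (x v : S) :
    covDeriv ħ θ (f + g : 𝓓((⊤ : TopologicalSpace.Opens S), ℂ)) x v
      = covDeriv ħ θ f x v + covDeriv ħ θ g x v := by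
  have hf : DifferentiableAt ℝ (f : S → ℂ) x := f.contDiff.differentiable (by simp) x
  have hg : DifferentiableAt ℝ (g : S → ℂ) x := g.contDiff.differentiable (by simp) x
  have : fderiv ℝ (⇑(f + g)) x = fderiv ℝ f x + fderiv ℝ g x := fderiv_add hf hg
  have h2 : (f + g) x = f x + g x := rfl
  simp only [covDeriv, this, h2, add_apply]
  ring

theorem covDeriv_smul (ħ : ℝ) (θ : S → S →L[ℝ] ℝ) (c : ℂ)
    (f : 𝓓((⊤ : TopologicalSpace.Opens S), ℂ)) (x v : S) :
    covDeriv ħ θ (c • f : 𝓓((⊤ : TopologicalSpace.Opens S), ℂ)) x v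
      = c * covDeriv ħ θ f x v := by
  have hf : DifferentiableAt ℝ (f : S → ℂ) x := f.contDiff.differentiable (by simp) x
  have : fderiv ℝ (⇑(c • f)) x = c • fderiv ℝ f x := fderiv_const_smul hf c
  have h2 : (c • f) x = c * f x := rfl
  simp only [covDeriv, this, h2, smul_apply, smul_eq_mul]
  ring

variable [FiniteDimensional ℝ S] [MeasurableSpace S] [BorelSpace S]

variable (S) in
/-- The Hilbert space of square-integrable sections of `S × ℂ`, for the Riemannian volume. -/
abbrev L2Sections : Type _ := Lp ℂ 2 (volume : Measure S)

variable (S) in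
/-- The Hilbert space of square-integrable one-forms with values in `S × ℂ`, given by their
components in an orthonormal basis of `S` indexed by `ι`. -/
abbrev L2OneForms (ι : Type*) [Fintype ι] : Type _ := PiLp 2 fun _ : ι => L2Sections S

/-- The class in `L²` of a test section. -/
def testToL2 : 𝓓((⊤ : TopologicalSpace.Opens S), ℂ) →ₗ[ℂ] L2Sections S where
  toFun f := (f.continuous.memLp_of_hasCompactSupport (p := 2) (μ := volume)
    f.hasCompactSupport).toLp f
  map_add' _ _ := rfl
  map_smul' _ _ := rfl

theorem testToL2_injective : Function.Injective (testToL2 (S := S)) := by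
  intro f g h
  have h' : (f : S → ℂ) =ᵐ[volume] g :=
    (MemLp.toLp_eq_toLp_iff (f.continuous.memLp_of_hasCompactSupport f.hasCompactSupport)
      (g.continuous.memLp_of_hasCompactSupport g.hasCompactSupport)).1 h
  exact DFunLike.coe_injective ((f.continuous.ae_eq_iff_eq volume g.continuous).1 h')

/-- The covariant derivative `∇_v f` of a test section in the constant direction `v`. -/
def derivTest (ħ : ℝ) {θ : S → S →L[ℝ] ℝ} (hθ : ContDiff ℝ (⊤ : ℕ∞) θ) (v : S) :
    𝓓((⊤ : TopologicalSpace.Opens S), ℂ) →ₗ[ℂ] L2Sections S where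
  toFun f := ((continuous_covDeriv ħ hθ f v).memLp_of_hasCompactSupport (p := 2) (μ := volume)
      (hasCompactSupport_covDeriv ħ θ f v)).toLp fun x => covDeriv ħ θ f x v
  map_add' f g := by
    rw [← MemLp.toLp_add, MemLp.toLp_eq_toLp_iff]
    exact Filter.Eventually.of_forall fun x => covDeriv_add ħ θ f g x v
  map_smul' c f := by
    rw [RingHom.id_apply, ← MemLp.toLp_const_smul, MemLp.toLp_eq_toLp_iff]
    exact Filter.Eventually.of_forall fun x => covDeriv_smul ħ θ c f x v

/-- The covariant derivative of a test section: the one-form whose `j`-th component is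
`∇_{e j} f`. -/
def gradTest {ι : Type*} [Fintype ι] (ħ : ℝ) {θ : S → S →L[ℝ] ℝ}
    (hθ : ContDiff ℝ (⊤ : ℕ∞) θ) (e : OrthonormalBasis ι ℝ S) :
    𝓓((⊤ : TopologicalSpace.Opens S), ℂ) →ₗ[ℂ] L2OneForms S ι :=
  (WithLp.linearEquiv 2 ℂ (ι → L2Sections S)).symm.toLinearMap ∘ₗ
    LinearMap.pi fun j => derivTest ħ hθ (e j)

/-- The connection as an unbounded operator from `L²` sections to `L²` one-forms, with the smooth
compactly supported sections as domain. -/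
def connectionOp {ι : Type*} [Fintype ι] (ħ : ℝ) {θ : S → S →L[ℝ] ℝ}
    (hθ : ContDiff ℝ (⊤ : ℕ∞) θ) (e : OrthonormalBasis ι ℝ S) :
    L2Sections S →ₗ.[ℂ] L2OneForms S ι where
  domain := LinearMap.range (testToL2 (S := S))
  toFun := gradTest ħ hθ e ∘ₗ
    (LinearEquiv.ofInjective (testToL2 (S := S)) testToL2_injective).symm.toLinearMap

/-- The Bochner Laplacian `∇* ∇` as an unbounded operator on the `L²` sections, where `∇` is the
closed operator given by the connection. -/
def bochnerLaplacian {ι : Type*} [Fintype ι] (ħ : ℝ) {θ : S → S →L[ℝ] ℝ}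
    (hθ : ContDiff ℝ (⊤ : ℕ∞) θ) (e : OrthonormalBasis ι ℝ S) :
    L2Sections S →ₗ.[ℂ] L2Sections S :=
  adjointCompClosure (connectionOp ħ hθ e)

end Bundle

end

/-! The polar decomposition `E⁻¹ = -J|E|⁻¹` reduces the problem to N commuting oscillators. The
symmetric operator `|E|⁻¹` commutes with the skew complex structure `J`, so it has a unitary
eigenframe, in which ω, η and J are explicit (`exists_isUnitaryFrame`). Since dθ = -ω, the one-form
θ + ½ω(x,·) is closed, hence equal to some dχ. Dividing sections by the nowhere vanishing function G
= exp(-η/4ħ - iχ/ħ) turns the covariant derivatives along the frame into a_i + ∂̄_i and i(a_i -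
∂̄_i), where a_i = ∂_i - k_i z̄_i, k_i = ϑ_i/2ħ and [∂̄_i, a_j] = -δ_ij k_j. Minus the sum of their
squares is ∑ (2k_i - 4a_i∂̄_i). On the joint eigenspace where -a_i∂̄_i = k_i n_i for all i this is
the number (1/ħ)∑(2n_i+1)ϑ_i. These eigenspaces span all polynomials in z and z̄
(`holomorphicPolynomials_sup_levelSpace`).

The analysis makes these algebraic eigenvectors into a spectral decomposition. Polynomials times G
are in the domain of the Laplacian: cutoffs approximate them in the graph norm, and integration by
parts evaluates the adjoint (`polyToL2_mem_eigenSubmodule`). They are dense, because Gaussian decay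
lets the moments determine a Fourier transform (`dense_range_polyToL2`). For a densely defined
closable T, the operator T*T̄ is symmetric with closed graph; together with a dense span of
eigenvectors this already yields a diagonal resolvent, so the spectrum is the set of eigenvalues
once that set is closed (`opSpectrum_eq_of_dense_eigenvectors`). Self-adjointness is not a separate
input.

The lowest eigenspace has two descriptions (`eigenSubmodule_landauLevel_zero`). It is the closure of
the holomorphic polynomials times G, and L² limits of holomorphic functions times G keep that form
by the mean value property. It is also the orthogonal complement of the levels n ≠ 0. Every
polynomial of such a level is in the image of some a_i, and a square-integrable holomorphic section
is orthogonal to these images by integration by parts. The two descriptions give the two inclusions.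
For the symmetric potential χ = 0 is admissible, and G becomes the Fock space Gaussian. -/

noncomputable section

/-! ### Polar decomposition of `E` and unitary frames. -/

section StructureOperators

variable {S : Type*} [NormedAddCommGroup S] [InnerProductSpace ℝ S] [FiniteDimensional ℝ S]

theorem structureInv_skew {ω : LinearMap.BilinForm ℝ S} (hω : ω.IsAlt) (v w : S) :
    inner ℝ (structureInv ω v) w = -inner ℝ v (structureInv ω w) := by
  rw [real_inner_comm, inner_structureInv, inner_structureInv]
  exact (hω.neg_eq v w).symm

theorem isUnit_of_injective {T : Module.End ℝ S} (h : ∀ v, T v = 0 → v = 0) : IsUnit T := by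
  rw [Module.End.isUnit_iff]
  have hi : Function.Injective T := (injective_iff_map_eq_zero T).2 h
  exact ⟨hi, LinearMap.injective_iff_surjective.1 hi⟩

theorem isUnit_structureInv {ω : LinearMap.BilinForm ℝ S} (hω : ω.Nondegenerate) :
    IsUnit (structureInv ω) := by
  refine isUnit_of_injective fun w hw => hω.2 w fun v => ?_
  rw [← inner_structureInv, hw, inner_zero_right]

theorem structureInv_structureOp {ω : LinearMap.BilinForm ℝ S} (hω : ω.Nondegenerate) (v : S) :
    structureInv ω (structureOp ω v) = v :=
  LinearMap.congr_fun (Ring.mul_inverse_cancel _ (isUnit_structureInv hω)) v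

theorem structureOp_structureInv {ω : LinearMap.BilinForm ℝ S} (hω : ω.Nondegenerate) (v : S) :
    structureOp ω (structureInv ω v) = v :=
  LinearMap.congr_fun (Ring.inverse_mul_cancel _ (isUnit_structureInv hω)) v

theorem structureOp_skew {ω : LinearMap.BilinForm ℝ S} (hω : ω.IsAlt) (hn : ω.Nondegenerate)
    (v w : S) : inner ℝ (structureOp ω v) w = -inner ℝ v (structureOp ω w) := by
  have := structureInv_skew hω (structureOp ω v) (structureOp ω w)
  rw [structureInv_structureOp hn, structureInv_structureOp hn] at this
  linarith

theorem adjoint_structureOp {ω : LinearMap.BilinForm ℝ S} (hω : ω.IsAlt) (hn : ω.Nondegenerate) :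
    LinearMap.adjoint (structureOp ω) = -structureOp ω := by
  symm
  rw [LinearMap.eq_adjoint_iff]
  intro v w
  rw [LinearMap.neg_apply, inner_neg_left, structureOp_skew hω hn, neg_neg]

/-- The modulus of `T` acts on every eigenvector of `T* T` by the root of its eigenvalue. -/
theorem modulus_apply_of_eigenvector (T : Module.End ℝ S) {v : S} {μ : ℝ}
    (hv : LinearMap.adjoint T (T v) = μ • v) : modulus T v = √μ • v := by
  have h : (LinearMap.adjoint T ∘ₗ T).IsSymmetric :=
    (LinearMap.isPositive_adjoint_comp_self T).isSymmetric
  set b := h.eigenvectorBasis rfl with hb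
  have key : ∀ i, inner ℝ (b i) v * √(h.eigenvalues rfl i) = inner ℝ (b i) v * √μ := by
    intro i
    have h1 : inner ℝ ((LinearMap.adjoint T ∘ₗ T) (b i)) v
        = inner ℝ (b i) ((LinearMap.adjoint T ∘ₗ T) v) := h _ _
    rw [hb, h.apply_eigenvectorBasis, LinearMap.comp_apply, hv, inner_smul_left,
      inner_smul_right] at h1
    simp only [RCLike.ofReal_real_eq_id, id_eq, conj_trivial] at h1
    rcases eq_or_ne (inner ℝ (b i) v) 0 with h0 | h0
    · rw [h0, zero_mul, zero_mul]
    · rw [mul_right_cancel₀ h0 h1]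
  conv_lhs => rw [← b.sum_repr' v]
  conv_rhs => rw [← b.sum_repr' v]
  rw [map_sum, Finset.smul_sum]
  refine Finset.sum_congr rfl fun i _ => ?_
  rw [map_smul, hb, modulus_apply_eigenvectorBasis, smul_smul, ← hb, key, smul_smul, mul_comm]

/-- As `E* = -E`, the operator `E⁻¹` commutes with `E*E` and so preserves its eigenspaces, on each
of which the modulus is a scalar. -/
theorem modulus_structureOp_structureInv {ω : LinearMap.BilinForm ℝ S} (hω : ω.IsAlt)
    (hn : ω.Nondegenerate) (v : S) :
    modulus (structureOp ω) (structureInv ω v) = structureInv ω (modulus (structureOp ω) v) := by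
  set T := structureOp ω with hT
  have h : (LinearMap.adjoint T ∘ₗ T).IsSymmetric :=
    (LinearMap.isPositive_adjoint_comp_self T).isSymmetric
  have key : modulus T ∘ₗ structureInv ω = structureInv ω ∘ₗ modulus T := by
    refine (h.eigenvectorBasis rfl).toBasis.ext fun i => ?_
    have e := h.apply_eigenvectorBasis rfl i
    simp only [OrthonormalBasis.coe_toBasis, LinearMap.comp_apply] at e ⊢
    rw [modulus_apply_eigenvectorBasis, map_smul]
    refine modulus_apply_of_eigenvector T ?_
    simp only [hT, adjoint_structureOp hω hn, LinearMap.neg_apply] at e ⊢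
    rw [structureOp_structureInv hn]
    have e' := congrArg (structureInv ω) e
    rw [map_neg, structureInv_structureOp hn, map_smul] at e'
    exact e'
  exact LinearMap.congr_fun key v

theorem modulus_structureOp_modulus {ω : LinearMap.BilinForm ℝ S} (hω : ω.IsAlt)
    (hn : ω.Nondegenerate) (v : S) :
    modulus (structureOp ω) (modulus (structureOp ω) v) = -structureOp ω (structureOp ω v) := by
  have := LinearMap.congr_fun (modulus_comp_modulus (structureOp ω)) v
  simpa [adjoint_structureOp hω hn] using this

theorem isUnit_modulus_structureOp {ω : LinearMap.BilinForm ℝ S} (hω : ω.IsAlt)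
    (hn : ω.Nondegenerate) : IsUnit (modulus (structureOp ω)) := by
  refine isUnit_of_injective fun v hv => ?_
  have h := modulus_structureOp_modulus hω hn v
  rw [hv, map_zero, eq_comm, neg_eq_zero] at h
  rw [← structureInv_structureOp hn v, ← structureInv_structureOp hn (structureOp ω v), h]
  simp

theorem modulus_invModulus {ω : LinearMap.BilinForm ℝ S} (hω : ω.IsAlt) (hn : ω.Nondegenerate)
    (v : S) : modulus (structureOp ω) (invModulus ω v) = v :=
  LinearMap.congr_fun (Ring.mul_inverse_cancel _ (isUnit_modulus_structureOp hω hn)) v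

theorem invModulus_modulus {ω : LinearMap.BilinForm ℝ S} (hω : ω.IsAlt) (hn : ω.Nondegenerate)
    (v : S) : invModulus ω (modulus (structureOp ω) v) = v :=
  LinearMap.congr_fun (Ring.inverse_mul_cancel _ (isUnit_modulus_structureOp hω hn)) v

theorem invModulus_isSymmetric {ω : LinearMap.BilinForm ℝ S} (hω : ω.IsAlt)
    (hn : ω.Nondegenerate) : (invModulus ω).IsSymmetric := by
  intro v w
  have := (modulus_isPositive (structureOp ω)).isSymmetric (invModulus ω v) (invModulus ω w)
  rw [modulus_invModulus hω hn, modulus_invModulus hω hn] at this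
  exact this.symm

theorem complexStructure_apply (ω : LinearMap.BilinForm ℝ S) (v : S) :
    complexStructure ω v = -structureInv ω (modulus (structureOp ω) v) := rfl

theorem complexStructure_complexStructure {ω : LinearMap.BilinForm ℝ S} (hω : ω.IsAlt)
    (hn : ω.Nondegenerate) (v : S) : complexStructure ω (complexStructure ω v) = -v := by
  simp only [complexStructure_apply, map_neg, neg_neg, modulus_structureOp_structureInv hω hn,
    modulus_structureOp_modulus hω hn, structureInv_structureOp hn]

theorem complexStructure_skew {ω : LinearMap.BilinForm ℝ S} (hω : ω.IsAlt)
    (hn : ω.Nondegenerate) (v w : S) :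
    inner ℝ (complexStructure ω v) w = -inner ℝ v (complexStructure ω w) := by
  simp only [complexStructure_apply, inner_neg_left, inner_neg_right, neg_neg]
  rw [structureInv_skew hω, neg_neg,
    (modulus_isPositive (structureOp ω)).isSymmetric, modulus_structureOp_structureInv hω hn]

theorem invModulus_complexStructure {ω : LinearMap.BilinForm ℝ S} (hω : ω.IsAlt)
    (hn : ω.Nondegenerate) (v : S) :
    invModulus ω (complexStructure ω v) = complexStructure ω (invModulus ω v) := by
  rw [complexStructure_apply, complexStructure_apply, ← modulus_structureOp_structureInv hω hn,
    ← modulus_structureOp_structureInv hω hn, map_neg, invModulus_modulus hω hn,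
    modulus_structureOp_structureInv hω hn, modulus_invModulus hω hn]

/-- The polar decomposition, through which ω is evaluated in terms of `J` and the eigenvalues of
`|E|⁻¹`. -/
theorem structureInv_eq {ω : LinearMap.BilinForm ℝ S} (hω : ω.IsAlt)
    (hn : ω.Nondegenerate) (v : S) :
    structureInv ω v = -complexStructure ω (invModulus ω v) := by
  rw [complexStructure_apply, modulus_invModulus hω hn, neg_neg]

theorem pos_of_invModulus_eigenvector {ω : LinearMap.BilinForm ℝ S} (hω : ω.IsAlt)
    (hn : ω.Nondegenerate) {v : S} {t : ℝ} (hv : v ≠ 0) (h : invModulus ω v = t • v) : 0 < t := by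
  have h1 : t • modulus (structureOp ω) v = v := by
    rw [← map_smul, ← h, modulus_invModulus hω hn]
  have h2 := (modulus_isPositive (structureOp ω)).2 v
  have h3 : 0 < inner ℝ v v := real_inner_self_pos.2 hv
  nth_rewrite 1 [← h1] at h3
  rw [inner_smul_left] at h3
  exact pos_of_mul_pos_left h3 h2

/-- A symmetric operator commuting with a skew complex structure `J` has arbitrarily long (up to
half the dimension) unitary systems of eigenvectors. -/
theorem exists_unitary_eigenvectors {B J : Module.End ℝ S} (hB : B.IsSymmetric)
    (hJ : ∀ v w, inner ℝ (J v) w = -inner ℝ v (J w))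
    (hBJ : ∀ v, B (J v) = J (B v)) (k : ℕ) (hk : 2 * k ≤ Module.finrank ℝ S) :
    ∃ (u : Fin k → S) (ϑ : Fin k → ℝ),
      (∀ i j, inner ℝ (u i) (u j) = if i = j then (1 : ℝ) else 0) ∧
      (∀ i j, inner ℝ (u i) (J (u j)) = (0 : ℝ)) ∧ ∀ i, B (u i) = ϑ i • u i := by
  induction k with
  | zero => exact ⟨Fin.elim0, Fin.elim0, fun i => i.elim0, fun i => i.elim0, fun i => i.elim0⟩
  | succ k ih =>
    obtain ⟨u, ϑ, h1, h2, h3⟩ := ih (by omega)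
    let W : Submodule ℝ S := Submodule.span ℝ (Set.range (Sum.elim u fun i => J (u i)))
    have hW : Module.finrank ℝ W ≤ 2 * k := by
      refine (finrank_range_le_card _).trans ?_
      simp; omega
    -- Skewness moves `J` from `u i` to `v`. In this form the invariance of the complement under `B`
    -- follows from symmetry and commutation with `J`.
    have hmem : ∀ v : S, v ∈ Wᗮ ↔ (∀ i, inner ℝ (u i) v = (0 : ℝ)) ∧
        ∀ i, inner ℝ (u i) (J v) = (0 : ℝ) := by
      intro v
      rw [Submodule.mem_orthogonal]
      constructor
      · intro h
        refine ⟨fun i => h _ (Submodule.subset_span ⟨Sum.inl i, rfl⟩), fun i => ?_⟩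
        have := h _ (Submodule.subset_span ⟨Sum.inr i, rfl⟩)
        rw [Sum.elim_inr, hJ, neg_eq_zero] at this
        exact this
      · rintro ⟨h, h'⟩ w hw
        induction hw using Submodule.span_induction with
        | mem x hx =>
          obtain ⟨i | i, rfl⟩ := hx
          · exact h i
          · rw [Sum.elim_inr, hJ, h', neg_zero]
        | zero => exact inner_zero_left _
        | add x y _ _ hx hy => rw [inner_add_left, hx, hy, add_zero]
        | smul a x _ hx => rw [inner_smul_left, hx, mul_zero]
    have hBW : ∀ v ∈ Wᗮ, B v ∈ Wᗮ := by
      intro v hv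
      rw [hmem] at hv ⊢
      constructor
      · intro i
        rw [← hB, h3, inner_smul_left, hv.1, mul_zero]
      · intro i
        rw [← hBJ, ← hB, h3, inner_smul_left, hv.2, mul_zero]
    -- The span has dimension at most 2k, and 2k + 2 dimensions are available.
    have hne : Nontrivial Wᗮ := by
      have := W.finrank_add_finrank_orthogonal
      exact Module.nontrivial_of_finrank_pos (R := ℝ) (by omega)
    have hsym : (B.restrict hBW).IsSymmetric := hB.restrict_invariant hBW
    obtain ⟨t, ht⟩ : ∃ t : ℝ, Module.End.HasEigenvalue (B.restrict hBW) t := by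
      by_contra! hcon
      have := hsym.subsingleton_of_no_eigenvalue_finiteDimensional fun μ => by
        simpa [Module.End.hasEigenvalue_iff] using hcon μ
      exact not_subsingleton _ this
    obtain ⟨x, hx⟩ := ht.exists_hasEigenvector
    have hx0 : ‖(x : S)‖ ≠ 0 := by simpa using hx.2
    let v : S := ‖(x : S)‖⁻¹ • (x : S)
    have hvW : v ∈ Wᗮ := Submodule.smul_mem _ _ x.2
    have hBv : B v = t • v := by
      have : B (x : S) = t • (x : S) := congrArg Subtype.val hx.apply_eq_smul
      simp only [v, map_smul, this, smul_comm t]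
    have hv1 : inner ℝ v v = (1 : ℝ) := by
      rw [real_inner_self_eq_norm_sq, norm_smul, norm_inv, norm_norm, inv_mul_cancel₀ hx0, one_pow]
    have hvJ : inner ℝ v (J v) = (0 : ℝ) := by
      have := hJ v v
      rw [real_inner_comm] at this
      linarith
    obtain ⟨a1, a2⟩ := (hmem v).1 hvW
    have a3 : ∀ i, inner ℝ v (J (u i)) = (0 : ℝ) := fun i => by
      have := hJ v (u i)
      rw [real_inner_comm, a2] at this
      linarith
    refine ⟨Fin.snoc u v, Fin.snoc ϑ t, ?_, ?_, ?_⟩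
    · intro i j
      refine Fin.lastCases ?_ (fun i => ?_) i <;> refine Fin.lastCases ?_ (fun j => ?_) j
      · rw [Fin.snoc_last, hv1, if_pos rfl]
      · simp [real_inner_comm, a1, (Fin.castSucc_lt_last j).ne']
      · simp [a1, (Fin.castSucc_lt_last i).ne]
      · simp [h1]
    · intro i j
      refine Fin.lastCases ?_ (fun i => ?_) i <;> refine Fin.lastCases ?_ (fun j => ?_) j
      · simp [hvJ]
      · simp [a3]
      · simp [a2]
      · simp [h2]
    · intro i
      refine Fin.lastCases ?_ (fun i => ?_) i
      · simp [hBv]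
      · simp [h3]

/-- An orthonormal basis adapted to the complex structure and diagonalizing `|E|⁻¹`. -/
structure IsUnitaryFrame {N : ℕ} (ω : LinearMap.BilinForm ℝ S)
    (u : OrthonormalBasis (Fin N ⊕ Fin N) ℝ S) (ϑ : Fin N → ℝ) : Prop where
  apply_inr : ∀ i, u (Sum.inr i) = complexStructure ω (u (Sum.inl i))
  invModulus_inl : ∀ i, invModulus ω (u (Sum.inl i)) = ϑ i • u (Sum.inl i)
  pos : ∀ i, 0 < ϑ i

theorem exists_isUnitaryFrame {N : ℕ} (hN : Module.finrank ℝ S = 2 * N)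
    {ω : LinearMap.BilinForm ℝ S} (hω : ω.IsAlt) (hn : ω.Nondegenerate) :
    ∃ (u : OrthonormalBasis (Fin N ⊕ Fin N) ℝ S) (ϑ : Fin N → ℝ), IsUnitaryFrame ω u ϑ := by
  have hJ := complexStructure_skew hω hn
  obtain ⟨u, ϑ, h1, h2, h3⟩ := exists_unitary_eigenvectors (invModulus_isSymmetric hω hn)
    hJ (invModulus_complexStructure hω hn) N hN.ge
  have ho : Orthonormal ℝ (Sum.elim u fun i => complexStructure ω (u i)) := by
    rw [orthonormal_iff_ite]
    rintro (i | i) (j | j)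
    · simp [h1]
    · simp [h2]
    · simp [hJ, h2]
    · simp only [Sum.elim_inr, hJ, complexStructure_complexStructure hω hn, inner_neg_right,
        neg_neg, h1, Sum.inr.injEq]
  have hc : Fintype.card (Fin N ⊕ Fin N) = Module.finrank ℝ S := by simp [hN]; omega
  have hs := (basisOfLinearIndependentOfCardEqFinrank' _ ho.linearIndependent hc).span_eq
  rw [coe_basisOfLinearIndependentOfCardEqFinrank'] at hs
  refine ⟨OrthonormalBasis.mk ho hs.ge, ϑ, ?_, ?_, ?_⟩
  · simp
  · simp [h3]
  · intro i
    refine pos_of_invModulus_eigenvector hω hn (v := u i) (fun h => ?_) (h3 i)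
    simpa [h] using h1 i i

namespace IsUnitaryFrame

variable {N : ℕ} {ω : LinearMap.BilinForm ℝ S} {u : OrthonormalBasis (Fin N ⊕ Fin N) ℝ S}
  {ϑ : Fin N → ℝ}

theorem complexStructure_inr (h : IsUnitaryFrame ω u ϑ) (hω : ω.IsAlt) (hn : ω.Nondegenerate)
    (i : Fin N) : complexStructure ω (u (Sum.inr i)) = -u (Sum.inl i) := by
  rw [h.apply_inr, complexStructure_complexStructure hω hn]

theorem invModulus_inr (h : IsUnitaryFrame ω u ϑ) (hω : ω.IsAlt) (hn : ω.Nondegenerate)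
    (i : Fin N) : invModulus ω (u (Sum.inr i)) = ϑ i • u (Sum.inr i) := by
  rw [h.apply_inr, invModulus_complexStructure hω hn, h.invModulus_inl, map_smul]

theorem form_inl (h : IsUnitaryFrame ω u ϑ) (hω : ω.IsAlt) (hn : ω.Nondegenerate)
    (x : S) (i : Fin N) : ω x (u (Sum.inl i)) = -(ϑ i * inner ℝ (u (Sum.inr i)) x) := by
  rw [← inner_structureInv, structureInv_eq hω hn, h.invModulus_inl, map_smul, ← h.apply_inr,
    inner_neg_right, inner_smul_right, real_inner_comm]

theorem form_inr (h : IsUnitaryFrame ω u ϑ) (hω : ω.IsAlt) (hn : ω.Nondegenerate)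
    (x : S) (i : Fin N) : ω x (u (Sum.inr i)) = ϑ i * inner ℝ (u (Sum.inl i)) x := by
  rw [← inner_structureInv, structureInv_eq hω hn, h.invModulus_inr hω hn, map_smul,
    h.complexStructure_inr hω hn, smul_neg, neg_neg, inner_smul_right, real_inner_comm]

theorem etaForm_inl (h : IsUnitaryFrame ω u ϑ)
    (x : S) (i : Fin N) : etaForm ω x (u (Sum.inl i)) = ϑ i * inner ℝ (u (Sum.inl i)) x := by
  rw [etaForm, h.invModulus_inl, inner_smul_right, real_inner_comm]

theorem etaForm_inr (h : IsUnitaryFrame ω u ϑ) (hω : ω.IsAlt) (hn : ω.Nondegenerate)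
    (x : S) (i : Fin N) : etaForm ω x (u (Sum.inr i)) = ϑ i * inner ℝ (u (Sum.inr i)) x := by
  rw [etaForm, h.invModulus_inr hω hn, inner_smul_right, real_inner_comm]

theorem etaForm_self (h : IsUnitaryFrame ω u ϑ) (hω : ω.IsAlt) (hn : ω.Nondegenerate) (x : S) :
    etaForm ω x x = ∑ s, Sum.elim ϑ ϑ s * inner ℝ (u s) x ^ 2 := by
  have : ∀ s, inner ℝ (u s) (invModulus ω x) = Sum.elim ϑ ϑ s * inner ℝ (u s) x := by
    intro s
    rw [← invModulus_isSymmetric hω hn]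
    rcases s with i | i
    · rw [h.invModulus_inl, inner_smul_left]; rfl
    · rw [h.invModulus_inr hω hn, inner_smul_left]; rfl
  rw [etaForm, ← u.sum_inner_mul_inner]
  refine Finset.sum_congr rfl fun s _ => ?_
  rw [this, real_inner_comm]
  ring

theorem trace_invModulus (h : IsUnitaryFrame ω u ϑ) (hω : ω.IsAlt) (hn : ω.Nondegenerate) :
    LinearMap.trace ℝ S (invModulus ω) = 2 * ∑ i, ϑ i := by
  rw [LinearMap.trace_eq_sum_inner _ u, Fintype.sum_sum_type, two_mul]
  congr 1
  · refine Finset.sum_congr rfl fun i _ => ?_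
    rw [h.invModulus_inl, inner_smul_right]; simp
  · refine Finset.sum_congr rfl fun i _ => ?_
    rw [h.invModulus_inr hω hn, inner_smul_right]; simp

/-- Scaling a unitary frame gives diagonal coordinates with metric components `δ_{ij} / ϑ_i`. -/
theorem exists_isDiagonalCoordinates (h : IsUnitaryFrame ω u ϑ) (hω : ω.IsAlt)
    (hn : ω.Nondegenerate) :
    ∃ b : Module.Basis (Fin N ⊕ Fin N) ℝ S, IsDiagonalCoordinates ω b ϑ ∧
      ∀ i j, metricComponent b i j = if i = j then ((1 / ϑ i : ℝ) : ℂ) else 0 := by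
  -- A frame scaled by c has diagonal metric components (c² + c²)/4 = c²/2, which must equal 1/ϑ.
  let c : Fin N → ℝ := fun i => √(2 / ϑ i)
  have hc : ∀ i, 0 < c i := fun i => Real.sqrt_pos.2 (div_pos two_pos (h.pos i))
  let b : Module.Basis (Fin N ⊕ Fin N) ℝ S :=
    Module.Basis.isUnitSMul u.toBasis (w := Sum.elim c c) (by rintro (i | i) <;> simp [(hc i).ne'])
  have hl : ∀ i, b (Sum.inl i) = c i • u (Sum.inl i) := fun i => by
    simp [b, Module.Basis.isUnitSMul_apply]
  have hr : ∀ i, b (Sum.inr i) = c i • u (Sum.inr i) := fun i => by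
    simp [b, Module.Basis.isUnitSMul_apply]
  refine ⟨b, fun i => ⟨?_, ?_, ?_⟩, fun i j => ?_⟩
  · rw [hl, hr, h.apply_inr, map_smul]
  · rw [hl, map_smul, h.invModulus_inl, smul_comm]
  · rw [hr, map_smul, h.invModulus_inr hω hn, smul_comm]
  · simp only [metricComponent, hl, hr, inner_smul_left, inner_smul_right,
      orthonormal_iff_ite.1 u.orthonormal]
    rcases eq_or_ne i j with rfl | hij
    · have h2 : c i * c i = 2 / ϑ i := Real.mul_self_sqrt (div_pos two_pos (h.pos i)).le
      have h3 : ((c i : ℂ)) * c i = 2 / ϑ i := by exact_mod_cast h2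
      simp [h3]
      ring
    · simp [hij]

theorem isDiagonalCoordinates (h : IsUnitaryFrame ω u ϑ) (hω : ω.IsAlt)
    (hn : ω.Nondegenerate) : IsDiagonalCoordinates ω u.toBasis ϑ := fun i => by
  simpa using ⟨h.apply_inr i, h.invModulus_inl i, h.invModulus_inr hω hn i⟩

end IsUnitaryFrame

/-- The fibres of `f` and `g` over each value have the same cardinality; bijections between them
glue to a permutation. -/
theorem exists_perm_of_map_univ_eq {α β : Type*} [Fintype α] {f g : α → β}
    (h : Finset.univ.val.map f = Finset.univ.val.map g) : ∃ σ : Equiv.Perm α, f = g ∘ σ := by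
  classical
  have hcard : ∀ b, Fintype.card {a // f a = b} = Fintype.card {a // g a = b} := by
    intro b
    have := congrArg (Multiset.count b) h
    rw [Multiset.count_map, Multiset.count_map] at this
    rw [Fintype.card_subtype, Fintype.card_subtype]
    simpa [Finset.card, Finset.filter, eq_comm] using this
  let e : ∀ b, {a // f a = b} ≃ {a // g a = b} := fun b => Fintype.equivOfCardEq (hcard b)
  refine ⟨(Equiv.sigmaFiberEquiv f).symm.trans
    ((Equiv.sigmaCongrRight e).trans (Equiv.sigmaFiberEquiv g)), funext fun a => ?_⟩
  exact (e (f a) ⟨a, rfl⟩).2.symm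

/-- The diagonal components of `|E|⁻¹` are unique up to a permutation. -/
theorem IsDiagonalCoordinates.exists_perm {N : ℕ} {ω : LinearMap.BilinForm ℝ S}
    {b b' : Module.Basis (Fin N ⊕ Fin N) ℝ S} {ϑ ϑ' : Fin N → ℝ}
    (h : IsDiagonalCoordinates ω b ϑ) (h' : IsDiagonalCoordinates ω b' ϑ') :
    ∃ σ : Equiv.Perm (Fin N), ϑ = ϑ' ∘ σ := by
  -- The real characteristic polynomial sees each component twice, along ∂/∂xⁱ and ∂/∂yⁱ. Comparing
  -- multiplicities at the end cancels the factor 2.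
  have key : ∀ {b : Module.Basis (Fin N ⊕ Fin N) ℝ S} {ϑ : Fin N → ℝ},
      IsDiagonalCoordinates ω b ϑ → (LinearMap.charpoly (invModulus ω)).roots
        = Finset.univ.val.map ϑ + Finset.univ.val.map ϑ := by
    intro b ϑ h
    have hm : LinearMap.toMatrix b b (invModulus ω) = Matrix.diagonal (Sum.elim ϑ ϑ) := by
      ext s t
      rw [LinearMap.toMatrix_apply]
      rcases t with i | i
      · rw [(h i).2.1, map_smul, Module.Basis.repr_self]
        simp [Matrix.diagonal, Finsupp.single_apply, eq_comm]
        rcases s with j | j <;> simp +contextual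
      · rw [(h i).2.2, map_smul, Module.Basis.repr_self]
        simp [Matrix.diagonal, Finsupp.single_apply, eq_comm]
        rcases s with j | j <;> simp +contextual
    rw [← LinearMap.charpoly_toMatrix _ b, hm, Matrix.charpoly_diagonal]
    have : (Finset.univ.val.map ϑ + Finset.univ.val.map ϑ : Multiset ℝ)
        = (Finset.univ : Finset (Fin N ⊕ Fin N)).val.map (Sum.elim ϑ ϑ) := by
      simp [← Finset.univ_disjSum_univ, Finset.disjSum, Multiset.disjSum]
    rw [this, ← Polynomial.roots_multiset_prod_X_sub_C (Multiset.map _ _), Multiset.map_map]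
    rfl
  refine exists_perm_of_map_univ_eq ?_
  have := (key h).symm.trans (key h')
  rw [← two_nsmul, ← two_nsmul] at this
  ext a
  have h3 := congrArg (Multiset.count a) this
  rw [Multiset.count_nsmul, Multiset.count_nsmul] at h3
  omega

end StructureOperators

/-! ### Symmetry and closedness of T*T̄. -/

section AdjointCompClosure

open scoped LinearPMap

variable {H K : Type*} [NormedAddCommGroup H] [InnerProductSpace ℂ H] [CompleteSpace H]
  [NormedAddCommGroup K] [InnerProductSpace ℂ K]

theorem mem_graph_adjoint_iff {T : H →ₗ.[ℂ] K} (hT : Dense (T.domain : Set H)) (v : K) (w : H) :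
    (v, w) ∈ T†.graph ↔ ∀ x : T.domain, inner ℂ w (x : H) = inner ℂ v (T x) := by
  rw [LinearPMap.mem_graph_iff]
  constructor
  · rintro ⟨y, rfl, rfl⟩ x
    exact LinearPMap.adjoint_isFormalAdjoint hT y x
  · intro h
    have hv := LinearPMap.mem_adjoint_domain_of_exists v ⟨w, h⟩
    exact ⟨⟨v, hv⟩, rfl, LinearPMap.adjoint_apply_eq hT ⟨v, hv⟩ h⟩

/-- For fixed (v, w) the adjoint relation is a closed condition on the other pair, so it passes from
the graph of T to its closure; this is T* = T̄*. -/
theorem inner_eq_of_mem_graph_adjoint {T : H →ₗ.[ℂ] K} (hT : Dense (T.domain : Set H))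
    (hc : T.IsClosable) {v : K} {w : H} (h : (v, w) ∈ T†.graph) {u : H} {v' : K}
    (h' : (u, v') ∈ T.closure.graph) : inner ℂ w u = inner ℂ v v' := by
  rw [← hc.graph_closure_eq_closure_graph] at h'
  have hclosed : IsClosed {p : H × K | inner ℂ w p.1 = inner ℂ v p.2} :=
    isClosed_eq (by fun_prop) (by fun_prop)
  have hsub : (T.graph : Set (H × K)) ⊆ {p : H × K | inner ℂ w p.1 = inner ℂ v p.2} := by
    rintro ⟨a, b⟩ hab
    obtain ⟨x, rfl, rfl⟩ := T.mem_graph_iff.1 hab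
    exact (mem_graph_adjoint_iff hT v w).1 h x
  exact closure_minimal hsub hclosed h'

/-- Both sides equal the inner product of T̄u and T̄u'. -/
theorem inner_eq_of_mem_graph_adjointCompClosure {T : H →ₗ.[ℂ] K}
    (hT : Dense (T.domain : Set H)) (hc : T.IsClosable) {u w u' w' : H}
    (h : (u, w) ∈ (adjointCompClosure T).graph) (h' : (u', w') ∈ (adjointCompClosure T).graph) :
    inner ℂ w u' = inner ℂ u w' := by
  obtain ⟨v, h1, h2⟩ := (mem_graph_adjointCompClosure T u w).1 h
  obtain ⟨v', h3, h4⟩ := (mem_graph_adjointCompClosure T u' w').1 h'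
  rw [inner_eq_of_mem_graph_adjoint hT hc h2 h3, ← inner_conj_symm u w',
    inner_eq_of_mem_graph_adjoint hT hc h4 h1, inner_conj_symm]

/-- The identity ⟨T*T̄u, u⟩ = ‖T̄u‖² and Cauchy–Schwarz make the intermediate vectors T̄u_n Cauchy
whenever u_n and T*T̄u_n converge. Their limit passes through the closed graphs of T̄ and of T*. -/
theorem isClosed_graph_adjointCompClosure [CompleteSpace K] {T : H →ₗ.[ℂ] K}
    (hT : Dense (T.domain : Set H)) (hc : T.IsClosable) :
    IsClosed ((adjointCompClosure T).graph : Set (H × H)) := by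
  refine IsSeqClosed.isClosed fun p q hp hpq => ?_
  have hp' := fun n => (mem_graph_adjointCompClosure T (p n).1 (p n).2).1 (hp n)
  choose v h1 h2 using hp'
  have key : ∀ m n, ‖v m - v n‖ ^ 2 ≤ ‖(p m).2 - (p n).2‖ * ‖(p m).1 - (p n).1‖ := by
    intro m n
    have e : inner ℂ ((p m).2 - (p n).2) ((p m).1 - (p n).1)
        = inner ℂ (v m - v n) (v m - v n) :=
      inner_eq_of_mem_graph_adjoint hT hc (T†.graph.sub_mem (h2 m) (h2 n))
        (T.closure.graph.sub_mem (h1 m) (h1 n))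
    have e' : ‖v m - v n‖ ^ 2 = ‖inner ℂ (v m - v n) (v m - v n)‖ := by
      rw [inner_self_eq_norm_sq_to_K]
      simp
    rw [e', ← e]
    exact norm_inner_le_norm _ _
  have hp1 : Filter.Tendsto (fun n => (p n).1) Filter.atTop (nhds q.1) := hpq.fst_nhds
  have hp2 : Filter.Tendsto (fun n => (p n).2) Filter.atTop (nhds q.2) := hpq.snd_nhds
  have hv : CauchySeq v := by
    rw [Metric.cauchySeq_iff]
    intro ε hε
    obtain ⟨N1, hN1⟩ := Metric.cauchySeq_iff.1 hp1.cauchySeq ε hε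
    obtain ⟨N2, hN2⟩ := Metric.cauchySeq_iff.1 hp2.cauchySeq ε hε
    refine ⟨max N1 N2, fun m hm n hn => ?_⟩
    have a1 := hN1 m (le_of_max_le_left hm) n (le_of_max_le_left hn)
    have a2 := hN2 m (le_of_max_le_right hm) n (le_of_max_le_right hn)
    rw [dist_eq_norm] at a1 a2 ⊢
    refine lt_of_pow_lt_pow_left₀ 2 hε.le ((key m n).trans_lt ?_)
    rw [sq]
    exact mul_lt_mul'' a2 a1 (norm_nonneg _) (norm_nonneg _)
  obtain ⟨v', hv'⟩ := cauchySeq_tendsto_of_complete hv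
  refine (mem_graph_adjointCompClosure T q.1 q.2).2 ⟨v', ?_, ?_⟩
  · exact hc.closure_isClosed.mem_of_tendsto (hp1.prodMk_nhds hv')
      (Filter.Eventually.of_forall h1)
  · exact (LinearPMap.adjoint_isClosed hT).mem_of_tendsto (hv'.prodMk_nhds hp2)
      (Filter.Eventually.of_forall h2)

end AdjointCompClosure

/-! ### Closed symmetric operators with a dense span of eigenvectors. -/

section SymmetricOperator

universe u

variable {H : Type u} [NormedAddCommGroup H] [InnerProductSpace ℂ H]

theorem mem_opEigenspace_iff {D : H →ₗ.[ℂ] H} {z : ℂ} {u : H} :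
    u ∈ opEigenspace D z ↔ (u, z • u) ∈ D.graph := by
  rw [LinearPMap.mem_graph_iff]
  constructor
  · rintro ⟨hu, h⟩
    exact ⟨⟨u, hu⟩, rfl, h⟩
  · rintro ⟨⟨x, hx⟩, rfl, h⟩
    exact ⟨hx, h⟩

theorem mem_opSpectrum_of_isOpEigenvalue {D : H →ₗ.[ℂ] H} {z : ℂ} (h : IsOpEigenvalue D z) :
    z ∈ opSpectrum D := by
  rintro ⟨R, -, hR⟩
  obtain ⟨u, ⟨hu, hDu⟩, h0⟩ := h
  have := hR ⟨u, hu⟩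
  rw [hDu, sub_self, map_zero] at this
  exact h0 this.symm

/-- An operator is symmetric. -/
def IsSymmetricOp (D : H →ₗ.[ℂ] H) : Prop :=
  ∀ ⦃u w u' w' : H⦄, (u, w) ∈ D.graph → (u', w') ∈ D.graph → inner ℂ w u' = inner ℂ u w'

/-- The eigenspace of an operator, as a subspace. -/
def eigenSubmodule (D : H →ₗ.[ℂ] H) (z : ℂ) : Submodule ℂ H where
  carrier := {u | (u, z • u) ∈ D.graph}
  add_mem' ha hb := by
    have := D.graph.add_mem ha hb
    rwa [Prod.mk_add_mk, ← smul_add] at this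
  zero_mem' := by
    have := D.graph.zero_mem
    rw [Set.mem_ofPred_eq, smul_zero]
    exact this
  smul_mem' c a ha := by
    have := D.graph.smul_mem c ha
    rwa [Prod.smul_mk, smul_comm c z] at this

theorem coe_eigenSubmodule (D : H →ₗ.[ℂ] H) (z : ℂ) :
    (eigenSubmodule D z : Set H) = opEigenspace D z :=
  Set.ext fun _ => mem_opEigenspace_iff.symm

theorem isClosed_eigenSubmodule {D : H →ₗ.[ℂ] H} (hD : IsClosed (D.graph : Set (H × H))) (z : ℂ) :
    IsClosed (eigenSubmodule D z : Set H) :=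
  hD.preimage (f := fun u : H => (u, z • u)) (by fun_prop)

theorem IsSymmetricOp.inner_eq_zero {D : H →ₗ.[ℂ] H} (hs : IsSymmetricOp D) {a b : ℝ} (hab : a ≠ b)
    {u v : H} (hu : u ∈ eigenSubmodule D a) (hv : v ∈ eigenSubmodule D b) :
    inner ℂ u v = 0 := by
  have := hs hu hv
  rw [inner_smul_left, inner_smul_right, conj_ofReal, ← sub_eq_zero, ← sub_mul] at this
  rcases mul_eq_zero.1 this with h | h
  · exact absurd (by exact_mod_cast sub_eq_zero.1 h) hab
  · exact h

/-- The diagonal operator with bounded entries in a Hilbert basis. -/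
theorem HilbertBasis.exists_diagonal {κ : Type*} (b : HilbertBasis κ ℂ H) {c : κ → ℂ} {M : ℝ}
    (hc : ∀ k, ‖c k‖ ≤ M) :
    ∃ R : H →L[ℂ] H, ∀ f k, inner ℂ (b k) (R f) = c k * inner ℂ (b k) f := by
  have hle : ∀ (f : lp (fun _ : κ => ℂ) 2) (k), ‖c k * f k‖ ≤ ‖((M : ℂ) • f : lp _ 2) k‖ := by
    intro f k
    rw [lp.coeFn_smul, Pi.smul_apply, norm_mul, norm_smul, norm_real, Real.norm_eq_abs]
    exact mul_le_mul_of_nonneg_right ((hc k).trans (le_abs_self M)) (norm_nonneg _)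
  have hmem : ∀ f : lp (fun _ : κ => ℂ) 2, Memℓp (fun k => c k * f k) 2 := fun f =>
    memℓp_gen (Summable.of_nonneg_of_le (fun k => by positivity)
      (fun k => Real.rpow_le_rpow (norm_nonneg _) (hle f k) (by norm_num))
      ((lp.memℓp ((M : ℂ) • f)).summable (by norm_num)))
  let Q : lp (fun _ : κ => ℂ) 2 →ₗ[ℂ] lp (fun _ : κ => ℂ) 2 :=
    { toFun := fun f => ⟨fun k => c k * f k, hmem f⟩
      map_add' := fun f g => by
        ext k; exact mul_add _ _ _
      map_smul' := fun a f => by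
        ext k; exact mul_left_comm _ _ _ }
  have hQ : ∀ f, ‖Q f‖ ≤ |M| * ‖f‖ := by
    intro f
    have : ‖((M : ℂ) • f : lp (fun _ : κ => ℂ) 2)‖ = |M| * ‖f‖ := by
      rw [norm_smul, norm_real, Real.norm_eq_abs]
    rw [← this]
    exact lp.norm_mono (by norm_num) (hle f)
  refine ⟨b.repr.symm.toContinuousLinearEquiv.toContinuousLinearMap ∘L
    (Q.mkContinuous |M| hQ) ∘L b.repr.toContinuousLinearEquiv.toContinuousLinearMap,
    fun f k => ?_⟩
  rw [← b.repr_apply_apply, ← b.repr_apply_apply]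
  simp [Q]

variable [CompleteSpace H]

/-- A closed symmetric operator whose eigenvectors with eigenvalues in `Λ` span a dense subspace
has a Hilbert basis of such eigenvectors. -/
theorem exists_hilbertBasis_eigenvectors {D : H →ₗ.[ℂ] H}
    (hD : IsClosed (D.graph : Set (H × H))) (hs : IsSymmetricOp D) (Λ : Set ℝ)
    (hd : Dense ((⨆ a ∈ Λ, eigenSubmodule D (a : ℝ) : Submodule ℂ H) : Set H)) :
    ∃ (κ : Type u) (b : HilbertBasis κ ℂ H) (m : κ → ℝ),
      ∀ k, m k ∈ Λ ∧ b k ∈ eigenSubmodule D (m k) := by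
  have hcomp : ∀ a : Λ, CompleteSpace (eigenSubmodule D ((a : ℝ) : ℂ)) := fun a =>
    (isClosed_eigenSubmodule hD _).completeSpace_coe
  have hof : OrthogonalFamily ℂ (fun a : Λ => eigenSubmodule D ((a : ℝ) : ℂ))
      fun a => (eigenSubmodule D ((a : ℝ) : ℂ)).subtypeₗᵢ := by
    rintro a a' haa' ⟨u, hu⟩ ⟨v, hv⟩
    exact hs.inner_eq_zero (fun h => haa' (Subtype.ext h)) hu hv
  have hb := fun a : Λ => exists_hilbertBasis ℂ (eigenSubmodule D ((a : ℝ) : ℂ))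
  choose w b hwb using hb
  have ho := hof.orthonormal_sigma_orthonormal (v_family := fun a => b a)
    fun a => (b a).orthonormal
  -- The closed span of the joined bases contains each eigenspace, since it contains the closure of
  -- the span of that eigenspace's own basis.
  have htop : ⊤ ≤ (Submodule.span ℂ (Set.range fun k : Σ a, w a =>
      (eigenSubmodule D ((k.1 : ℝ) : ℂ)).subtypeₗᵢ (b k.1 k.2))).topologicalClosure := by
    rw [← (Submodule.dense_iff_topologicalClosure_eq_top.1 hd)]
    refine Submodule.topologicalClosure_minimal _ (iSup₂_le fun a ha => ?_)
      (Submodule.isClosed_topologicalClosure _)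
    intro u hu
    have h1 : (⟨u, hu⟩ : eigenSubmodule D ((a : ℝ) : ℂ))
        ∈ (Submodule.span ℂ (Set.range (b ⟨a, ha⟩))).topologicalClosure := by
      rw [(b ⟨a, ha⟩).dense_span]; trivial
    have h2 := image_closure_subset_closure_image continuous_subtype_val ⟨_, h1, rfl⟩
    refine closure_mono ?_ h2
    rintro _ ⟨x, hx, rfl⟩
    induction hx using Submodule.span_induction with
    | mem x hx =>
      obtain ⟨k, rfl⟩ := hx
      exact Submodule.subset_span ⟨⟨⟨a, ha⟩, k⟩, rfl⟩
    | zero => exact Submodule.zero_mem _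
    | add x y _ _ hx hy => exact Submodule.add_mem _ hx hy
    | smul c x _ hx => exact Submodule.smul_mem _ c hx
  refine ⟨Σ a, w a, HilbertBasis.mk ho htop, fun k => k.1, fun k => ⟨k.1.2, ?_⟩⟩
  rw [HilbertBasis.coe_mk]
  exact (b k.1 k.2).2

/-- In a Hilbert basis of eigenvectors the resolvent is diagonal with entries (z - m_k)⁻¹, bounded
because z has positive distance from the closed set Λ. It maps into the domain because this holds on
basis vectors and the graph is closed; it is a left inverse because symmetry lets D act on the basis
vectors. -/
theorem mem_opResolventSet_of_notMem {D : H →ₗ.[ℂ] H}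
    (hD : IsClosed (D.graph : Set (H × H))) (hs : IsSymmetricOp D) {Λ : Set ℝ} (hΛ : IsClosed Λ)
    (hd : Dense ((⨆ a ∈ Λ, eigenSubmodule D (a : ℝ) : Submodule ℂ H) : Set H)) {z : ℂ}
    (hz : ∀ a ∈ Λ, z ≠ (a : ℝ)) : z ∈ opResolventSet D := by
  obtain ⟨κ, b, m, hb⟩ := exists_hilbertBasis_eigenvectors hD hs Λ hd
  have hΛ' : IsClosed ((fun a : ℝ => (a : ℂ)) '' Λ) :=
    (Complex.isometry_ofReal.isClosedEmbedding.isClosedMap) _ hΛ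
  obtain ⟨δ, hδ, hball⟩ := Metric.isOpen_iff.1 hΛ'.isOpen_compl z (by
    rintro ⟨a, ha, rfl⟩
    exact hz a ha rfl)
  have hm : ∀ k, δ ≤ ‖z - m k‖ := by
    intro k
    by_contra! h
    refine hball (a := (m k : ℂ)) ?_ ⟨m k, (hb k).1, rfl⟩
    rwa [Metric.mem_ball, dist_comm, dist_eq_norm]
  have hm0 : ∀ k, z - m k ≠ 0 := fun k h => by
    have := hm k
    rw [h, norm_zero] at this
    linarith
  obtain ⟨R, hR⟩ := b.exists_diagonal (c := fun k => (z - m k)⁻¹) (M := δ⁻¹) fun k => by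
    rw [norm_inv]
    exact inv_anti₀ hδ (hm k)
  have hext : ∀ x y : H, (∀ k, inner ℂ (b k) x = inner ℂ (b k) y) → x = y := by
    intro x y h
    apply b.repr.injective
    ext k
    rw [b.repr_apply_apply, b.repr_apply_apply, h]
  have hgraph : ∀ f, (R f, z • R f - f) ∈ D.graph := by
    let P : Submodule ℂ H := D.graph.comap
      ((R : H →ₗ[ℂ] H).prod (z • (R : H →ₗ[ℂ] H) - LinearMap.id))
    have hP : IsClosed (P : Set H) :=
      hD.preimage (f := fun f => (R f, z • R f - f)) (by fun_prop)
    have hle : (Submodule.span ℂ (Set.range b)).topologicalClosure ≤ P := by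
      refine Submodule.topologicalClosure_minimal _ (Submodule.span_le.2 ?_) hP
      rintro _ ⟨k, rfl⟩
      change (R (b k), z • R (b k) - b k) ∈ D.graph
      have e : R (b k) = (z - m k)⁻¹ • b k := by
        refine hext _ _ fun j => ?_
        rw [hR, inner_smul_right]
        rcases eq_or_ne j k with rfl | hjk
        · rfl
        · rw [b.orthonormal.2 hjk, mul_zero, mul_zero]
      rw [e]
      convert! D.graph.smul_mem (z - m k)⁻¹ (hb k).2 using 1
      rw [Prod.smul_mk, Prod.mk.injEq]
      refine ⟨rfl, ?_⟩
      have h1 : b k = ((z - m k)⁻¹ * (z - m k)) • b k := by rw [inv_mul_cancel₀ (hm0 k), one_smul]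
      nth_rewrite 2 [h1]
      rw [smul_smul, smul_smul, ← sub_smul]
      ring_nf
    intro f
    have : f ∈ (Submodule.span ℂ (Set.range b)).topologicalClosure := by
      rw [b.dense_span]; trivial
    exact hle this
  refine ⟨R, fun f => ?_, fun u => ?_⟩
  · obtain ⟨⟨x, hx⟩, h1, h2⟩ := D.mem_graph_iff.1 (hgraph f)
    dsimp only at h1 h2
    subst h1
    exact ⟨hx, by rw [h2]; abel⟩
  · refine hext _ _ fun k => ?_
    have h1 := hs (hb k).2 (D.mem_graph u)
    rw [inner_smul_left, conj_ofReal] at h1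
    rw [hR, inner_sub_right, inner_smul_right, ← h1, ← sub_mul, ← mul_assoc,
      inv_mul_cancel₀ (hm0 k), one_mul]

theorem opSpectrum_eq_of_dense_eigenvectors {D : H →ₗ.[ℂ] H}
    (hD : IsClosed (D.graph : Set (H × H))) (hs : IsSymmetricOp D) {Λ : Set ℝ} (hΛ : IsClosed Λ)
    (hd : Dense ((⨆ a ∈ Λ, eigenSubmodule D (a : ℝ) : Submodule ℂ H) : Set H))
    (hne : ∀ a ∈ Λ, IsOpEigenvalue D (a : ℝ)) :
    opSpectrum D = (fun a : ℝ => (a : ℂ)) '' Λ := by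
  ext z
  constructor
  · intro h
    by_contra hcon
    exact h (mem_opResolventSet_of_notMem hD hs hΛ hd fun a ha h' => hcon ⟨a, ha, h'.symm⟩)
  · rintro ⟨a, ha, rfl⟩
    exact mem_opSpectrum_of_isOpEigenvalue (hne a ha)

/-- Two orthogonal subspaces with dense sum have complementary closures. -/
theorem mem_topologicalClosure_of_mem_orthogonal {A B : Submodule ℂ H} (hAB : A ≤ Bᗮ)
    (hd : Dense ((A ⊔ B : Submodule ℂ H) : Set H)) {u : H} (hu : u ∈ Bᗮ) :
    u ∈ A.topologicalClosure := by
  have hA : A.topologicalClosure ≤ Bᗮ :=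
    Submodule.topologicalClosure_minimal _ hAB B.isClosed_orthogonal
  have : CompleteSpace A.topologicalClosure :=
    A.isClosed_topologicalClosure.completeSpace_coe
  obtain ⟨y, hy, w, hw, rfl⟩ := A.topologicalClosure.exists_add_mem_mem_orthogonal u
  -- The remainder w is orthogonal to A by the projection, and to B because both u and the
  -- projection are; density then forces w = 0.
  have h1 : w ∈ (A ⊔ B)ᗮ := by
    rw [← Submodule.inf_orthogonal]
    refine ⟨Submodule.orthogonal_le A.le_topologicalClosure hw, ?_⟩
    simpa using Bᗮ.sub_mem hu (hA hy)
  rw [← Submodule.orthogonal_closure, Submodule.dense_iff_topologicalClosure_eq_top.1 hd,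
    Submodule.top_orthogonal_eq_bot, Submodule.mem_bot] at h1
  rwa [h1, add_zero]

/-- A sufficient description of an eigenspace of a closed symmetric operator. -/
theorem IsSymmetricOp.eigenSubmodule_eq {D : H →ₗ.[ℂ] H}
    (hD : IsClosed (D.graph : Set (H × H))) (hs : IsSymmetricOp D) {a : ℝ} {A B : Submodule ℂ H}
    (hA : A ≤ eigenSubmodule D a) (hB : B ≤ ⨆ (c : ℝ) (_ : c ≠ a), eigenSubmodule D c)
    (hd : Dense ((A ⊔ B : Submodule ℂ H) : Set H)) :
    eigenSubmodule D a = Bᗮ ∧ eigenSubmodule D a = A.topologicalClosure := by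
  have h1 : eigenSubmodule D a ≤ Bᗮ := by
    refine le_trans ?_ (Submodule.orthogonal_le hB)
    refine Submodule.isOrtho_iff_le.1 (Submodule.IsOrtho.symm
      (Submodule.isOrtho_iff_le.2 (iSup₂_le fun c hc u hu => ?_)))
    rw [Submodule.mem_orthogonal]
    exact fun v hv => hs.inner_eq_zero hc.symm hv hu
  have h2 : Bᗮ ≤ A.topologicalClosure := fun u hu =>
    mem_topologicalClosure_of_mem_orthogonal (hA.trans h1) hd hu
  have h3 : A.topologicalClosure ≤ eigenSubmodule D a :=
    Submodule.topologicalClosure_minimal _ hA (isClosed_eigenSubmodule hD _)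
  exact ⟨le_antisymm h1 (h2.trans h3), le_antisymm (h1.trans h2) h3⟩

end SymmetricOperator

/-! ### Ladder operators on polynomials in `z` and `z̄`

The variables `Sum.inl i` and `Sum.inr i` stand for `zⁱ` and `z̄ⁱ`. -/

section Ladder

open MvPolynomial

variable {N : ℕ}

/-- The raising operator `∂/∂zⁱ - kᵢ z̄ⁱ`. -/
def raiseOp (k : Fin N → ℂ) (i : Fin N) :
    MvPolynomial (Fin N ⊕ Fin N) ℂ →ₗ[ℂ] MvPolynomial (Fin N ⊕ Fin N) ℂ :=
  (pderiv (Sum.inl i)).toLinearMap - k i • LinearMap.mulLeft ℂ (X (Sum.inr i))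

theorem raiseOp_apply (k : Fin N → ℂ) (i : Fin N) (p : MvPolynomial (Fin N ⊕ Fin N) ℂ) :
    raiseOp k i p = pderiv (Sum.inl i) p - k i • (X (Sum.inr i) * p) := rfl

theorem pderiv_comm {σ : Type*} (s t : σ) (p : MvPolynomial σ ℂ) :
    pderiv s (pderiv t p) = pderiv t (pderiv s p) := by
  classical
  have h : ⁅pderiv (R := ℂ) s, pderiv (R := ℂ) t⁆ = 0 := by
    refine MvPolynomial.derivation_ext fun j => ?_
    rw [Derivation.commutator_apply, pderiv_X, pderiv_X]
    simp only [Pi.single_apply]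
    split_ifs <;> simp
  have := congrArg (fun D : Derivation ℂ (MvPolynomial σ ℂ) (MvPolynomial σ ℂ) => D p) h
  rwa [Derivation.commutator_apply, Derivation.zero_apply, sub_eq_zero] at this

/-- The canonical commutation relation [∂̄_i, a_j] = -δ_ij k_j, coming from the term k_j z̄_j alone.
-/
theorem pderiv_inr_raiseOp (k : Fin N → ℂ) (i j : Fin N) (p : MvPolynomial (Fin N ⊕ Fin N) ℂ) :
    pderiv (Sum.inr i) (raiseOp k j p)
      = raiseOp k j (pderiv (Sum.inr i) p) - if i = j then k j • p else 0 := by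
  rw [raiseOp_apply, raiseOp_apply, map_sub, Derivation.map_smul, Derivation.leibniz, pderiv_comm]
  rcases eq_or_ne i j with rfl | h
  · simp [smul_eq_mul]
    module
  · rw [pderiv_X_of_ne (by simpa using h.symm)]
    simp [h, smul_eq_mul]

theorem pderiv_inl_raiseOp (k : Fin N → ℂ) (i j : Fin N) (p : MvPolynomial (Fin N ⊕ Fin N) ℂ) :
    pderiv (Sum.inl i) (raiseOp k j p) = raiseOp k j (pderiv (Sum.inl i) p) := by
  rw [raiseOp_apply, raiseOp_apply, map_sub, Derivation.map_smul, Derivation.leibniz, pderiv_comm,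
    pderiv_X_of_ne (by simp)]
  simp [smul_eq_mul]

theorem raiseOp_comm (k : Fin N → ℂ) (i j : Fin N) (p : MvPolynomial (Fin N ⊕ Fin N) ℂ) :
    raiseOp k i (raiseOp k j p) = raiseOp k j (raiseOp k i p) := by
  conv_lhs => rw [raiseOp_apply, pderiv_inl_raiseOp]
  conv_rhs => rw [raiseOp_apply k i, map_sub, map_smul]
  congr 2
  rw [raiseOp_apply, raiseOp_apply, Derivation.leibniz, pderiv_X_of_ne (by simp)]
  simp only [smul_eq_mul, mul_zero, add_zero, mul_sub, mul_smul_comm]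
  ring_nf

/-- The joint eigenspace of the number operators with occupation numbers `n`. -/
def levelSpace (k : Fin N → ℂ) (n : Fin N → ℕ) :
    Submodule ℂ (MvPolynomial (Fin N ⊕ Fin N) ℂ) :=
  ⨅ i, LinearMap.ker (raiseOp k i ∘ₗ (pderiv (Sum.inr i)).toLinearMap
    + (k i * n i) • LinearMap.id)

theorem mem_levelSpace {k : Fin N → ℂ} {n : Fin N → ℕ} {p : MvPolynomial (Fin N ⊕ Fin N) ℂ} :
    p ∈ levelSpace k n ↔ ∀ i, raiseOp k i (pderiv (Sum.inr i) p) = -((k i * n i) • p) := by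
  simp [levelSpace, add_eq_zero_iff_eq_neg]

/-- The polynomials in the holomorphic variables. -/
def holomorphicPolynomials (N : ℕ) : Submodule ℂ (MvPolynomial (Fin N ⊕ Fin N) ℂ) :=
  ⨅ i, LinearMap.ker (pderiv (R := ℂ) (Sum.inr i : Fin N ⊕ Fin N)).toLinearMap

theorem mem_holomorphicPolynomials {p : MvPolynomial (Fin N ⊕ Fin N) ℂ} :
    p ∈ holomorphicPolynomials N ↔ ∀ i, pderiv (Sum.inr i) p = 0 := by
  simp [holomorphicPolynomials]

theorem holomorphicPolynomials_le_levelSpace (k : Fin N → ℂ) :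
    holomorphicPolynomials N ≤ levelSpace k 0 := by
  intro p hp
  rw [mem_levelSpace]
  intro i
  simp [mem_holomorphicPolynomials.1 hp i]

/-- Commuting a_j past -a_i∂̄_i adds k_i to the eigenvalue exactly when i = j. -/
theorem raiseOp_mem_levelSpace {k : Fin N → ℂ} {n : Fin N → ℕ} (j : Fin N)
    {p : MvPolynomial (Fin N ⊕ Fin N) ℂ} (hp : p ∈ levelSpace k n) :
    raiseOp k j p ∈ levelSpace k (n + Pi.single j 1) := by
  rw [mem_levelSpace] at hp ⊢
  intro i
  rw [pderiv_inr_raiseOp, map_sub, raiseOp_comm, hp]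
  rcases eq_or_ne i j with rfl | h
  · simp only [if_true, map_neg, map_smul, Pi.add_apply, Pi.single_eq_same]
    push_cast
    module
  · simp [h]

theorem pderiv_inl_mem_levelSpace {k : Fin N → ℂ} {n : Fin N → ℕ} (j : Fin N)
    {p : MvPolynomial (Fin N ⊕ Fin N) ℂ} (hp : p ∈ levelSpace k n) :
    pderiv (Sum.inl j) p ∈ levelSpace k n := by
  rw [mem_levelSpace] at hp ⊢
  intro i
  rw [pderiv_comm, ← pderiv_inl_raiseOp, hp, map_neg, Derivation.map_smul]

/-- The sum on the left is stable under every a_j and ∂_j, hence under multiplication by z̄_j =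
k_j⁻¹(∂_j - a_j). As it contains the holomorphic polynomials, it contains everything. Level 0 enters
only through its holomorphic elements, which is what identifies the lowest eigenspace later. -/
theorem holomorphicPolynomials_sup_levelSpace {k : Fin N → ℂ} (hk : ∀ i, k i ≠ 0) :
    holomorphicPolynomials N ⊔ ⨆ (n : Fin N → ℕ) (_ : n ≠ 0), levelSpace k n = ⊤ := by
  set Y := holomorphicPolynomials N ⊔ ⨆ (n : Fin N → ℕ) (_ : n ≠ 0), levelSpace k n with hY
  have hW : ∀ n : Fin N → ℕ, n ≠ 0 → levelSpace k n ≤ Y := fun n hn =>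
    le_sup_of_le_right (le_iSup₂_of_le n hn le_rfl)
  have hraise : ∀ j, Y ≤ Y.comap (raiseOp k j) := by
    intro j
    refine sup_le (fun p hp => ?_) (iSup₂_le fun n hn p hp => ?_)
    · exact hW _ (fun h => by simpa using congrFun h j)
        (raiseOp_mem_levelSpace j (holomorphicPolynomials_le_levelSpace k hp))
    · exact hW _ (fun h => by simpa using congrFun h j) (raiseOp_mem_levelSpace j hp)
  have hder : ∀ j, Y ≤ Y.comap (pderiv (Sum.inl j)).toLinearMap := by
    intro j
    refine sup_le (fun p hp => ?_) (iSup₂_le fun n hn p hp => ?_)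
    · refine Submodule.mem_sup_left (mem_holomorphicPolynomials.2 fun i => ?_)
      change pderiv _ (pderiv _ p) = 0
      rw [pderiv_comm, mem_holomorphicPolynomials.1 hp, map_zero]
    · exact hW n hn (pderiv_inl_mem_levelSpace j hp)
  have hmul : ∀ j, ∀ p ∈ Y, X (Sum.inr j) * p ∈ Y := by
    intro j p hp
    have : X (Sum.inr j) * p = (k j)⁻¹ • (pderiv (Sum.inl j) p - raiseOp k j p) := by
      rw [raiseOp_apply, sub_sub_cancel, smul_smul, inv_mul_cancel₀ (hk j), one_smul]
    rw [this]
    exact Y.smul_mem _ (Y.sub_mem (hder j hp) (hraise j hp))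
  -- The holomorphic factor h is carried along so that the variables z_j can be moved into it.
  have key : ∀ p, ∀ h ∈ holomorphicPolynomials N, h * p ∈ Y := by
    intro p
    induction p using MvPolynomial.induction_on with
    | C a =>
      intro h hh
      rw [mul_comm, ← smul_eq_C_mul]
      exact Y.smul_mem _ (Submodule.mem_sup_left hh)
    | add p q hp hq =>
      intro h hh
      rw [mul_add]
      exact Y.add_mem (hp h hh) (hq h hh)
    | mul_X p s hp =>
      intro h hh
      rcases s with j | j
      · rw [mul_comm p, ← mul_assoc]
        refine hp _ (mem_holomorphicPolynomials.2 fun i => ?_)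
        rw [Derivation.leibniz, mem_holomorphicPolynomials.1 hh, pderiv_X_of_ne (by simp)]
        simp
      · rw [mul_comm p, mul_left_comm]
        exact hmul j _ (hp h hh)
  rw [eq_top_iff]
  intro p _
  simpa using key p 1 (mem_holomorphicPolynomials.2 fun i => by simp)

/-- Every level contains polynomials outside a given proper differential subspace. -/
theorem exists_mem_levelSpace_notMem {k : Fin N → ℂ} (hk : ∀ i, k i ≠ 0)
    (Z : Submodule ℂ (MvPolynomial (Fin N ⊕ Fin N) ℂ))
    (hZ : ∀ i, ∀ p ∈ Z, pderiv (Sum.inr i) p ∈ Z) (h1 : (1 : MvPolynomial _ ℂ) ∉ Z)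
    (n : Fin N → ℕ) : ∃ p ∈ levelSpace k n, p ∉ Z := by
  induction hm : ∑ i, n i generalizing n with
  | zero =>
    have : n = 0 := funext fun i => by simpa using (Finset.sum_eq_zero_iff.1 hm) i
    subst this
    exact ⟨1, holomorphicPolynomials_le_levelSpace k
      (mem_holomorphicPolynomials.2 fun i => by simp), h1⟩
  | succ m ih =>
    obtain ⟨j, hj⟩ : ∃ j, n j ≠ 0 := by
      by_contra! h
      simp [h] at hm
    -- The truncated subtraction is exact, because `n j ≠ 0`.
    let n' : Fin N → ℕ := n - Pi.single j 1
    have hn : n = n' + Pi.single j 1 := by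
      ext i
      rcases eq_or_ne i j with rfl | h
      · simp [n']; omega
      · simp [n', h]
    have hs : ∑ i, n' i = m := by
      have : ∑ i, n i = ∑ i, n' i + 1 := by
        conv_lhs => rw [hn]
        simp [Finset.sum_add_distrib]
      omega
    obtain ⟨p, hp, hpZ⟩ := ih n' hs
    refine ⟨raiseOp k j p, hn ▸ raiseOp_mem_levelSpace j hp, fun hcon => hpZ ?_⟩
    have h2 := hZ j _ hcon
    -- On a level, ∂̄_j undoes a_j up to the nonzero factor -k_j(n'_j + 1). Raising therefore cannot
    -- lead into a subspace stable under ∂̄_j.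
    have h3 : pderiv (Sum.inr j) (raiseOp k j p) = (-(k j * (n' j + 1))) • p := by
      rw [pderiv_inr_raiseOp, mem_levelSpace.1 hp, if_pos rfl]
      module
    rw [h3] at h2
    refine (Z.smul_mem_iff ?_).1 h2
    exact neg_ne_zero.2 (mul_ne_zero (hk j) (Nat.cast_add_one_ne_zero _))

/-- The covariant derivative along the real coordinate directions, in terms of ladder operators. -/
def nablaPoly (k : Fin N → ℂ) : Fin N ⊕ Fin N →
    MvPolynomial (Fin N ⊕ Fin N) ℂ →ₗ[ℂ] MvPolynomial (Fin N ⊕ Fin N) ℂ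
  | Sum.inl i => raiseOp k i + (pderiv (Sum.inr i)).toLinearMap
  | Sum.inr i => I • (raiseOp k i - (pderiv (Sum.inr i)).toLinearMap)

theorem nablaPoly_inl (k : Fin N → ℂ) (i : Fin N) (p : MvPolynomial (Fin N ⊕ Fin N) ℂ) :
    nablaPoly k (Sum.inl i) p = raiseOp k i p + pderiv (Sum.inr i) p := rfl

theorem nablaPoly_inr (k : Fin N → ℂ) (i : Fin N) (p : MvPolynomial (Fin N ⊕ Fin N) ℂ) :
    nablaPoly k (Sum.inr i) p = I • (raiseOp k i p - pderiv (Sum.inr i) p) := rfl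

/-- For each i, (a+∂̄)² - (a-∂̄)² = 2(a∂̄ + ∂̄a) = 4a∂̄ - 2k, and a∂̄ = -kn on the level. -/
theorem sum_nablaPoly_nablaPoly {k : Fin N → ℂ} {n : Fin N → ℕ}
    {p : MvPolynomial (Fin N ⊕ Fin N) ℂ} (hp : p ∈ levelSpace k n) :
    ∑ s, nablaPoly k s (nablaPoly k s p) = -((∑ i, (2 * k i * (2 * n i + 1))) • p) := by
  rw [Fintype.sum_sum_type, ← Finset.sum_add_distrib, Finset.sum_smul, ← Finset.sum_neg_distrib]
  refine Finset.sum_congr rfl fun i _ => ?_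
  simp only [nablaPoly_inl, nablaPoly_inr, map_add, map_smul, map_sub, pderiv_inr_raiseOp,
    mem_levelSpace.1 hp, if_true]
  have h : I * I = -1 := I_mul_I
  simp only [smul_sub, smul_smul, smul_neg, h, ← mul_assoc]
  module

end Ladder

/-! ### Polynomials in z and z̄ as functions: derivatives and growth. -/

section PolynomialSections

variable {S : Type*} [NormedAddCommGroup S] [InnerProductSpace ℝ S]
  {N : ℕ}

/-- The complex coordinates `zⁱ` (`Sum.inl i`) and `z̄ⁱ` (`Sum.inr i`) of an orthonormal frame. -/
def complexCoord (u : OrthonormalBasis (Fin N ⊕ Fin N) ℝ S) : Fin N ⊕ Fin N → S →L[ℝ] ℂ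
  | Sum.inl i => ofRealCLM ∘L innerSL ℝ (u (Sum.inl i))
      + I • (ofRealCLM ∘L innerSL ℝ (u (Sum.inr i)))
  | Sum.inr i => ofRealCLM ∘L innerSL ℝ (u (Sum.inl i))
      - I • (ofRealCLM ∘L innerSL ℝ (u (Sum.inr i)))

variable (u : OrthonormalBasis (Fin N ⊕ Fin N) ℝ S)

theorem complexCoord_inl (i : Fin N) (x : S) : complexCoord u (Sum.inl i) x
    = (inner ℝ (u (Sum.inl i)) x : ℝ) + I * (inner ℝ (u (Sum.inr i)) x : ℝ) := rfl

theorem complexCoord_inr (i : Fin N) (x : S) : complexCoord u (Sum.inr i) x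
    = (inner ℝ (u (Sum.inl i)) x : ℝ) - I * (inner ℝ (u (Sum.inr i)) x : ℝ) := rfl

/-- Evaluation of a polynomial in `z` and `z̄` as a function on `S`. -/
def polyFun (p : MvPolynomial (Fin N ⊕ Fin N) ℂ) (x : S) : ℂ :=
  MvPolynomial.eval (fun s => complexCoord u s x) p

theorem polyFun_add (p q : MvPolynomial (Fin N ⊕ Fin N) ℂ) (x : S) :
    polyFun u (p + q) x = polyFun u p x + polyFun u q x := by simp [polyFun]

theorem polyFun_sub (p q : MvPolynomial (Fin N ⊕ Fin N) ℂ) (x : S) :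
    polyFun u (p - q) x = polyFun u p x - polyFun u q x := by simp [polyFun]

theorem polyFun_mul (p q : MvPolynomial (Fin N ⊕ Fin N) ℂ) (x : S) :
    polyFun u (p * q) x = polyFun u p x * polyFun u q x := by simp [polyFun]

theorem polyFun_smul (c : ℂ) (p : MvPolynomial (Fin N ⊕ Fin N) ℂ) (x : S) :
    polyFun u (c • p) x = c * polyFun u p x := by simp [polyFun]

theorem polyFun_X (s : Fin N ⊕ Fin N) (x : S) :
    polyFun u (MvPolynomial.X s) x = complexCoord u s x := by simp [polyFun]

theorem polyFun_C (c : ℂ) (x : S) : polyFun u (MvPolynomial.C c) x = c := by simp [polyFun]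

theorem hasFDerivAt_polyFun (p : MvPolynomial (Fin N ⊕ Fin N) ℂ) (x : S) :
    HasFDerivAt (polyFun u p)
      (∑ s, polyFun u (MvPolynomial.pderiv s p) x • complexCoord u s) x := by
  induction p using MvPolynomial.induction_on with
  | C a =>
    have : polyFun u (MvPolynomial.C a) = fun _ => a := funext fun x => polyFun_C u a x
    rw [this]
    refine (hasFDerivAt_const a x).congr_fderiv (ContinuousLinearMap.ext fun v => ?_)
    simp [polyFun]
  | add p q hp hq =>
    have : polyFun u (p + q) = fun x => polyFun u p x + polyFun u q x :=
      funext fun x => polyFun_add u p q x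
    rw [this]
    refine (hp.add hq).congr_fderiv (ContinuousLinearMap.ext fun v => ?_)
    simp only [add_apply, sum_apply, smul_apply, map_add, polyFun_add, smul_eq_mul, add_mul,
      Finset.sum_add_distrib]
  | mul_X p t hp =>
    have : polyFun u (p * MvPolynomial.X t) = fun x => polyFun u p x * complexCoord u t x :=
      funext fun x => by rw [polyFun_mul, polyFun_X]
    rw [this]
    refine (hp.mul (complexCoord u t).hasFDerivAt).congr_fderiv
      (ContinuousLinearMap.ext fun v => ?_)
    simp only [add_apply, sum_apply, smul_apply, Derivation.leibniz, polyFun_add, smul_eq_mul,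
      polyFun_mul, polyFun_X, add_mul, Finset.sum_add_distrib, Finset.mul_sum,
      MvPolynomial.pderiv_X, mul_assoc]
    congr 1
    rw [Finset.sum_eq_single t]
    · simp [polyFun]
    · intro s _ hs
      simp [hs.symm, polyFun]
    · simp

theorem contDiff_polyFun (p : MvPolynomial (Fin N ⊕ Fin N) ℂ) :
    ContDiff ℝ (⊤ : ℕ∞) (polyFun u p) := by
  induction p using MvPolynomial.induction_on with
  | C a =>
    have : polyFun u (MvPolynomial.C a) = fun _ => a := funext fun x => polyFun_C u a x
    rw [this]
    exact contDiff_const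
  | add p q hp hq =>
    have : polyFun u (p + q) = fun x => polyFun u p x + polyFun u q x :=
      funext fun x => polyFun_add u p q x
    rw [this]
    exact hp.add hq
  | mul_X p t hp =>
    have : polyFun u (p * MvPolynomial.X t) = fun x => polyFun u p x * complexCoord u t x :=
      funext fun x => by rw [polyFun_mul, polyFun_X]
    rw [this]
    exact hp.mul (complexCoord u t).contDiff

theorem fderiv_polyFun_inl (p : MvPolynomial (Fin N ⊕ Fin N) ℂ) (x : S) (j : Fin N) :
    fderiv ℝ (polyFun u p) x (u (Sum.inl j))
      = polyFun u (MvPolynomial.pderiv (Sum.inl j) p + MvPolynomial.pderiv (Sum.inr j) p) x := by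
  rw [(hasFDerivAt_polyFun u p x).fderiv, Fintype.sum_sum_type, polyFun_add]
  simp [complexCoord_inl, complexCoord_inr, orthonormal_iff_ite.1 u.orthonormal,
    apply_ite ofReal]

theorem fderiv_polyFun_inr (p : MvPolynomial (Fin N ⊕ Fin N) ℂ) (x : S) (j : Fin N) :
    fderiv ℝ (polyFun u p) x (u (Sum.inr j)) = I *
      polyFun u (MvPolynomial.pderiv (Sum.inl j) p - MvPolynomial.pderiv (Sum.inr j) p) x := by
  rw [(hasFDerivAt_polyFun u p x).fderiv, Fintype.sum_sum_type, polyFun_sub]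
  simp [complexCoord_inl, complexCoord_inr, orthonormal_iff_ite.1 u.orthonormal,
    apply_ite ofReal]
  ring

theorem norm_complexCoord_le (s : Fin N ⊕ Fin N) (x : S) : ‖complexCoord u s x‖ ≤ 2 * ‖x‖ := by
  have h : ∀ s, ‖((inner ℝ (u s) x : ℝ) : ℂ)‖ ≤ ‖x‖ := fun s => by
    rw [norm_real]
    simpa using norm_inner_le_norm (𝕜 := ℝ) (u s) x
  rcases s with i | i
  · rw [complexCoord_inl]
    refine (norm_add_le _ _).trans ?_
    rw [norm_mul, norm_I, one_mul, two_mul]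
    exact add_le_add (h _) (h _)
  · rw [complexCoord_inr]
    refine (norm_sub_le _ _).trans ?_
    rw [norm_mul, norm_I, one_mul, two_mul]
    exact add_le_add (h _) (h _)

/-- Completing the square. It lets part of a Gaussian absorb any exponential. -/
theorem exp_mul_le_exp_sq {ε : ℝ} (hε : 0 < ε) (a t : ℝ) :
    Real.exp (a * t) ≤ Real.exp (a ^ 2 / (4 * ε)) * Real.exp (ε * t ^ 2) := by
  rw [← Real.exp_add, Real.exp_le_exp]
  have h : a ^ 2 / (4 * ε) + ε * t ^ 2 - a * t = (a - 2 * ε * t) ^ 2 / (4 * ε) := by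
    field_simp; ring
  have : 0 ≤ (a - 2 * ε * t) ^ 2 / (4 * ε) := by positivity
  linarith

/-- Polynomials grow slower than every Gaussian. -/
theorem exists_norm_polyFun_le (p : MvPolynomial (Fin N ⊕ Fin N) ℂ) {ε : ℝ} (hε : 0 < ε) :
    ∃ C, 0 ≤ C ∧ ∀ x, ‖polyFun u p x‖ ≤ C * Real.exp (ε * ‖x‖ ^ 2) := by
  induction p using MvPolynomial.induction_on generalizing ε with
  | C a =>
    refine ⟨‖a‖, norm_nonneg _, fun x => ?_⟩
    rw [polyFun_C]
    exact le_mul_of_one_le_right (norm_nonneg _) (Real.one_le_exp (by positivity))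
  | add p q hp hq =>
    obtain ⟨C, hC, h1⟩ := hp hε
    obtain ⟨C', hC', h2⟩ := hq hε
    refine ⟨C + C', add_nonneg hC hC', fun x => ?_⟩
    rw [polyFun_add, add_mul]
    exact (norm_add_le _ _).trans (add_le_add (h1 x) (h2 x))
  | mul_X p t hp =>
    -- Half of ε controls p, the other half the additional linear factor.
    obtain ⟨C, hC, h1⟩ := hp (half_pos hε)
    refine ⟨C * (2 * Real.exp (1 ^ 2 / (4 * (ε / 2)))), by positivity, fun x => ?_⟩
    have h2 : ‖x‖ ≤ Real.exp (1 ^ 2 / (4 * (ε / 2))) * Real.exp (ε / 2 * ‖x‖ ^ 2) := by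
      refine le_trans ?_ (exp_mul_le_exp_sq (half_pos hε) 1 ‖x‖)
      have := Real.add_one_le_exp (1 * ‖x‖)
      linarith
    rw [polyFun_mul, polyFun_X, norm_mul]
    calc ‖polyFun u p x‖ * ‖complexCoord u t x‖
        ≤ (C * Real.exp (ε / 2 * ‖x‖ ^ 2)) *
          (2 * (Real.exp (1 ^ 2 / (4 * (ε / 2))) * Real.exp (ε / 2 * ‖x‖ ^ 2))) := by
          refine mul_le_mul (h1 x) ((norm_complexCoord_le u t x).trans ?_) (norm_nonneg _)
            (by positivity)
          linarith
      _ = C * (2 * Real.exp (1 ^ 2 / (4 * (ε / 2)))) *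
          (Real.exp (ε / 2 * ‖x‖ ^ 2) * Real.exp (ε / 2 * ‖x‖ ^ 2)) := by ring
      _ = _ := by rw [← Real.exp_add]; ring_nf

end PolynomialSections

/-! ### The gauge function and the ground state Gaussian. -/

section GaugeGaussian

variable {S : Type*} [NormedAddCommGroup S] [InnerProductSpace ℝ S] [FiniteDimensional ℝ S]

/-- `χ` is a gauge function transforming the symmetric potential into `θ`. -/
structure IsGaugeFunction (ω : LinearMap.BilinForm ℝ S) (θ : S → S →L[ℝ] ℝ) (χ : S → ℝ) : Prop where
  contDiff : ContDiff ℝ (⊤ : ℕ∞) χ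
  fderiv_apply : ∀ x v, fderiv ℝ χ x v = θ x v + 1 / 2 * ω x v

/-- The form ½ω(x,·) has exterior derivative ω, and dθ = -ω, so their sum is closed; the Poincaré
lemma on the whole space gives χ. Its smoothness follows from that of its derivative. -/
theorem exists_isGaugeFunction {ω : LinearMap.BilinForm ℝ S} (hω : ω.IsAlt)
    {θ : S → S →L[ℝ] ℝ} (hθ : ContDiff ℝ (⊤ : ℕ∞) θ)
    (hθω : ∀ x u v : S, ω u v = -extDerivOne θ x u v) : ∃ χ, IsGaugeFunction ω θ χ := by
  let L : S →L[ℝ] S →L[ℝ] ℝ := LinearMap.toContinuousLinearMap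
    ((LinearMap.toContinuousLinearMap (𝕜 := ℝ) (E := S) (F' := ℝ)).toLinearMap ∘ₗ ω)
  have hL : ∀ x v, L x v = ω x v := fun x v => rfl
  let σ : S → S →L[ℝ] ℝ := fun x => θ x + (1 / 2 : ℝ) • L x
  have hσ : ContDiff ℝ (⊤ : ℕ∞) σ := hθ.add (L.contDiff.const_smul _)
  have hd : ∀ a, fderiv ℝ σ a = fderiv ℝ θ a + (1 / 2 : ℝ) • L := fun a =>
    (((hθ.differentiable (by simp) a).hasFDerivAt).add
      (L.hasFDerivAt.const_smul (1 / 2 : ℝ))).fderiv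
  obtain ⟨χ, hχ⟩ := convex_univ.exists_forall_hasFDerivAt_of_fderiv_symmetric (ω := σ) isOpen_univ
    (hσ.differentiable (by simp)).differentiableOn (fun a _ v w => by
      have h1 := hθω a v w
      have h2 := hω.neg_eq v w
      rw [extDerivOne] at h1
      simp only [hd, add_apply, smul_apply, hL, smul_eq_mul]
      linarith)
  have hχ' : fderiv ℝ χ = σ := funext fun x => (hχ x trivial).fderiv
  refine ⟨χ, ?_, fun x v => by rw [hχ']; rfl⟩
  rw [show ((⊤ : ℕ∞) : WithTop ℕ∞) = (⊤ : ℕ∞) + 1 from rfl, contDiff_succ_iff_fderiv]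
  exact ⟨fun x => (hχ x trivial).differentiableAt, by simp, hχ' ▸ hσ⟩

/-- The Gaussian `exp(-η(x, x) / 4ħ)` of the lowest Landau level, in the gauge given by `χ`. -/
def gaugeGaussian (ħ : ℝ) (ω : LinearMap.BilinForm ℝ S) (χ : S → ℝ) (x : S) : ℂ :=
  cexp (((-(1 / (4 * ħ)) * etaForm ω x x : ℝ) : ℂ) - I / ħ * (χ x : ℂ))

theorem gaugeGaussian_ne_zero (ħ : ℝ) (ω : LinearMap.BilinForm ℝ S) (χ : S → ℝ) (x : S) :
    gaugeGaussian ħ ω χ x ≠ 0 := exp_ne_zero _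

theorem norm_gaugeGaussian (ħ : ℝ) (ω : LinearMap.BilinForm ℝ S) (χ : S → ℝ) (x : S) :
    ‖gaugeGaussian ħ ω χ x‖ = Real.exp (-(1 / (4 * ħ)) * etaForm ω x x) := by
  rw [gaugeGaussian, norm_exp]
  congr 1
  have : I / (ħ : ℂ) * (χ x : ℂ) = ((χ x / ħ : ℝ) : ℂ) * I := by push_cast; ring
  rw [this, sub_re, ofReal_re, re_ofReal_mul, I_re, mul_zero, sub_zero]

theorem hasFDerivAt_etaForm {ω : LinearMap.BilinForm ℝ S} (hω : ω.IsAlt) (hn : ω.Nondegenerate)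
    (x : S) : ∃ L : S →L[ℝ] ℝ, HasFDerivAt (fun x => etaForm ω x x) L x ∧
      ∀ v, L v = 2 * etaForm ω x v := by
  let B : S →L[ℝ] S := LinearMap.toContinuousLinearMap (invModulus ω)
  refine ⟨_, (hasFDerivAt_id x).inner ℝ (B.hasFDerivAt (x := x)), fun v => ?_⟩
  simp only [ContinuousLinearMap.comp_apply, ContinuousLinearMap.prod_apply,
    fderivInnerCLM_apply, id_eq, etaForm]
  have h := invModulus_isSymmetric hω hn x v
  change inner ℝ x (invModulus ω v) + inner ℝ v (invModulus ω x) = _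
  rw [real_inner_comm _ v, h]
  ring

theorem contDiff_etaForm (ω : LinearMap.BilinForm ℝ S) :
    ContDiff ℝ (⊤ : ℕ∞) fun x => etaForm ω x x :=
  contDiff_id.inner ℝ (LinearMap.toContinuousLinearMap (invModulus ω)).contDiff

theorem contDiff_gaugeGaussian (ħ : ℝ) (ω : LinearMap.BilinForm ℝ S) {χ : S → ℝ}
    (hχ : ContDiff ℝ (⊤ : ℕ∞) χ) : ContDiff ℝ (⊤ : ℕ∞) (gaugeGaussian ħ ω χ) := by
  have h1 : ContDiff ℝ (⊤ : ℕ∞) fun x : S => ((-(1 / (4 * ħ)) * etaForm ω x x : ℝ) : ℂ) :=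
    ofRealCLM.contDiff.comp (contDiff_const.mul (contDiff_etaForm ω))
  have h2 : ContDiff ℝ (⊤ : ℕ∞) fun x : S => (χ x : ℂ) := ofRealCLM.contDiff.comp hχ
  exact (h1.sub (contDiff_const.mul h2)).cexp

/-- The connection in the gauge trivialized by the Gaussian. -/
theorem covDeriv_mul_gaugeGaussian {ħ : ℝ} (hħ : 0 < ħ) {ω : LinearMap.BilinForm ℝ S}
    (hω : ω.IsAlt) (hn : ω.Nondegenerate) {θ : S → S →L[ℝ] ℝ} {χ : S → ℝ}
    (hχ : IsGaugeFunction ω θ χ) {β : S → ℂ} {x : S} (hβ : DifferentiableAt ℝ β x) (v : S) :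
    covDeriv ħ θ (fun x => β x * gaugeGaussian ħ ω χ x) x v
      = (fderiv ℝ β x v - (1 / (2 * ħ) : ℂ) * (etaForm ω x v + I * (ω x v : ℝ)) * β x)
        * gaugeGaussian ħ ω χ x := by
  obtain ⟨L, hL, hLv⟩ := hasFDerivAt_etaForm hω hn x
  have h1 := ofRealCLM.hasFDerivAt.comp x (hL.const_mul (-(1 / (4 * ħ))))
  have h2 := ofRealCLM.hasFDerivAt.comp x
    ((hχ.contDiff.differentiable (by simp)) x).hasFDerivAt
  have h3 : HasFDerivAt (gaugeGaussian ħ ω χ) (gaugeGaussian ħ ω χ x •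
      (ofRealCLM ∘L (-(1 / (4 * ħ)) • L) - (I / ħ) • (ofRealCLM ∘L fderiv ℝ χ x))) x :=
    (h1.sub (h2.const_mul (I / ħ))).cexp
  have h4 : HasFDerivAt (fun x => β x * gaugeGaussian ħ ω χ x) _ x := hβ.hasFDerivAt.mul h3
  rw [covDeriv, h4.fderiv]
  have hħ' : (ħ : ℂ) ≠ 0 := by exact_mod_cast hħ.ne'
  simp only [add_apply, smul_apply, sub_apply, ContinuousLinearMap.comp_apply, ofRealCLM_apply,
    hLv, hχ.fderiv_apply, smul_eq_mul]
  push_cast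
  field_simp
  ring

end GaugeGaussian

/-! ### Covariant derivatives and decay of polynomials times the Gaussian. -/

section GaussianSections

variable {S : Type*} [NormedAddCommGroup S] [InnerProductSpace ℝ S]

theorem covDeriv_sum_smul (ħ : ℝ) (θ : S → S →L[ℝ] ℝ) (f : S → ℂ) (x : S) {ι : Type*} [Fintype ι]
    (c : ι → ℝ) (v : ι → S) :
    covDeriv ħ θ f x (∑ s, c s • v s) = ∑ s, (c s : ℂ) * covDeriv ħ θ f x (v s) := by
  simp only [covDeriv, map_sum, map_smul, ofReal_sum, smul_eq_mul, real_smul, ofReal_mul, mul_add,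
    Finset.sum_add_distrib, Finset.mul_sum, Finset.sum_mul]
  congr 1
  exact Finset.sum_congr rfl fun s _ => by ring

/-- Parseval in the basis `e`: the sum of squares of covariant derivatives is the same in `e` and in
the unitary frame. -/
theorem sum_inner_mul_inner_eq_ite {N : ℕ} {u : OrthonormalBasis (Fin N ⊕ Fin N) ℝ S}
    {ι : Type*} [Fintype ι] (e : OrthonormalBasis ι ℝ S)
    (s t : Fin N ⊕ Fin N) :
    ∑ j, inner ℝ (u s) (e j) * inner ℝ (u t) (e j) = if s = t then (1 : ℝ) else 0 := by
  rw [← orthonormal_iff_ite.1 u.orthonormal, ← e.sum_inner_mul_inner]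
  exact Finset.sum_congr rfl fun j _ => by rw [real_inner_comm (e j) (u t)]

variable {N : ℕ}

/-- The covariant derivative of polynomial sections in the direction `v`. -/
def nablaVec (u : OrthonormalBasis (Fin N ⊕ Fin N) ℝ S) (ħ : ℝ) (ϑ : Fin N → ℝ) (v : S) :
    MvPolynomial (Fin N ⊕ Fin N) ℂ →ₗ[ℂ] MvPolynomial (Fin N ⊕ Fin N) ℂ :=
  ∑ s, ((inner ℝ (u s) v : ℝ) : ℂ) • nablaPoly (fun i => ((ϑ i / (2 * ħ) : ℝ) : ℂ)) s

/-- The Bochner Laplacian on polynomial sections. -/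
theorem sum_nablaVec_nablaVec {u : OrthonormalBasis (Fin N ⊕ Fin N) ℝ S} {ħ : ℝ}
    {ϑ : Fin N → ℝ} {ι : Type*} [Fintype ι] (e : OrthonormalBasis ι ℝ S)
    {n : Fin N → ℕ} {p : MvPolynomial (Fin N ⊕ Fin N) ℂ} (hħ : 0 < ħ)
    (hp : p ∈ levelSpace (fun i => ((ϑ i / (2 * ħ) : ℝ) : ℂ)) n) :
    ∑ j, nablaVec u ħ ϑ (e j) (nablaVec u ħ ϑ (e j) p)
      = -(((1 / ħ * ∑ i, (2 * (n i : ℝ) + 1) * ϑ i : ℝ) : ℂ) • p) := by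
  have h1 : ∑ j, nablaVec u ħ ϑ (e j) (nablaVec u ħ ϑ (e j) p)
      = ∑ s, nablaPoly (fun i => ((ϑ i / (2 * ħ) : ℝ) : ℂ)) s
        (nablaPoly (fun i => ((ϑ i / (2 * ħ) : ℝ) : ℂ)) s p) := by
    set k : Fin N → ℂ := fun i => ((ϑ i / (2 * ħ) : ℝ) : ℂ) with hk
    have h2 : ∀ j, nablaVec u ħ ϑ (e j) (nablaVec u ħ ϑ (e j) p)
        = ∑ s, ∑ t, ((inner ℝ (u s) (e j) * inner ℝ (u t) (e j) : ℝ) : ℂ) •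
          nablaPoly k s (nablaPoly k t p) := by
      intro j
      simp only [nablaVec, LinearMap.sum_apply, LinearMap.smul_apply, map_sum, map_smul,
        Finset.smul_sum, smul_smul, ofReal_mul]
      rw [Finset.sum_comm]
      exact Finset.sum_congr rfl fun s _ => Finset.sum_congr rfl fun t _ => by rw [mul_comm]
    simp only [h2]
    rw [Finset.sum_comm]
    refine Finset.sum_congr rfl fun s _ => ?_
    rw [Finset.sum_comm]
    simp only [← Finset.sum_smul, ← ofReal_sum, sum_inner_mul_inner_eq_ite]
    rw [Finset.sum_eq_single s]
    · simp
    · intro t _ ht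
      simp [ht.symm]
    · simp
  rw [h1, sum_nablaPoly_nablaPoly hp]
  congr 2
  push_cast
  rw [Finset.mul_sum]
  refine Finset.sum_congr rfl fun i _ => ?_
  have hħ' : (ħ : ℂ) ≠ 0 := by exact_mod_cast hħ.ne'
  field_simp

variable [FiniteDimensional ℝ S]

/-- The section given by a polynomial in `z` and `z̄` times the Gaussian. -/
def polySection (u : OrthonormalBasis (Fin N ⊕ Fin N) ℝ S) (ħ : ℝ) (ω : LinearMap.BilinForm ℝ S)
    (χ : S → ℝ) (p : MvPolynomial (Fin N ⊕ Fin N) ℂ) (x : S) : ℂ :=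
  polyFun u p x * gaugeGaussian ħ ω χ x

variable {u : OrthonormalBasis (Fin N ⊕ Fin N) ℝ S} {ħ : ℝ} {ω : LinearMap.BilinForm ℝ S}
  {θ : S → S →L[ℝ] ℝ} {χ : S → ℝ} {ϑ : Fin N → ℝ}

theorem contDiff_polySection (u : OrthonormalBasis (Fin N ⊕ Fin N) ℝ S) (ħ : ℝ)
    (ω : LinearMap.BilinForm ℝ S) (hχ : ContDiff ℝ (⊤ : ℕ∞) χ)
    (p : MvPolynomial (Fin N ⊕ Fin N) ℂ) : ContDiff ℝ (⊤ : ℕ∞) (polySection u ħ ω χ p) :=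
  (contDiff_polyFun u p).mul (contDiff_gaugeGaussian ħ ω hχ)

theorem covDeriv_polySection_frame (hu : IsUnitaryFrame ω u ϑ) (hħ : 0 < ħ)
    (hω : ω.IsAlt) (hn : ω.Nondegenerate) (hχ : IsGaugeFunction ω θ χ)
    (p : MvPolynomial (Fin N ⊕ Fin N) ℂ) (x : S) (s : Fin N ⊕ Fin N) :
    covDeriv ħ θ (polySection u ħ ω χ p) x (u s)
      = polySection u ħ ω χ (nablaPoly (fun i => ((ϑ i / (2 * ħ) : ℝ) : ℂ)) s p) x := by
  have h := covDeriv_mul_gaugeGaussian hħ hω hn hχ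
    (((contDiff_polyFun u p).differentiable (by simp)) x) (u s)
  have hħ' : (ħ : ℂ) ≠ 0 := by exact_mod_cast hħ.ne'
  change covDeriv ħ θ (fun x => polyFun u p x * gaugeGaussian ħ ω χ x) x (u s) = _ * _
  rw [h]
  congr 1
  rcases s with i | i
  · rw [fderiv_polyFun_inl, hu.etaForm_inl, hu.form_inl hω hn, nablaPoly_inl, raiseOp_apply]
    simp only [polyFun_add, polyFun_sub, polyFun_smul, polyFun_mul, polyFun_X, complexCoord_inr]
    push_cast
    field_simp
    ring
  · rw [fderiv_polyFun_inr, hu.etaForm_inr hω hn, hu.form_inr hω hn, nablaPoly_inr, raiseOp_apply]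
    simp only [polyFun_sub, polyFun_smul, polyFun_mul, polyFun_X, complexCoord_inr]
    push_cast
    field_simp
    ring_nf
    simp only [I_sq]
    ring

theorem covDeriv_polySection (hu : IsUnitaryFrame ω u ϑ) (hħ : 0 < ħ)
    (hω : ω.IsAlt) (hn : ω.Nondegenerate) (hχ : IsGaugeFunction ω θ χ)
    (p : MvPolynomial (Fin N ⊕ Fin N) ℂ) (x v : S) :
    covDeriv ħ θ (polySection u ħ ω χ p) x v
      = polySection u ħ ω χ (nablaVec u ħ ϑ v p) x := by
  conv_lhs => rw [← u.sum_repr' v, covDeriv_sum_smul]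
  simp only [covDeriv_polySection_frame hu hħ hω hn hχ, nablaVec, LinearMap.sum_apply,
    LinearMap.smul_apply, polySection, polyFun, map_sum, MvPolynomial.smul_eval, Finset.sum_mul,
    mul_assoc]

theorem exists_pos_mul_norm_sq_le_etaForm (hu : IsUnitaryFrame ω u ϑ) (hω : ω.IsAlt)
    (hn : ω.Nondegenerate) : ∃ m, 0 < m ∧ ∀ x, m * ‖x‖ ^ 2 ≤ etaForm ω x x := by
  obtain ⟨m, hm, hle⟩ : ∃ m, 0 < m ∧ ∀ i, m ≤ ϑ i := by
    rcases isEmpty_or_nonempty (Fin N) with h | h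
    -- For N = 0 there is no eigenvalue to bound, and any positive constant serves.
    · exact ⟨1, one_pos, fun i => h.elim i⟩
    · obtain ⟨i, hi⟩ := Finite.exists_min ϑ
      exact ⟨ϑ i, hu.pos i, hi⟩
  refine ⟨m, hm, fun x => ?_⟩
  rw [hu.etaForm_self hω hn, ← u.sum_sq_norm_inner_right, Finset.mul_sum]
  refine Finset.sum_le_sum fun s _ => ?_
  rw [Real.norm_eq_abs, sq_abs]
  refine mul_le_mul_of_nonneg_right ?_ (sq_nonneg _)
  rcases s with i | i <;> exact hle i

/-- Polynomial sections have Gaussian decay, even after multiplication by an exponential. -/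
theorem exists_norm_polySection_le (hu : IsUnitaryFrame ω u ϑ) (hħ : 0 < ħ) (hω : ω.IsAlt)
    (hn : ω.Nondegenerate) (χ : S → ℝ) :
    ∃ c, 0 < c ∧ ∀ (p : MvPolynomial (Fin N ⊕ Fin N) ℂ) (a : ℝ), ∃ C, 0 ≤ C ∧
      ∀ x, Real.exp (a * ‖x‖) * ‖polySection u ħ ω χ p x‖ ≤ C * Real.exp (-c * ‖x‖ ^ 2) := by
  obtain ⟨m, hm, hle⟩ := exists_pos_mul_norm_sq_le_etaForm hu hω hn
  -- The decay rate m/4ħ is split into three equal parts: one absorbs the polynomial, one the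
  -- exponential, and the last remains.
  have hc : 0 < m / (12 * ħ) := by positivity
  refine ⟨m / (12 * ħ), hc, fun p a => ?_⟩
  obtain ⟨C, hC, hp⟩ := exists_norm_polyFun_le u p hc
  refine ⟨Real.exp (a ^ 2 / (4 * (m / (12 * ħ)))) * C, by positivity, fun x => ?_⟩
  rw [polySection, norm_mul, norm_gaugeGaussian]
  have h1 : Real.exp (-(1 / (4 * ħ)) * etaForm ω x x)
      ≤ Real.exp (-(m / (12 * ħ)) * ‖x‖ ^ 2 - m / (12 * ħ) * ‖x‖ ^ 2 - m / (12 * ħ) * ‖x‖ ^ 2) := by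
    rw [Real.exp_le_exp]
    have h2 : -(m / (12 * ħ)) * ‖x‖ ^ 2 - m / (12 * ħ) * ‖x‖ ^ 2 - m / (12 * ħ) * ‖x‖ ^ 2
        = -(1 / (4 * ħ)) * (m * ‖x‖ ^ 2) := by field_simp; ring
    rw [h2]
    exact mul_le_mul_of_nonpos_left (hle x) (by rw [neg_nonpos]; positivity)
  calc _ ≤ (Real.exp (a ^ 2 / (4 * (m / (12 * ħ)))) * Real.exp (m / (12 * ħ) * ‖x‖ ^ 2)) *
        ((C * Real.exp (m / (12 * ħ) * ‖x‖ ^ 2)) * Real.exp (-(m / (12 * ħ)) * ‖x‖ ^ 2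
          - m / (12 * ħ) * ‖x‖ ^ 2 - m / (12 * ħ) * ‖x‖ ^ 2)) := by
        refine mul_le_mul (exp_mul_le_exp_sq hc a _) ?_ (by positivity) (by positivity)
        exact mul_le_mul (hp x) h1 (by positivity) (by positivity)
    _ = _ := by
        rw [sub_eq_add_neg, sub_eq_add_neg, Real.exp_add, Real.exp_add, Real.exp_neg (_ * _)]
        field_simp

end GaussianSections

/-! ### Polynomial sections in L². -/

section SquareIntegrable

variable {S : Type*} [NormedAddCommGroup S] [InnerProductSpace ℝ S] [FiniteDimensional ℝ S]
  [MeasurableSpace S] [BorelSpace S]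

theorem integrable_exp_neg_mul_norm_sq {c : ℝ} (hc : 0 < c) :
    Integrable fun x : S => Real.exp (-c * ‖x‖ ^ 2) := by
  have h := (GaussianFourier.integrable_cexp_neg_mul_sq_norm_add (V := S) (b := (c : ℂ))
    (by simpa using hc) 0 0).norm
  refine h.congr (Filter.Eventually.of_forall fun x => ?_)
  simp only [zero_mul, add_zero, norm_exp]
  congr 1
  have : (-(c : ℂ) * (‖x‖ : ℂ) ^ 2) = ((-c * ‖x‖ ^ 2 : ℝ) : ℂ) := by push_cast; ring
  rw [this, ofReal_re]

theorem memLp_two_exp_neg_mul_norm_sq {c : ℝ} (hc : 0 < c) :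
    MemLp (fun x : S => Real.exp (-c * ‖x‖ ^ 2)) 2 (volume : Measure S) := by
  rw [memLp_two_iff_integrable_sq (Continuous.aestronglyMeasurable (by fun_prop))]
  refine (integrable_exp_neg_mul_norm_sq (mul_pos two_pos hc)).congr
    (Filter.Eventually.of_forall fun x => ?_)
  simp only [sq (Real.exp _), ← Real.exp_add]
  ring_nf

/-- Convergence in `L²` from domination by multiples of a square-integrable function. -/
theorem tendsto_toLp_of_norm_sub_le {f : ℕ → S → ℂ} {g : S → ℂ} {h : S → ℝ} {a : ℕ → ℝ}
    (hf : ∀ n, MemLp (f n) 2 (volume : Measure S)) (hg : MemLp g 2 (volume : Measure S))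
    (hh : MemLp h 2 (volume : Measure S)) (ha : Filter.Tendsto a Filter.atTop (nhds 0))
    (hle : ∀ n x, ‖f n x - g x‖ ≤ a n * h x) :
    Filter.Tendsto (fun n => (hf n).toLp (f n)) Filter.atTop (nhds (hg.toLp g)) := by
  rw [tendsto_iff_norm_sub_tendsto_zero]
  have hlim : Filter.Tendsto (fun n => |a n| * ‖hh.toLp h‖) Filter.atTop (nhds 0) := by
    simpa using ha.abs.mul_const ‖hh.toLp h‖
  refine squeeze_zero (fun n => norm_nonneg _) (fun n => ?_) hlim
  refine Lp.norm_le_mul_norm_of_ae_le_mul ?_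
  rw [← MemLp.toLp_sub]
  filter_upwards [((hf n).sub hg).coeFn_toLp, hh.coeFn_toLp] with x h1 h2
  rw [h1, h2, Pi.sub_apply, Real.norm_eq_abs]
  refine (hle n x).trans ((le_abs_self _).trans ?_)
  rw [abs_mul]

variable {N : ℕ} {u : OrthonormalBasis (Fin N ⊕ Fin N) ℝ S} {ħ : ℝ} {ω : LinearMap.BilinForm ℝ S}
  {θ : S → S →L[ℝ] ℝ} {χ : S → ℝ} {ϑ : Fin N → ℝ}

theorem memLp_polySection (hu : IsUnitaryFrame ω u ϑ) (hħ : 0 < ħ) (hω : ω.IsAlt)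
    (hn : ω.Nondegenerate) (hχ : ContDiff ℝ (⊤ : ℕ∞) χ) (p : MvPolynomial (Fin N ⊕ Fin N) ℂ) :
    MemLp (polySection u ħ ω χ p) 2 (volume : Measure S) := by
  obtain ⟨c, hc, h⟩ := exists_norm_polySection_le hu hħ hω hn χ
  obtain ⟨C, hC, hp⟩ := h p 0
  refine ((memLp_two_exp_neg_mul_norm_sq hc).const_mul C).of_le
    (contDiff_polySection u ħ ω hχ p).continuous.aestronglyMeasurable
    (Filter.Eventually.of_forall fun x => ?_)
  have := hp x
  rw [zero_mul, Real.exp_zero, one_mul] at this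
  exact this.trans (le_abs_self _)

/-- Polynomial sections as elements of `L²`. -/
def polyToL2 (hu : IsUnitaryFrame ω u ϑ) (hħ : 0 < ħ) (hω : ω.IsAlt) (hn : ω.Nondegenerate)
    (hχ : ContDiff ℝ (⊤ : ℕ∞) χ) : MvPolynomial (Fin N ⊕ Fin N) ℂ →ₗ[ℂ] L2Sections S where
  toFun p := (memLp_polySection hu hħ hω hn hχ p).toLp (polySection u ħ ω χ p)
  map_add' p q := by
    rw [← MemLp.toLp_add, MemLp.toLp_eq_toLp_iff]
    exact Filter.Eventually.of_forall fun x => by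
      simp [polySection, polyFun_add, add_mul]
  map_smul' c p := by
    rw [RingHom.id_apply, ← MemLp.toLp_const_smul, MemLp.toLp_eq_toLp_iff]
    exact Filter.Eventually.of_forall fun x => by
      simp [polySection, polyFun_smul, mul_assoc]

theorem coeFn_polyToL2 (hu : IsUnitaryFrame ω u ϑ) (hħ : 0 < ħ) (hω : ω.IsAlt)
    (hn : ω.Nondegenerate) (hχ : ContDiff ℝ (⊤ : ℕ∞) χ) (p : MvPolynomial (Fin N ⊕ Fin N) ℂ) :
    polyToL2 hu hħ hω hn hχ p =ᵐ[volume] polySection u ħ ω χ p :=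
  (memLp_polySection hu hħ hω hn hχ p).coeFn_toLp

end SquareIntegrable

/-! ### The connection as a closable operator. -/

section ConnectionOperator

theorem covDeriv_ofReal_mul {S : Type*} [NormedAddCommGroup S] [InnerProductSpace ℝ S] {ħ : ℝ}
    {θ : S → S →L[ℝ] ℝ} {ρ : S → ℝ} {f : S → ℂ} {x : S} (hρ : DifferentiableAt ℝ ρ x)
    (hf : DifferentiableAt ℝ f x) (v : S) :
    covDeriv ħ θ (fun x => (ρ x : ℂ) * f x) x v
      = ρ x * covDeriv ħ θ f x v + (fderiv ℝ ρ x v : ℝ) * f x := by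
  have h1 := ofRealCLM.hasFDerivAt.comp x hρ.hasFDerivAt
  have h2 : HasFDerivAt (fun x => (ρ x : ℂ) * f x) _ x := h1.mul hf.hasFDerivAt
  rw [covDeriv, h2.fderiv]
  simp only [covDeriv, add_apply, smul_apply, ContinuousLinearMap.comp_apply, ofRealCLM_apply,
    Function.comp_apply, smul_eq_mul]
  ring

variable {S : Type*} [NormedAddCommGroup S] [InnerProductSpace ℝ S] [FiniteDimensional ℝ S]
  [MeasurableSpace S] [BorelSpace S]

theorem inner_toLp {f g : S → ℂ} (hf : MemLp f 2 (volume : Measure S))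
    (hg : MemLp g 2 (volume : Measure S)) :
    inner ℂ (hf.toLp f) (hg.toLp g) = ∫ x, star (f x) * g x := by
  rw [L2.inner_def]
  refine integral_congr_ae ?_
  filter_upwards [hf.coeFn_toLp, hg.coeFn_toLp] with x h1 h2
  rw [h1, h2, RCLike.inner_apply, mul_comm]
  rfl

/-- The covariant derivative is skew-adjoint. -/
theorem integral_star_mul_covDeriv (ħ : ℝ) {θ : S → S →L[ℝ] ℝ} (hθ : ContDiff ℝ (⊤ : ℕ∞) θ)
    {g : S → ℂ} (hg : ContDiff ℝ (⊤ : ℕ∞) g) (f : 𝓓((⊤ : TopologicalSpace.Opens S), ℂ)) (v : S) :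
    ∫ x, star (g x) * covDeriv ħ θ f x v = -∫ x, star (covDeriv ħ θ g x v) * f x := by
  have hf1 : Continuous (fderiv ℝ (f : S → ℂ)) := f.contDiff.continuous_fderiv (by simp)
  have hg1 : Continuous (fderiv ℝ g) := hg.continuous_fderiv (by simp)
  have hf0 := f.continuous
  have hg0 := hg.continuous
  have hθ0 := hθ.continuous
  let G : S → ℂ := fun x => star (g x)
  have hG : ContDiff ℝ (⊤ : ℕ∞) G := conjCLE.contDiff.comp hg
  have hGd : ∀ x, fderiv ℝ G x v = star (fderiv ℝ g x v) := fun x => by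
    have h := conjCLE.hasFDerivAt.comp x ((hg.differentiable (by simp)) x).hasFDerivAt
    have h' : HasFDerivAt G _ x := h
    rw [h'.fderiv]
    rfl
  have hsupp : ∀ h : S → ℂ, Continuous h → Integrable fun x => h x * f x := fun h hh =>
    (hh.mul hf0).integrable_of_hasCompactSupport f.hasCompactSupport.mul_left
  have hsupp' : Integrable fun x => G x * fderiv ℝ (f : S → ℂ) x v :=
    Continuous.integrable_of_hasCompactSupport (by fun_prop)
      (f.hasCompactSupport.fderiv_apply ℝ v).mul_left
  have key := integral_mul_fderiv_eq_neg_fderiv_mul_of_integrable (μ := (volume : Measure S))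
    (f := G) (g := f) (v := v) (hsupp _ ((hG.continuous_fderiv (by simp)).clm_apply
      continuous_const)) hsupp' (hsupp _ hG.continuous)
    (fun x _ => hG.differentiable (by simp) x) (fun x _ => f.contDiff.differentiable (by simp) x)
  have h1 : ∀ x, star (g x) * covDeriv ħ θ f x v
      = G x * fderiv ℝ (f : S → ℂ) x v + (G x * (I / (ħ : ℂ) * (θ x v : ℂ))) * f x := fun x => by
    simp only [covDeriv, G]; ring
  -- The potential iθ/ħ is imaginary, so conjugation flips its sign. The potential terms on the two
  -- sides then agree, and only the ordinary integration by parts remains.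
  have h2 : ∀ x, star (covDeriv ħ θ g x v) * f x
      = fderiv ℝ G x v * f x - (G x * (I / (ħ : ℂ) * (θ x v : ℂ))) * f x := fun x => by
    rw [hGd]
    simp only [covDeriv, G, star_def, map_add, map_mul, map_div₀, conj_I, conj_ofReal]; ring
  have hint : Integrable fun x => (G x * (I / (ħ : ℂ) * (θ x v : ℂ))) * f x :=
    hsupp _ (by fun_prop)
  simp only [h1, h2]
  rw [integral_add hsupp' hint, integral_sub (hsupp _ ((hG.continuous_fderiv (by simp)).clm_apply
      continuous_const)) hint, key]
  ring

theorem memLp_test (f : 𝓓((⊤ : TopologicalSpace.Opens S), ℂ)) :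
    MemLp f 2 (volume : Measure S) :=
  f.continuous.memLp_of_hasCompactSupport f.hasCompactSupport

theorem memLp_covDeriv_test (ħ : ℝ) {θ : S → S →L[ℝ] ℝ} (hθ : ContDiff ℝ (⊤ : ℕ∞) θ)
    (f : 𝓓((⊤ : TopologicalSpace.Opens S), ℂ)) (v : S) :
    MemLp (fun x => covDeriv ħ θ f x v) 2 (volume : Measure S) :=
  (continuous_covDeriv ħ hθ f v).memLp_of_hasCompactSupport (hasCompactSupport_covDeriv ħ θ f v)

theorem testToL2_apply (f : 𝓓((⊤ : TopologicalSpace.Opens S), ℂ)) :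
    testToL2 f = (memLp_test f).toLp f := rfl

theorem derivTest_apply (ħ : ℝ) {θ : S → S →L[ℝ] ℝ} (hθ : ContDiff ℝ (⊤ : ℕ∞) θ)
    (f : 𝓓((⊤ : TopologicalSpace.Opens S), ℂ)) (v : S) :
    derivTest ħ hθ v f = (memLp_covDeriv_test ħ hθ f v).toLp fun x => covDeriv ħ θ f x v := rfl

theorem inner_toLp_derivTest (ħ : ℝ) {θ : S → S →L[ℝ] ℝ} (hθ : ContDiff ℝ (⊤ : ℕ∞) θ)
    {g : S → ℂ} (hg : ContDiff ℝ (⊤ : ℕ∞) g) (hg2 : MemLp g 2 (volume : Measure S)) {v : S}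
    (hgv : MemLp (fun x => covDeriv ħ θ g x v) 2 (volume : Measure S))
    (f : 𝓓((⊤ : TopologicalSpace.Opens S), ℂ)) :
    inner ℂ (hg2.toLp g) (derivTest ħ hθ v f)
      = -inner ℂ (hgv.toLp fun x => covDeriv ħ θ g x v) (testToL2 f) := by
  rw [derivTest_apply, testToL2_apply, inner_toLp, inner_toLp]
  exact integral_star_mul_covDeriv ħ hθ hg f v

/-- A smooth compactly supported function as a test section. -/
def mkTest {g : S → ℂ} (hg : ContDiff ℝ (⊤ : ℕ∞) g) (hc : HasCompactSupport g) :
    𝓓((⊤ : TopologicalSpace.Opens S), ℂ) := ⟨g, hg, hc, fun _ _ => trivial⟩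

theorem eq_zero_of_forall_inner_testToL2 {ψ : L2Sections S}
    (h : ∀ f, inner ℂ ψ (testToL2 f) = 0) : ψ = 0 := by
  have hloc : LocallyIntegrable (fun x => star (ψ x)) (volume : Measure S) :=
    ((Lp.memLp ψ).star.locallyIntegrable (by norm_num))
  have key := ae_eq_zero_of_integral_contDiff_smul_eq_zero hloc fun g hg hc => by
    have hg' : ContDiff ℝ (⊤ : ℕ∞) fun x => (g x : ℂ) := ofRealCLM.contDiff.comp hg
    have hc' : HasCompactSupport fun x => (g x : ℂ) := hc.comp_left (g := ofReal) ofReal_zero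
    rw [← h (mkTest hg' hc')]
    rw [testToL2_apply, L2.inner_def]
    refine integral_congr_ae ?_
    filter_upwards [(memLp_test (mkTest hg' hc')).coeFn_toLp] with x hx
    rw [hx, RCLike.inner_apply, real_smul]
    rfl
  refine (Lp.eq_zero_iff_ae_eq_zero).2 ?_
  filter_upwards [key] with x hx
  simpa using hx

theorem dense_range_testToL2 : Dense ((LinearMap.range (testToL2 (S := S)) : Submodule ℂ _) :
    Set (L2Sections S)) := by
  rw [Submodule.dense_iff_topologicalClosure_eq_top, Submodule.topologicalClosure_eq_top_iff,
    Submodule.eq_bot_iff]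
  intro ψ hψ
  refine eq_zero_of_forall_inner_testToL2 fun f => ?_
  rw [← inner_conj_symm, hψ _ ⟨f, rfl⟩, map_zero]

variable {ι : Type*} [Fintype ι] {ħ : ℝ} {θ : S → S →L[ℝ] ℝ} {hθ : ContDiff ℝ (⊤ : ℕ∞) θ}
  {e : OrthonormalBasis ι ℝ S}

theorem mem_graph_connectionOp {a : L2Sections S} {b : L2OneForms S ι} :
    (a, b) ∈ (connectionOp ħ hθ e).graph ↔ ∃ f, testToL2 f = a ∧ gradTest ħ hθ e f = b := by
  have key : ∀ f, (LinearEquiv.ofInjective (testToL2 (S := S)) testToL2_injective).symm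
      ⟨testToL2 f, ⟨f, rfl⟩⟩ = f := fun f => by
    rw [LinearEquiv.symm_apply_eq]; rfl
  rw [LinearPMap.mem_graph_iff]
  constructor
  · rintro ⟨⟨_, f, rfl⟩, rfl, rfl⟩
    exact ⟨f, rfl, congrArg (gradTest ħ hθ e) (key f).symm⟩
  · rintro ⟨f, rfl, rfl⟩
    exact ⟨⟨testToL2 f, ⟨f, rfl⟩⟩, rfl, congrArg (gradTest ħ hθ e) (key f)⟩

theorem gradTest_apply (f : 𝓓((⊤ : TopologicalSpace.Opens S), ℂ)) (j : ι) :
    gradTest ħ hθ e f j = derivTest ħ hθ (e j) f := rfl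

theorem dense_domain_connectionOp :
    Dense ((connectionOp ħ hθ e).domain : Set (L2Sections S)) := dense_range_testToL2

/-- Integration by parts extends to the closure of the graph, so a limit pair (0, b) has each
component of b orthogonal to all test sections. -/
theorem isClosable_connectionOp : (connectionOp ħ hθ e).IsClosable := by
  refine ⟨(connectionOp ħ hθ e).graph.topologicalClosure.toLinearPMap, ?_⟩
  rw [Submodule.toLinearPMap_graph_eq]
  rintro ⟨a, b⟩ hab (ha : a = 0)
  have hadj : ∀ (f : 𝓓((⊤ : TopologicalSpace.Opens S), ℂ)) (j : ι),
      inner ℂ (b j) (testToL2 f) = -inner ℂ a (derivTest ħ hθ (e j) f) := by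
    intro f j
    have hclosed : IsClosed {q : L2Sections S × L2OneForms S ι |
        inner ℂ (q.2 j) (testToL2 f) = -inner ℂ q.1 (derivTest ħ hθ (e j) f)} :=
      isClosed_eq (by fun_prop) (by fun_prop)
    refine closure_minimal ?_ hclosed hab
    rintro ⟨a, b⟩ hab
    obtain ⟨g, rfl, rfl⟩ := mem_graph_connectionOp.1 hab
    change inner ℂ (derivTest ħ hθ (e j) g) (testToL2 f)
      = -inner ℂ (testToL2 g) (derivTest ħ hθ (e j) f)
    rw [testToL2_apply g, inner_toLp_derivTest ħ hθ g.contDiff (memLp_test g)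
      (memLp_covDeriv_test ħ hθ g (e j)) f, neg_neg, derivTest_apply]
  refine PiLp.ext fun j => eq_zero_of_forall_inner_testToL2 fun f => ?_
  rw [hadj, ha, inner_zero_left, neg_zero]

theorem isClosed_graph_bochnerLaplacian :
    IsClosed ((bochnerLaplacian ħ hθ e).graph : Set (L2Sections S × L2Sections S)) :=
  isClosed_graph_adjointCompClosure dense_domain_connectionOp isClosable_connectionOp

theorem isSymmetricOp_bochnerLaplacian : IsSymmetricOp (bochnerLaplacian ħ hθ e) :=
  fun _ _ _ _ h h' => inner_eq_of_mem_graph_adjointCompClosure (T := connectionOp ħ hθ e)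
    dense_domain_connectionOp isClosable_connectionOp h h'

/-! ### Polynomial sections are in the domain of the Laplacian -/

variable {N : ℕ} {u : OrthonormalBasis (Fin N ⊕ Fin N) ℝ S} {ω : LinearMap.BilinForm ℝ S}
  {χ : S → ℝ} {ϑ : Fin N → ℝ}

/-- Polynomial sections are limits of test sections together with their covariant derivatives. -/
theorem exists_tendsto_polyToL2 (hu : IsUnitaryFrame ω u ϑ) (hħ : 0 < ħ) (hω : ω.IsAlt)
    (hn : ω.Nondegenerate) (hθ : ContDiff ℝ (⊤ : ℕ∞) θ) (hχ : IsGaugeFunction ω θ χ)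
    (p : MvPolynomial (Fin N ⊕ Fin N) ℂ) :
    ∃ f : ℕ → 𝓓((⊤ : TopologicalSpace.Opens S), ℂ),
      Filter.Tendsto (fun n => testToL2 (f n)) Filter.atTop
        (nhds (polyToL2 hu hħ hω hn hχ.contDiff p)) ∧
      ∀ v, Filter.Tendsto (fun n => derivTest ħ hθ v (f n)) Filter.atTop
        (nhds (polyToL2 hu hħ hω hn hχ.contDiff (nablaVec u ħ ϑ v p))) := by
  let ρ : ContDiffBump (0 : S) := ⟨1, 2, one_pos, one_lt_two⟩
  -- Cutoffs are dilations of one bump function. Their gradients are O(r_n), and they equal 1 on the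
  -- ball of radius 1/r_n.
  let r : ℕ → ℝ := fun n => 1 / ((n : ℝ) + 1)
  have hr : ∀ n, 0 < r n := fun n => Nat.one_div_pos_of_nat
  have hr0 : Filter.Tendsto r Filter.atTop (nhds 0) := tendsto_one_div_add_atTop_nhds_zero_nat
  let η : ℕ → S → ℝ := fun n x => ρ (r n • x)
  have hη : ∀ n, ContDiff ℝ (⊤ : ℕ∞) (η n) := fun n =>
    ρ.contDiff.comp (contDiff_const_smul (r n))
  have hηc : ∀ n, HasCompactSupport (η n) := fun n =>
    ρ.hasCompactSupport.comp_homeomorph (Homeomorph.smulOfNeZero (r n) (hr n).ne')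
  have hsec := contDiff_polySection u ħ ω hχ.contDiff p
  -- Outside the ball of radius 1/r_n one has 1 ≤ r_n‖x‖. The exponential weight is harmless against
  -- the Gaussian decay and makes the bound uniform in x.
  have hη1 : ∀ n x, |η n x - 1| ≤ r n * Real.exp (1 * ‖x‖) := by
    intro n x
    have hexp : ‖x‖ ≤ Real.exp (1 * ‖x‖) := by
      have := Real.add_one_le_exp (1 * ‖x‖); linarith
    rcases le_or_gt (r n * ‖x‖) 1 with h | h
    · have : η n x = 1 := ρ.one_of_mem_closedBall (by
        rw [mem_closedBall_zero_iff, norm_smul, Real.norm_of_nonneg (hr n).le]; exact h)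
      rw [this, sub_self, abs_zero]
      exact mul_nonneg (hr n).le (Real.exp_pos _).le
    · have h0 : 0 ≤ η n x := ρ.nonneg
      have h1 : η n x ≤ 1 := ρ.le_one
      have h2 := mul_le_mul_of_nonneg_left hexp (hr n).le
      rw [abs_le]
      constructor <;> linarith
  obtain ⟨M, hM⟩ := (ρ.hasCompactSupport.fderiv ℝ).exists_bound_of_continuous
    (ρ.contDiff.continuous_fderiv (n := 1) (by simp))
  have hη2 : ∀ n x v, |fderiv ℝ (η n) x v| ≤ r n * (M * ‖v‖) := by
    intro n x v
    have hd : HasFDerivAt (η n) (fderiv ℝ ρ (r n • x) ∘L (r n • ContinuousLinearMap.id ℝ S)) x :=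
      ((ρ.contDiff (n := 1)).differentiable (by simp) _).hasFDerivAt.comp x
        ((hasFDerivAt_id x).const_smul (r n))
    rw [hd.fderiv]
    simp only [ContinuousLinearMap.comp_apply, smul_apply, ContinuousLinearMap.id_apply, map_smul,
      smul_eq_mul, abs_mul, abs_of_pos (hr n)]
    refine mul_le_mul_of_nonneg_left ?_ (hr n).le
    rw [← Real.norm_eq_abs]
    exact ((fderiv ℝ ρ (r n • x)).le_opNorm v).trans
      (mul_le_mul_of_nonneg_right (hM _) (norm_nonneg _))
  have hF : ∀ n, ContDiff ℝ (⊤ : ℕ∞) fun x => (η n x : ℂ) * polySection u ħ ω χ p x := fun n =>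
    (ofRealCLM.contDiff.comp (hη n)).mul hsec
  have hFc : ∀ n, HasCompactSupport fun x => (η n x : ℂ) * polySection u ħ ω χ p x := fun n =>
    ((hηc n).comp_left (g := ofReal) ofReal_zero).mul_right
  obtain ⟨c, hc, hdec⟩ := exists_norm_polySection_le hu hħ hω hn χ
  refine ⟨fun n => mkTest (hF n) (hFc n), ?_, fun v => ?_⟩
  · obtain ⟨C, hC, h⟩ := hdec p 1
    refine tendsto_toLp_of_norm_sub_le (a := r) (fun n => memLp_test (mkTest (hF n) (hFc n)))
      (memLp_polySection hu hħ hω hn hχ.contDiff p)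
      ((memLp_two_exp_neg_mul_norm_sq hc).const_mul C) hr0 fun n x => ?_
    change ‖(η n x : ℂ) * polySection u ħ ω χ p x - polySection u ħ ω χ p x‖ ≤ _
    rw [← sub_one_mul, norm_mul, ← ofReal_one, ← ofReal_sub, norm_real, Real.norm_eq_abs]
    refine (mul_le_mul_of_nonneg_right (hη1 n x) (norm_nonneg _)).trans ?_
    rw [mul_assoc]
    exact mul_le_mul_of_nonneg_left (h x) (hr n).le
  · obtain ⟨C, hC, h⟩ := hdec (nablaVec u ħ ϑ v p) 1
    obtain ⟨C', hC', h'⟩ := hdec p 0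
    refine tendsto_toLp_of_norm_sub_le (a := r)
      (fun n => memLp_covDeriv_test ħ hθ (mkTest (hF n) (hFc n)) v)
      (memLp_polySection hu hħ hω hn hχ.contDiff (nablaVec u ħ ϑ v p))
      ((memLp_two_exp_neg_mul_norm_sq hc).const_mul (C + |M| * ‖v‖ * C')) hr0 fun n x => ?_
    change ‖covDeriv ħ θ (fun x => (η n x : ℂ) * polySection u ħ ω χ p x) x v - _‖ ≤ _
    rw [covDeriv_ofReal_mul ((hη n).differentiable (by simp) x)
      (hsec.differentiable (by simp) x), covDeriv_polySection hu hħ hω hn hχ]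
    set a := polySection u ħ ω χ (nablaVec u ħ ϑ v p) x
    set b := polySection u ħ ω χ p x with hb
    have e1 : (η n x : ℂ) * a + (fderiv ℝ (η n) x v : ℝ) * b - a
        = ((η n x - 1 : ℝ) : ℂ) * a + (fderiv ℝ (η n) x v : ℝ) * b := by push_cast; ring
    rw [e1]
    refine (norm_add_le _ _).trans ?_
    rw [norm_mul, norm_mul, norm_real, norm_real, Real.norm_eq_abs, Real.norm_eq_abs]
    have h1 : |η n x - 1| * ‖a‖ ≤ r n * (C * Real.exp (-c * ‖x‖ ^ 2)) := by
      refine (mul_le_mul_of_nonneg_right (hη1 n x) (norm_nonneg _)).trans ?_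
      rw [mul_assoc]
      exact mul_le_mul_of_nonneg_left (h x) (hr n).le
    have h2 : |fderiv ℝ (η n) x v| * ‖b‖
        ≤ r n * (|M| * ‖v‖) * (C' * Real.exp (-c * ‖x‖ ^ 2)) := by
      have h3 := h' x
      rw [zero_mul, Real.exp_zero, one_mul] at h3
      refine mul_le_mul ((hη2 n x v).trans ?_) h3 (norm_nonneg _)
        (mul_nonneg (hr n).le (by positivity))
      exact mul_le_mul_of_nonneg_left (mul_le_mul_of_nonneg_right (le_abs_self M)
        (norm_nonneg _)) (hr n).le
    calc _ ≤ _ := add_le_add h1 h2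
      _ = _ := by ring

theorem polyToL2_mem_closure_graph (hu : IsUnitaryFrame ω u ϑ) (hħ : 0 < ħ) (hω : ω.IsAlt)
    (hn : ω.Nondegenerate) (hχ : IsGaugeFunction ω θ χ) (p : MvPolynomial (Fin N ⊕ Fin N) ℂ) :
    (polyToL2 hu hħ hω hn hχ.contDiff p, WithLp.toLp 2 fun j =>
      polyToL2 hu hħ hω hn hχ.contDiff (nablaVec u ħ ϑ (e j) p))
      ∈ (connectionOp ħ hθ e).closure.graph := by
  rw [← isClosable_connectionOp.graph_closure_eq_closure_graph]
  obtain ⟨f, h1, h2⟩ := exists_tendsto_polyToL2 hu hħ hω hn hθ hχ p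
  have h3 : Filter.Tendsto (fun n => gradTest ħ hθ e (f n)) Filter.atTop
      (nhds (WithLp.toLp 2 fun j => polyToL2 hu hħ hω hn hχ.contDiff (nablaVec u ħ ϑ (e j) p))) :=
    ((PiLp.continuous_toLp 2 _).tendsto _).comp (tendsto_pi_nhds.2 fun j => h2 (e j))
  exact mem_closure_of_tendsto (h1.prodMk_nhds h3)
    (Filter.Eventually.of_forall fun n => mem_graph_connectionOp.2 ⟨f n, rfl, rfl⟩)

theorem inner_polyToL2_derivTest (hu : IsUnitaryFrame ω u ϑ) (hħ : 0 < ħ) (hω : ω.IsAlt)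
    (hn : ω.Nondegenerate) (hθ : ContDiff ℝ (⊤ : ℕ∞) θ) (hχ : IsGaugeFunction ω θ χ)
    (p : MvPolynomial (Fin N ⊕ Fin N) ℂ) (v : S) (f : 𝓓((⊤ : TopologicalSpace.Opens S), ℂ)) :
    inner ℂ (polyToL2 hu hħ hω hn hχ.contDiff p) (derivTest ħ hθ v f)
      = -inner ℂ (polyToL2 hu hħ hω hn hχ.contDiff (nablaVec u ħ ϑ v p)) (testToL2 f) := by
  have hcov : (fun x => covDeriv ħ θ (polySection u ħ ω χ p) x v)
      = polySection u ħ ω χ (nablaVec u ħ ϑ v p) :=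
    funext fun x => covDeriv_polySection hu hħ hω hn hχ p x v
  have h2 := memLp_polySection hu hħ hω hn hχ.contDiff (nablaVec u ħ ϑ v p)
  rw [← hcov] at h2
  refine (inner_toLp_derivTest ħ hθ (contDiff_polySection u ħ ω hχ.contDiff p)
    (memLp_polySection hu hħ hω hn hχ.contDiff p) h2 f).trans ?_
  congr 3

/-- The eigenvalue of the Landau level with occupation numbers `n`. -/
def landauLevel (ħ : ℝ) (ϑ : Fin N → ℝ) (n : Fin N → ℕ) : ℝ :=
  1 / ħ * ∑ i, (2 * (n i : ℝ) + 1) * ϑ i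

/-- The gradient of the section comes from the closure of ∇ by cutoffs. Pairing that gradient with
the gradients of test sections and integrating by parts produces -∑∇², which is the level's scalar
by the ladder computation. -/
theorem polyToL2_mem_eigenSubmodule (hu : IsUnitaryFrame ω u ϑ) (hħ : 0 < ħ) (hω : ω.IsAlt)
    (hn : ω.Nondegenerate) (hχ : IsGaugeFunction ω θ χ) {n : Fin N → ℕ}
    {p : MvPolynomial (Fin N ⊕ Fin N) ℂ}
    (hp : p ∈ levelSpace (fun i => ((ϑ i / (2 * ħ) : ℝ) : ℂ)) n) :
    polyToL2 hu hħ hω hn hχ.contDiff p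
      ∈ eigenSubmodule (bochnerLaplacian ħ hθ e) (landauLevel ħ ϑ n : ℝ) := by
  have hadj : (WithLp.toLp 2 fun j => polyToL2 hu hħ hω hn hχ.contDiff (nablaVec u ħ ϑ (e j) p),
      (landauLevel ħ ϑ n : ℂ) • polyToL2 hu hħ hω hn hχ.contDiff p)
      ∈ (connectionOp ħ hθ e).adjoint.graph := by
    refine (mem_graph_adjoint_iff (T := connectionOp ħ hθ e)
      (dense_domain_connectionOp (ħ := ħ) (hθ := hθ) (e := e)) _ _).2 fun x => ?_
    have hx : ((x : L2Sections S), connectionOp ħ hθ e x) ∈ (connectionOp ħ hθ e).graph :=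
      (connectionOp ħ hθ e).mem_graph x
    obtain ⟨f, hf1, hf2⟩ := mem_graph_connectionOp.1 hx
    rw [← hf1, ← hf2, PiLp.inner_apply]
    simp only [gradTest_apply, inner_polyToL2_derivTest hu hħ hω hn hθ hχ]
    rw [Finset.sum_neg_distrib, ← sum_inner, ← map_sum, sum_nablaVec_nablaVec e hħ hp, map_neg,
      map_smul, inner_neg_left, neg_neg]
    rfl
  exact (mem_graph_adjointCompClosure (connectionOp ħ hθ e) _ _).2
    ⟨_, polyToL2_mem_closure_graph hu hħ hω hn hχ p, hadj⟩

end ConnectionOperator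

/-- Real linear functionals are polynomials in `z` and `z̄`. -/
theorem exists_polyFun_eq_inner {S : Type*} [NormedAddCommGroup S] [InnerProductSpace ℝ S]
    {N : ℕ} (u : OrthonormalBasis (Fin N ⊕ Fin N) ℝ S) (w : S) :
    ∃ p, ∀ x, polyFun u p x = ((inner ℝ x w : ℝ) : ℂ) := by
  refine ⟨∑ i, (((inner ℝ (u (Sum.inl i)) w : ℝ) : ℂ) • (2 : ℂ)⁻¹ •
      (MvPolynomial.X (Sum.inl i) + MvPolynomial.X (Sum.inr i))
    + ((inner ℝ (u (Sum.inr i)) w : ℝ) : ℂ) • (2 * I)⁻¹ •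
      (MvPolynomial.X (Sum.inl i) - MvPolynomial.X (Sum.inr i))), fun x => ?_⟩
  have h2 : ((inner ℝ x w : ℝ) : ℂ) = ∑ s, ((inner ℝ (u s) w : ℝ) : ℂ)
      * ((inner ℝ (u s) x : ℝ) : ℂ) := by
    rw [← u.sum_inner_mul_inner, ofReal_sum]
    refine Finset.sum_congr rfl fun s _ => ?_
    rw [real_inner_comm, ofReal_mul, mul_comm]
  rw [h2, Fintype.sum_sum_type, ← Finset.sum_add_distrib]
  have hsum : ∀ q : Fin N → MvPolynomial (Fin N ⊕ Fin N) ℂ,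
      polyFun u (∑ i, q i) x = ∑ i, polyFun u (q i) x := fun q => by simp [polyFun]
  rw [hsum]
  refine Finset.sum_congr rfl fun i _ => ?_
  simp only [polyFun_add, polyFun_smul, polyFun_sub, polyFun_X, complexCoord_inl, complexCoord_inr]
  field_simp
  ring

/-! ### Density of the polynomial sections via moments. -/

section Density

open scoped FourierTransform SchwartzMap

variable {S : Type*} [NormedAddCommGroup S] [InnerProductSpace ℝ S] [FiniteDimensional ℝ S]
  [MeasurableSpace S] [BorelSpace S]

/-- An integrable function with vanishing Fourier transform vanishes almost everywhere. -/
theorem ae_eq_zero_of_fourier_eq_zero {h : S → ℂ} (hh : Integrable h)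
    (h0 : ∀ w, 𝓕 h w = 0) : h =ᵐ[volume] 0 := by
  refine ae_eq_zero_of_integral_contDiff_smul_eq_zero hh.locallyIntegrable fun g hg hc => ?_
  have hg' : ContDiff ℝ (⊤ : ℕ∞) fun x => (g x : ℂ) := ofRealCLM.contDiff.comp hg
  have hc' : HasCompactSupport fun x => (g x : ℂ) := hc.comp_left (g := ofReal) ofReal_zero
  -- A test function g is the Fourier transform of a Schwartz function φ, so ∫ g h = ∫ φ 𝓕h = 0.
  let φ : 𝓢(S, ℂ) := 𝓕⁻ (hc'.toSchwartzMap hg')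
  have hφ : ∀ x, 𝓕 (φ : S → ℂ) x = g x := fun x => by
    have h1 : 𝓕 φ = hc'.toSchwartzMap hg' := FourierTransform.fourier_fourierInv_eq _
    rw [← SchwartzMap.fourier_coe, h1]
    rfl
  have key := VectorFourier.integral_bilin_fourierIntegral_eq_flip (μ := (volume : Measure S))
    (ν := (volume : Measure S)) (ContinuousLinearMap.mul ℂ ℂ) (L := innerₗ S)
    Real.continuous_fourierChar continuous_inner φ.integrable hh
  have h1 : ∀ x, g x • h x = ContinuousLinearMap.mul ℂ ℂ (𝓕 (φ : S → ℂ) x) (h x) := fun x => by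
    rw [hφ, ContinuousLinearMap.mul_apply', real_smul]
  simp only [h1]
  refine key.trans ?_
  have h2 : ∀ x, VectorFourier.fourierIntegral Real.fourierChar volume (innerₗ S) h x = 0 := h0
  simp [h2]

/-- If all moments of a function with exponential decay vanish, so does the function. -/
theorem ae_eq_zero_of_moments_eq_zero {h : S → ℂ}
    (hexp : ∀ a : ℝ, Integrable fun x => (Real.exp (a * ‖x‖) : ℂ) * h x)
    (h0 : ∀ (w : S) (n : ℕ), ∫ x, ((inner ℝ x w : ℝ) : ℂ) ^ n * h x = 0) : h =ᵐ[volume] 0 := by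
  have hh : Integrable h := by simpa using hexp 0
  refine ae_eq_zero_of_fourier_eq_zero hh fun w => ?_
  -- The character is expanded into its power series. The terms are dominated by those of
  -- exp(2π‖w‖‖x‖)‖h x‖, which is integrable, so the Fourier integral is a series in the moments.
  have hsum : HasSum (fun n : ℕ => ∫ x, (-(2 * Real.pi * I)) ^ n / (n.factorial : ℂ) *
      (((inner ℝ x w : ℝ) : ℂ) ^ n * h x)) (𝓕 h w) := by
    rw [Real.fourier_eq']
    refine hasSum_integral_of_dominated_convergence
      (fun n x => (2 * Real.pi * ‖w‖ * ‖x‖) ^ n / (n.factorial : ℝ) * ‖h x‖) (fun n => ?_)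
      (fun n => Filter.Eventually.of_forall fun x => ?_)
      (Filter.Eventually.of_forall fun x => ?_) ?_ (Filter.Eventually.of_forall fun x => ?_)
    · refine AEStronglyMeasurable.mul (by fun_prop) (AEStronglyMeasurable.mul ?_ hh.1)
      exact Continuous.aestronglyMeasurable (by fun_prop)
    · have h1 : ‖((inner ℝ x w : ℝ) : ℂ)‖ ≤ ‖w‖ * ‖x‖ := by
        rw [norm_real, mul_comm]
        exact norm_inner_le_norm x w
      have h2 : ‖-(2 * (Real.pi : ℂ) * I)‖ = 2 * Real.pi := by
        simp [abs_of_pos Real.pi_pos]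
      rw [norm_mul, norm_mul, norm_div, norm_pow, norm_pow, h2, Complex.norm_natCast, ← mul_assoc,
        div_mul_eq_mul_div, ← mul_pow]
      refine mul_le_mul_of_nonneg_right (div_le_div_of_nonneg_right
        (pow_le_pow_left₀ (by positivity) ?_ n) (by positivity)) (norm_nonneg _)
      rw [mul_assoc (2 * Real.pi)]
      exact mul_le_mul_of_nonneg_left h1 (by positivity)
    · exact (Real.summable_pow_div_factorial _).mul_right _
    · have : (fun x => ∑' n : ℕ, (2 * Real.pi * ‖w‖ * ‖x‖) ^ n / (n.factorial : ℝ) * ‖h x‖)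
          = fun x => ‖(Real.exp (2 * Real.pi * ‖w‖ * ‖x‖) : ℂ) * h x‖ := by
        funext x
        rw [tsum_mul_right, norm_mul, norm_real, Real.norm_of_nonneg (Real.exp_pos _).le,
          Real.exp_eq_exp_ℝ, NormedSpace.exp_eq_tsum_div]
      rw [this]
      exact (hexp _).norm
    · have := (NormedSpace.expSeries_div_hasSum_exp (𝔸 := ℂ)
        (((-2 * Real.pi * inner ℝ x w : ℝ) : ℂ) * I)).mul_right (h x)
      rw [← Complex.exp_eq_exp_ℂ] at this
      convert! this using 2 with n
      have e : ((-2 * Real.pi * inner ℝ x w : ℝ) : ℂ) * I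
          = -(2 * Real.pi * I) * ((inner ℝ x w : ℝ) : ℂ) := by push_cast; ring
      rw [e, mul_pow]
      ring
  have hz : (fun n : ℕ => ∫ x, (-(2 * Real.pi * I)) ^ n / (n.factorial : ℂ) *
      (((inner ℝ x w : ℝ) : ℂ) ^ n * h x)) = fun _ => 0 := by
    funext n
    rw [integral_const_mul, h0, mul_zero]
  rw [hz] at hsum
  exact hsum.unique hasSum_zero

variable {N : ℕ} {u : OrthonormalBasis (Fin N ⊕ Fin N) ℝ S} {ħ : ℝ} {ω : LinearMap.BilinForm ℝ S}
  {χ : S → ℝ} {ϑ : Fin N → ℝ}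

/-- If ψ is orthogonal to the range, then all moments of Ḡψ vanish. This product of an L² function
with a Gaussian has finite exponential moments, so it is zero, and G has no zeros. -/
theorem dense_range_polyToL2 (hu : IsUnitaryFrame ω u ϑ) (hħ : 0 < ħ) (hω : ω.IsAlt)
    (hn : ω.Nondegenerate) (hχ : ContDiff ℝ (⊤ : ℕ∞) χ) :
    Dense ((LinearMap.range (polyToL2 hu hħ hω hn hχ) : Submodule ℂ (L2Sections S)) :
      Set (L2Sections S)) := by
  rw [Submodule.dense_iff_topologicalClosure_eq_top, Submodule.topologicalClosure_eq_top_iff,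
    Submodule.eq_bot_iff]
  intro ψ hψ
  let h : S → ℂ := fun x => star (gaugeGaussian ħ ω χ x) * ψ x
  have hGc : Continuous (gaugeGaussian ħ ω χ) := (contDiff_gaugeGaussian ħ ω hχ).continuous
  have hexp : ∀ a : ℝ, Integrable fun x => (Real.exp (a * ‖x‖) : ℂ) * h x := by
    intro a
    have h1 : MemLp (fun x => (Real.exp (a * ‖x‖) : ℂ) * star (gaugeGaussian ħ ω χ x)) 2
        (volume : Measure S) := by
      obtain ⟨c, hc, hdec⟩ := exists_norm_polySection_le hu hħ hω hn χ
      obtain ⟨C, hC, hp⟩ := hdec 1 a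
      refine ((memLp_two_exp_neg_mul_norm_sq hc).const_mul C).of_le
        (Continuous.aestronglyMeasurable (by fun_prop)) (Filter.Eventually.of_forall fun x => ?_)
      have h2 := hp x
      rw [polySection, ← MvPolynomial.C_1, polyFun_C, one_mul] at h2
      rw [norm_mul, norm_real, Real.norm_of_nonneg (Real.exp_pos _).le, norm_star]
      exact h2.trans (le_abs_self _)
    refine (h1.integrable_mul (Lp.memLp ψ)).congr (Filter.Eventually.of_forall fun x => ?_)
    simp only [Pi.mul_apply, h, mul_assoc]
  have key := ae_eq_zero_of_moments_eq_zero hexp fun w n => by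
    obtain ⟨p, hp⟩ := exists_polyFun_eq_inner u w
    rw [← hψ _ ⟨p ^ n, rfl⟩, L2.inner_def]
    refine integral_congr_ae ?_
    filter_upwards [coeFn_polyToL2 hu hħ hω hn hχ (p ^ n)] with x hx
    have e : polyFun u (p ^ n) x = ((inner ℝ x w : ℝ) : ℂ) ^ n := by
      rw [← hp]; simp [polyFun]
    rw [hx, RCLike.inner_apply, polySection, e]
    simp only [h, map_mul, map_pow, conj_ofReal, star_def]
    ring
  refine (Lp.eq_zero_iff_ae_eq_zero).2 ?_
  filter_upwards [key] with x hx
  exact (mul_eq_zero.1 hx).resolve_left (star_ne_zero.2 (gaugeGaussian_ne_zero ħ ω χ x))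

end Density

/-! ### The mean value property of holomorphic functions -/

section MeanValue

variable {S : Type*} [NormedAddCommGroup S] [InnerProductSpace ℝ S] {J : Module.End ℝ S}

/-- A skew-symmetric complex structure generates rotations. -/
theorem norm_cos_smul_add_sin_smul (hJ : ∀ v, J (J v) = -v)
    (hs : ∀ v w, inner ℝ (J v) w = -inner ℝ v (J w)) (t : ℝ) (y : S) :
    ‖Real.cos t • y + Real.sin t • J y‖ = ‖y‖ := by
  have h1 : inner ℝ y (J y) = 0 := by
    have := hs y y
    rw [real_inner_comm] at this
    linarith
  have h2 : ‖J y‖ ^ 2 = ‖y‖ ^ 2 := by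
    rw [← real_inner_self_eq_norm_sq, hs, hJ, inner_neg_right, neg_neg,
      real_inner_self_eq_norm_sq]
  rw [← sq_eq_sq₀ (norm_nonneg _) (norm_nonneg _), norm_add_sq_real, norm_smul, norm_smul,
    inner_smul_left, inner_smul_right, h1, mul_pow, mul_pow, h2, Real.norm_eq_abs,
    Real.norm_eq_abs, sq_abs, sq_abs]
  have := Real.cos_sq_add_sin_sq t
  simp only [mul_zero, add_zero]
  rw [← add_mul, this, one_mul]

/-- Restricted to the complex line ζ ↦ x + (Re ζ)y + (Im ζ)Jy, f is an entire function of ζ; its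
mean over the unit circle is its value at 0. -/
theorem integral_cos_sin_eq {f : S → ℂ} (hf : IsHolomorphicFunction J f) (x y : S) :
    ∫ t in 0..2 * Real.pi, f (x + (Real.cos t • y + Real.sin t • J y))
      = (2 * Real.pi : ℝ) * f x := by
  let L : ℂ →L[ℝ] S := reCLM.smulRight y + imCLM.smulRight (J y)
  let g : ℂ → ℂ := fun ζ => f (x + L ζ)
  have hg : ∀ ζ, HasFDerivAt g (fderiv ℝ f (x + L ζ) ∘L L) ζ := fun ζ =>
    ((hf.1.differentiable (by simp)) _).hasFDerivAt.comp ζ (L.hasFDerivAt.const_add x)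
  have hd : Differentiable ℂ g := fun ζ => by
    rw [differentiableAt_complex_iff_differentiableAt_real]
    refine ⟨(hg ζ).differentiableAt, ?_⟩
    rw [(hg ζ).fderiv]
    simpa [L] using hf.2 (x + L ζ) y
  have key := (hd.diffContOnCl (s := Metric.ball 0 |1|)).circleAverage
  rw [Real.circleAverage_def, inv_smul_eq_iff₀ (by positivity)] at key
  have h0 : g 0 = f x := by simp [g]
  rw [h0, real_smul] at key
  rw [← key]
  refine intervalIntegral.integral_congr fun t _ => ?_
  simp [g, L, circleMap, exp_re, exp_im]

variable [FiniteDimensional ℝ S] [MeasurableSpace S] [BorelSpace S]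

/-- The mean value property with respect to radial weights. -/
theorem integral_mul_radial_eq (hJ : ∀ v, J (J v) = -v)
    (hs : ∀ v w, inner ℝ (J v) w = -inner ℝ v (J w)) {f : S → ℂ} (hf : IsHolomorphicFunction J f)
    {ρ : S → ℂ} (hρ : Continuous ρ) (hρc : HasCompactSupport ρ)
    (hrad : ∀ x y, ‖x‖ = ‖y‖ → ρ x = ρ y) (x : S) :
    ∫ y, f (x + y) * ρ y = f x * ∫ y, ρ y := by
  have hfc : Continuous f := hf.1.continuous
  let R : ℝ → S →ₗᵢ[ℝ] S := fun t =>
    ⟨Real.cos t • LinearMap.id + Real.sin t • J, fun y => norm_cos_smul_add_sin_smul hJ hs t y⟩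
  have hR : ∀ t y, R t y = Real.cos t • y + Real.sin t • J y := fun t y => rfl
  let R' : ℝ → S ≃ₗᵢ[ℝ] S := fun t => (R t).toLinearIsometryEquiv rfl
  -- The rotation generated by `J` preserves volume and the radial weight. Averaging over t and
  -- exchanging the integrals then reduces the claim to the circle mean.
  have h1 : ∀ t : ℝ, ∫ y, f (x + R t y) * ρ y = ∫ y, f (x + y) * ρ y := by
    intro t
    rw [← (R' t).measurePreserving.integral_comp (R' t).toHomeomorph.measurableEmbedding
      (fun y => f (x + y) * ρ y)]
    refine integral_congr_ae (Filter.Eventually.of_forall fun y => ?_)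
    change f (x + R t y) * ρ y = f (x + R t y) * ρ (R t y)
    rw [hrad (R t y) y ((R t).norm_map y)]
  have hJc : Continuous J := J.continuous_of_finiteDimensional
  have hcont : Continuous (Function.uncurry fun (t : ℝ) (y : S) => f (x + R t y) * ρ y) := by
    simp only [Function.uncurry_def, hR]
    fun_prop
  have hint : Integrable (Function.uncurry fun (t : ℝ) (y : S) => f (x + R t y) * ρ y)
      ((volume.restrict (Set.uIoc 0 (2 * Real.pi))).prod volume) := by
    rw [← Measure.restrict_univ (μ := (volume : Measure S)), Measure.prod_restrict]
    have hK : IsCompact (Set.uIcc 0 (2 * Real.pi) ×ˢ tsupport ρ) := isCompact_uIcc.prod hρc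
    refine IntegrableOn.of_forall_sdiff_eq_zero
      ((hcont.continuousOn.integrableOn_compact hK).mono_set
        (s := Set.uIoc 0 (2 * Real.pi) ×ˢ tsupport ρ)
        (Set.prod_mono Set.uIoc_subset_uIcc subset_rfl)) (by measurability) ?_
    rintro ⟨t, y⟩ ⟨⟨ht, -⟩, hy⟩
    have : y ∉ tsupport ρ := fun h => hy ⟨ht, h⟩
    simp [image_eq_zero_of_notMem_tsupport this]
  have h2 := intervalIntegral_integral_swap hint
  simp only [h1, intervalIntegral.integral_const, sub_zero, real_smul] at h2
  simp only [intervalIntegral.integral_mul_const, hR, integral_cos_sin_eq hf, mul_assoc,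
    integral_const_mul] at h2
  exact mul_left_cancel₀ (ofReal_ne_zero.2 Real.two_pi_pos.ne') h2

/-- A smooth radial mollifier. -/
theorem exists_radial_mollifier : ∃ ρ : S → ℂ, ContDiff ℝ (⊤ : ℕ∞) ρ ∧ HasCompactSupport ρ ∧
    (∀ x y, ‖x‖ = ‖y‖ → ρ x = ρ y) ∧ ∫ y, ρ y ≠ 0 := by
  let r : S → ℝ := fun x => Real.smoothTransition (2 - ‖x‖ ^ 2)
  have hr : ContDiff ℝ (⊤ : ℕ∞) r :=
    Real.smoothTransition.contDiff.comp (contDiff_const.sub (contDiff_norm_sq ℝ))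
  have hrc : HasCompactSupport r :=
    HasCompactSupport.intro (isCompact_closedBall (0 : S) 2) fun x hx => by
      refine Real.smoothTransition.zero_of_nonpos ?_
      rw [mem_closedBall_zero_iff, not_le] at hx
      nlinarith
  refine ⟨fun x => (r x : ℂ), ofRealCLM.contDiff.comp hr,
    hrc.comp_left (g := ofReal) ofReal_zero, fun x y h => by simp [r, h], ?_⟩
  change ∫ y, (r y : ℂ) ≠ 0
  rw [integral_complex_ofReal, ofReal_ne_zero]
  refine (hr.continuous.integral_pos_of_hasCompactSupport_nonneg_nonzero hrc
    (fun x => Real.smoothTransition.nonneg _) (x := 0) ?_).ne'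
  simp [r, (Real.smoothTransition.pos_of_pos two_pos).ne']

end MeanValue

/-! ### Limits of holomorphic sections are holomorphic -/

section Limits

open scoped Convolution

variable {S : Type*} [NormedAddCommGroup S] [InnerProductSpace ℝ S] [FiniteDimensional ℝ S]
  [MeasurableSpace S] [BorelSpace S]

theorem locallyIntegrable_div (ψ : L2Sections S) {G : S → ℂ} (hG : Continuous G)
    (hG0 : ∀ x, G x ≠ 0) : LocallyIntegrable (fun x => ψ x / G x) (volume : Measure S) := by
  have h := ((Lp.memLp ψ).locallyIntegrable (by norm_num)).continuous_smul (hG.inv₀ hG0)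
  refine h.congr (Filter.Eventually.of_forall fun x => ?_)
  simp [div_eq_inv_mul]

/-- At a fixed point the convolution is the L² inner product with a fixed continuous function of
compact support, hence continuous in the L² argument. -/
theorem tendsto_convolution_div {G : S → ℂ} (hG : Continuous G) (hG0 : ∀ x, G x ≠ 0)
    {Ψ : ℕ → L2Sections S} {ψ : L2Sections S} (h : Filter.Tendsto Ψ Filter.atTop (nhds ψ))
    {g : S → ℂ} (hg : Continuous g) (hgc : HasCompactSupport g) (x : S) :
    Filter.Tendsto (fun k => ((fun t => Ψ k t / G t) ⋆[ContinuousLinearMap.mul ℝ ℂ, volume] g) x)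
      Filter.atTop (nhds (((fun t => ψ t / G t) ⋆[ContinuousLinearMap.mul ℝ ℂ, volume] g) x)) := by
  let m : S → ℂ := fun t => star (g (x - t) / G t)
  have hm : Continuous m := ((hg.comp (by fun_prop)).div hG hG0).star
  have hmc : HasCompactSupport m := by
    have h1 : HasCompactSupport fun t => g (x - t) :=
      hgc.comp_homeomorph (Homeomorph.subLeft x)
    refine h1.mono fun t ht => ?_
    contrapose! ht
    simp only [Function.mem_support, not_not] at ht
    simp [m, ht]
  have hm2 : MemLp m 2 (volume : Measure S) := hm.memLp_of_hasCompactSupport hmc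
  have key : ∀ φ : L2Sections S,
      ((fun t => φ t / G t) ⋆[ContinuousLinearMap.mul ℝ ℂ, volume] g) x
        = inner ℂ (hm2.toLp m) φ := by
    intro φ
    rw [convolution_def, L2.inner_def]
    refine integral_congr_ae ?_
    filter_upwards [hm2.coeFn_toLp] with t ht
    rw [ht, RCLike.inner_apply]
    simp only [m, ContinuousLinearMap.mul_apply', star_def, conj_conj]
    ring
  simp only [key]
  exact tendsto_const_nhds.inner h

/-- An `L²` limit of holomorphic functions times a fixed function is again of this form. -/
theorem exists_isHolomorphicFunction_of_tendsto {J : Module.End ℝ S} (hJ : ∀ v, J (J v) = -v)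
    (hs : ∀ v w, inner ℝ (J v) w = -inner ℝ v (J w)) {G : S → ℂ} (hG : Continuous G)
    (hG0 : ∀ x, G x ≠ 0) {Ψ : ℕ → L2Sections S} {ψ : L2Sections S}
    (h : Filter.Tendsto Ψ Filter.atTop (nhds ψ)) {f : ℕ → S → ℂ}
    (hf : ∀ k, IsHolomorphicFunction J (f k)) (hΨ : ∀ k, Ψ k =ᵐ[volume] fun x => f k x * G x) :
    ∃ β, IsHolomorphicFunction J β ∧ ψ =ᵐ[volume] fun x => β x * G x := by
  obtain ⟨ρ, hρ, hρc, hrad, hρ0⟩ := exists_radial_mollifier (S := S)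
  set c := ∫ y, ρ y with hc
  have hdiv : ∀ k, (fun t => Ψ k t / G t) =ᵐ[volume] f k := fun k => by
    filter_upwards [hΨ k] with t ht
    rw [ht, mul_div_cancel_right₀ _ (hG0 t)]
  have hconv : ∀ k (g : S → ℂ) x,
      ((fun t => Ψ k t / G t) ⋆[ContinuousLinearMap.mul ℝ ℂ, volume] g) x
        = (f k ⋆[ContinuousLinearMap.mul ℝ ℂ, volume] g) x := fun k g x => by
    rw [convolution_def, convolution_def]
    refine integral_congr_ae ?_
    filter_upwards [hdiv k] with t ht
    rw [ht]
  -- By the mean value property, mollifying a holomorphic function only multiplies it by c.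
  have hmean : ∀ k, f k ⋆[ContinuousLinearMap.mul ℝ ℂ, volume] ρ = fun x => c * f k x := by
    intro k
    ext x
    rw [convolution_eq_swap, mul_comm, hc, ← integral_mul_radial_eq hJ hs (hf k) hρ.continuous hρc
      hrad, ← integral_neg_eq_self]
    refine integral_congr_ae (Filter.Eventually.of_forall fun y => ?_)
    simp [hrad (-y) y (norm_neg y)]
  have hderiv : ∀ (α : S → ℂ), LocallyIntegrable α (volume : Measure S) → ∀ x v,
      fderiv ℝ (α ⋆[ContinuousLinearMap.mul ℝ ℂ, volume] ρ) x v
        = (α ⋆[ContinuousLinearMap.mul ℝ ℂ, volume] fun y => fderiv ℝ ρ y v) x := by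
    intro α hα x v
    rw [(hρc.hasFDerivAt_convolution_right _ hα (hρ.of_le (by simp)) x).fderiv,
      convolution_precompR_apply _ hα (hρc.fderiv ℝ) (hρ.continuous_fderiv (by simp))]
  have hfl : ∀ k, LocallyIntegrable (f k) (volume : Measure S) := fun k =>
    (hf k).1.continuous.locallyIntegrable
  have hψl := locallyIntegrable_div ψ hG hG0
  -- The mollified limit is smooth, and c f_k and its derivatives converge to it pointwise, so it
  -- inherits complex linearity of the derivative.
  set A : S → ℂ := (fun t => ψ t / G t) ⋆[ContinuousLinearMap.mul ℝ ℂ, volume] ρ with hA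
  have hA1 : ContDiff ℝ (⊤ : ℕ∞) A := hρc.contDiff_convolution_right _ hψl hρ
  have hlim0 : ∀ x, Filter.Tendsto (fun k => c * f k x) Filter.atTop (nhds (A x)) := fun x => by
    have := tendsto_convolution_div hG hG0 h hρ.continuous hρc x
    simpa only [hconv, hmean] using this
  have hlim1 : ∀ x v, Filter.Tendsto (fun k => c * fderiv ℝ (f k) x v) Filter.atTop
      (nhds (fderiv ℝ A x v)) := fun x v => by
    have := tendsto_convolution_div hG hG0 h
      ((hρ.continuous_fderiv (by simp)).clm_apply continuous_const)
      (hρc.fderiv_apply ℝ v) x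
    rw [hA, hderiv _ hψl]
    refine this.congr fun k => ?_
    rw [hconv, ← hderiv _ (hfl k), hmean,
      fderiv_const_mul ((hf k).1.differentiable (by simp) x)]
    rfl
  refine ⟨fun x => c⁻¹ * A x, ⟨contDiff_const.mul hA1, fun x v => ?_⟩, ?_⟩
  · rw [fderiv_const_mul (hA1.differentiable (by simp) x), smul_apply, smul_apply, smul_eq_mul,
      smul_eq_mul, mul_left_comm]
    congr 1
    refine tendsto_nhds_unique (hlim1 x (J v)) (((hlim1 x v).const_mul I).congr fun k => ?_)
    rw [(hf k).2]
    ring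
  -- An almost everywhere convergent subsequence identifies ψ with c⁻¹A G.
  · obtain ⟨ns, hns, hae⟩ := (tendstoInMeasure_of_tendsto_Lp h).exists_seq_tendsto_ae
    filter_upwards [hae, ae_all_iff.2 hΨ] with x hx hx'
    refine tendsto_nhds_unique hx ?_
    have := (((hlim0 x).const_mul c⁻¹).mul_const (G x)).comp hns.tendsto_atTop
    refine this.congr fun k => ?_
    simp only [Function.comp_apply, hx', inv_mul_cancel_left₀ hρ0]

end Limits

/-! ### The lowest Landau level -/

section LowestLevel

variable {S : Type*} [NormedAddCommGroup S] [InnerProductSpace ℝ S] {N : ℕ}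

theorem nablaVec_frame (u : OrthonormalBasis (Fin N ⊕ Fin N) ℝ S) (ħ : ℝ) (ϑ : Fin N → ℝ)
    (s : Fin N ⊕ Fin N) (p : MvPolynomial (Fin N ⊕ Fin N) ℂ) :
    nablaVec u ħ ϑ (u s) p = nablaPoly (fun i => ((ϑ i / (2 * ħ) : ℝ) : ℂ)) s p := by
  simp [nablaVec, orthonormal_iff_ite.1 u.orthonormal, apply_ite ofReal, ite_smul]

variable [FiniteDimensional ℝ S] {u : OrthonormalBasis (Fin N ⊕ Fin N) ℝ S} {ω : LinearMap.BilinForm ℝ S}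
  {ϑ : Fin N → ℝ} {ħ : ℝ} {θ : S → S →L[ℝ] ℝ} {χ : S → ℝ}

theorem form_complexStructure (hω : ω.IsAlt) (hn : ω.Nondegenerate) (v w : S) :
    ω v (complexStructure ω w) = etaForm ω v w := by
  rw [← inner_structureInv, structureInv_eq hω hn, invModulus_complexStructure hω hn,
    complexStructure_complexStructure hω hn, neg_neg, etaForm]

theorem etaForm_complexStructure (hω : ω.IsAlt) (hn : ω.Nondegenerate) (v w : S) :
    etaForm ω v (complexStructure ω w) = -ω v w := by
  rw [← inner_structureInv, structureInv_eq hω hn, etaForm, invModulus_complexStructure hω hn,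
    inner_neg_right, neg_neg]

/-- Replacing v by Jv turns η + iω into i(η + iω), so the zeroth-order terms cancel in ∇_v +
i∇_{Jv}. What remains is the Cauchy–Riemann operator applied to β, times G. -/
theorem isHolomorphicSection_mul_gaugeGaussian_iff (hħ : 0 < ħ) (hω : ω.IsAlt)
    (hn : ω.Nondegenerate) (hχ : IsGaugeFunction ω θ χ) {β : S → ℂ}
    (hβ : ContDiff ℝ (⊤ : ℕ∞) β) :
    IsHolomorphicSection ħ θ (complexStructure ω) (fun x => β x * gaugeGaussian ħ ω χ x) ↔
      IsHolomorphicFunction (complexStructure ω) β := by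
  have key : ∀ x v, covDeriv ħ θ (fun x => β x * gaugeGaussian ħ ω χ x) x v
      + I * covDeriv ħ θ (fun x => β x * gaugeGaussian ħ ω χ x) x (complexStructure ω v)
      = (fderiv ℝ β x v + I * fderiv ℝ β x (complexStructure ω v))
        * gaugeGaussian ħ ω χ x := by
    intro x v
    have hd := hβ.differentiable (by simp) x
    rw [covDeriv_mul_gaugeGaussian hħ hω hn hχ hd, covDeriv_mul_gaugeGaussian hħ hω hn hχ hd,
      form_complexStructure hω hn, etaForm_complexStructure hω hn]
    have hI : I ^ 2 = -1 := I_sq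
    push_cast
    linear_combination (-(1 / (2 * ħ) : ℂ) * etaForm ω x v * β x * gaugeGaussian ħ ω χ x) * hI
  rw [IsHolomorphicSection, IsHolomorphicFunction,
    and_iff_right (hβ.mul (contDiff_gaugeGaussian ħ ω hχ.contDiff)), and_iff_right hβ]
  refine forall_congr' fun x => forall_congr' fun v => ?_
  rw [key, mul_eq_zero_iff_right (gaugeGaussian_ne_zero ħ ω χ x)]
  have hI : I ^ 2 = -1 := I_sq
  constructor
  · intro h
    linear_combination (-I) * h + fderiv ℝ β x (complexStructure ω v) * hI
  · intro h
    rw [h]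
    linear_combination fderiv ℝ β x v * hI

theorem complexCoord_complexStructure (hu : IsUnitaryFrame ω u ϑ) (hω : ω.IsAlt)
    (hn : ω.Nondegenerate) (i : Fin N) (x : S) :
    complexCoord u (Sum.inl i) (complexStructure ω x) = I * complexCoord u (Sum.inl i) x := by
  have h1 : inner ℝ (u (Sum.inl i)) (complexStructure ω x) = -inner ℝ (u (Sum.inr i)) x := by
    rw [hu.apply_inr, complexStructure_skew hω hn, neg_neg]
  have h2 : inner ℝ (u (Sum.inr i)) (complexStructure ω x) = inner ℝ (u (Sum.inl i)) x := by
    rw [hu.apply_inr, complexStructure_skew hω hn, complexStructure_complexStructure hω hn,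
      inner_neg_right, neg_neg]
  rw [complexCoord_inl, complexCoord_inl, h1, h2]
  have hI : I ^ 2 = -1 := I_sq
  push_cast
  linear_combination (-(inner ℝ (u (Sum.inr i)) x : ℂ)) * hI

theorem isHolomorphicFunction_polyFun (hu : IsUnitaryFrame ω u ϑ) (hω : ω.IsAlt)
    (hn : ω.Nondegenerate) {p : MvPolynomial (Fin N ⊕ Fin N) ℂ}
    (hp : p ∈ holomorphicPolynomials N) :
    IsHolomorphicFunction (complexStructure ω) (polyFun u p) := by
  refine ⟨contDiff_polyFun u p, fun x v => ?_⟩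
  rw [(hasFDerivAt_polyFun u p x).fderiv]
  rw [Fintype.sum_sum_type]
  simp only [add_apply, sum_apply, smul_apply, mem_holomorphicPolynomials.1 hp,
    complexCoord_complexStructure hu hω hn, smul_eq_mul, Finset.mul_sum, mul_add]
  congr 1
  · exact Finset.sum_congr rfl fun i _ => by ring
  · simp [polyFun]

theorem landauLevel_lt (hħ : 0 < ħ) (hϑ : ∀ i, 0 < ϑ i) {n : Fin N → ℕ} (hn : n ≠ 0) :
    landauLevel ħ ϑ 0 < landauLevel ħ ϑ n := by
  obtain ⟨j, hj⟩ := Function.ne_iff.1 hn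
  refine mul_lt_mul_of_pos_left (Finset.sum_lt_sum (fun i _ => ?_) ⟨j, Finset.mem_univ j, ?_⟩)
    (by positivity)
  · refine mul_le_mul_of_nonneg_right ?_ (hϑ i).le
    simp
  · refine mul_lt_mul_of_pos_right ?_ (hϑ j)
    have : 0 < n j := Nat.pos_of_ne_zero hj
    simpa using this

variable [MeasurableSpace S] [BorelSpace S] {hθ : ContDiff ℝ (⊤ : ℕ∞) θ}
  {ι : Type*} [Fintype ι] {e : OrthonormalBasis ι ℝ S}

/-- Holomorphic sections are orthogonal to the antiholomorphic derivatives of test sections. -/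
theorem inner_derivTest_sub_eq_zero {J : Module.End ℝ S} {f : S → ℂ}
    (hf : IsHolomorphicSection ħ θ J f) (hf2 : MemLp f 2 (volume : Measure S)) (v : S)
    (g : 𝓓((⊤ : TopologicalSpace.Opens S), ℂ)) :
    inner ℂ (hf2.toLp f) (derivTest ħ hθ v g - I • derivTest ħ hθ (J v) g) = 0 := by
  have h1 : ∀ x, star (covDeriv ħ θ f x v) * g x
      = I * (star (covDeriv ħ θ f x (J v)) * g x) := fun x => by
    rw [eq_neg_of_add_eq_zero_left (hf.2 x v)]
    simp only [star_def, map_neg, map_mul, conj_I]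
    ring
  rw [inner_sub_right, inner_smul_right, derivTest_apply, derivTest_apply, inner_toLp, inner_toLp,
    integral_star_mul_covDeriv ħ hθ hf.1, integral_star_mul_covDeriv ħ hθ hf.1]
  simp only [h1, integral_const_mul]
  ring

/-- Along the frame 2a_i = ∇_v - i∇_{Jv}, whose formal adjoint -(∇_v + i∇_{Jv}) annihilates f.
Approximating the polynomial section by test sections avoids any decay assumption on the derivatives
of f. -/
theorem inner_polyToL2_raiseOp_eq_zero (hu : IsUnitaryFrame ω u ϑ) (hħ : 0 < ħ) (hω : ω.IsAlt)
    (hn : ω.Nondegenerate) (hθ : ContDiff ℝ (⊤ : ℕ∞) θ) (hχ : IsGaugeFunction ω θ χ) {f : S → ℂ}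
    (hf : IsHolomorphicSection ħ θ (complexStructure ω) f)
    (hf2 : MemLp f 2 (volume : Measure S)) (i : Fin N) (q : MvPolynomial (Fin N ⊕ Fin N) ℂ) :
    inner ℂ (hf2.toLp f) (polyToL2 hu hħ hω hn hχ.contDiff
      (raiseOp (fun i => ((ϑ i / (2 * ħ) : ℝ) : ℂ)) i q)) = 0 := by
  obtain ⟨g, -, hg⟩ := exists_tendsto_polyToL2 hu hħ hω hn hθ hχ q
  have h1 := (hg (u (Sum.inl i))).sub ((hg (u (Sum.inr i))).const_smul I)
  rw [nablaVec_frame, nablaVec_frame, ← map_smul, ← map_sub, nablaPoly_inl, nablaPoly_inr,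
    smul_smul, I_mul_I] at h1
  have h2 : ∀ a b : MvPolynomial (Fin N ⊕ Fin N) ℂ, a + b - (-1 : ℂ) • (a - b) = (2 : ℂ) • a :=
    fun a b => by module
  rw [h2, map_smul] at h1
  have h3 := (tendsto_const_nhds (x := hf2.toLp f)).inner (𝕜 := ℂ) h1
  simp only [hu.apply_inr, inner_derivTest_sub_eq_zero hf hf2] at h3
  have h4 := tendsto_nhds_unique h3 tendsto_const_nhds
  rw [inner_smul_right] at h4
  simpa using h4

/-- Where n_i ≠ 0, the relation a_i∂̄_i p = -k_i n_i p can be solved for p. -/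
theorem exists_raiseOp_eq {k : Fin N → ℂ} (hk : ∀ i, k i ≠ 0) {n : Fin N → ℕ} (hn : n ≠ 0)
    {p : MvPolynomial (Fin N ⊕ Fin N) ℂ} (hp : p ∈ levelSpace k n) :
    ∃ i q, p = raiseOp k i q := by
  obtain ⟨i, hi⟩ := Function.ne_iff.1 hn
  have hi' : k i * n i ≠ 0 := mul_ne_zero (hk i) (Nat.cast_ne_zero.2 hi)
  refine ⟨i, -(k i * n i)⁻¹ • MvPolynomial.pderiv (Sum.inr i) p, ?_⟩
  rw [map_smul, mem_levelSpace.1 hp, neg_smul, smul_neg, neg_neg, smul_smul,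
    inv_mul_cancel₀ hi', one_smul]

/-- The eigenspace of the lowest Landau level, through polynomial sections. -/
theorem eigenSubmodule_landauLevel_zero (hu : IsUnitaryFrame ω u ϑ) (hħ : 0 < ħ) (hω : ω.IsAlt)
    (hn : ω.Nondegenerate) (hχ : IsGaugeFunction ω θ χ) :
    eigenSubmodule (bochnerLaplacian ħ hθ e) (landauLevel ħ ϑ 0 : ℝ)
        = ((⨆ (n : Fin N → ℕ) (_ : n ≠ 0), levelSpace (fun i => ((ϑ i / (2 * ħ) : ℝ) : ℂ)) n).map
            (polyToL2 hu hħ hω hn hχ.contDiff))ᗮ ∧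
      eigenSubmodule (bochnerLaplacian ħ hθ e) (landauLevel ħ ϑ 0 : ℝ)
        = ((holomorphicPolynomials N).map
            (polyToL2 hu hħ hω hn hχ.contDiff)).topologicalClosure := by
  have hk : ∀ i, ((ϑ i / (2 * ħ) : ℝ) : ℂ) ≠ 0 := fun i =>
    ofReal_ne_zero.2 (div_pos (hu.pos i) (by positivity)).ne'
  refine IsSymmetricOp.eigenSubmodule_eq isClosed_graph_bochnerLaplacian
    isSymmetricOp_bochnerLaplacian ?_ ?_ ?_
  · rw [Submodule.map_le_iff_le_comap]
    exact fun p hp => polyToL2_mem_eigenSubmodule hu hħ hω hn hχ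
      (holomorphicPolynomials_le_levelSpace _ hp)
  · rw [Submodule.map_le_iff_le_comap]
    refine iSup₂_le fun n hn0 p hp => ?_
    exact Submodule.mem_iSup_of_mem _ (Submodule.mem_iSup_of_mem
      (landauLevel_lt hħ hu.pos hn0).ne' (polyToL2_mem_eigenSubmodule hu hħ hω hn hχ hp))
  · rw [← Submodule.map_sup, holomorphicPolynomials_sup_levelSpace hk, Submodule.map_top]
    exact dense_range_polyToL2 hu hħ hω hn hχ.contDiff

theorem exists_isHolomorphicFunction_of_mem_eigenSubmodule (hu : IsUnitaryFrame ω u ϑ) (hħ : 0 < ħ)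
    (hω : ω.IsAlt) (hn : ω.Nondegenerate) (hχ : IsGaugeFunction ω θ χ) {ψ : L2Sections S}
    (hψ : ψ ∈ eigenSubmodule (bochnerLaplacian ħ hθ e) (landauLevel ħ ϑ 0 : ℝ)) :
    ∃ β, IsHolomorphicFunction (complexStructure ω) β ∧
      ψ =ᵐ[volume] fun x => β x * gaugeGaussian ħ ω χ x := by
  rw [(eigenSubmodule_landauLevel_zero hu hħ hω hn hχ).2] at hψ
  obtain ⟨Ψ, hΨ, hlim⟩ := mem_closure_iff_seq_limit.1 hψ
  choose p hp hpΨ using hΨ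
  refine exists_isHolomorphicFunction_of_tendsto (complexStructure_complexStructure hω hn)
    (complexStructure_skew hω hn) (contDiff_gaugeGaussian ħ ω hχ.contDiff).continuous
    (gaugeGaussian_ne_zero ħ ω χ) hlim
    (fun k => isHolomorphicFunction_polyFun hu hω hn (hp k)) fun k => ?_
  rw [← hpΨ k]
  exact coeFn_polyToL2 hu hħ hω hn hχ.contDiff (p k)

theorem mem_eigenSubmodule_of_isHolomorphicSection (hu : IsUnitaryFrame ω u ϑ) (hħ : 0 < ħ)
    (hω : ω.IsAlt) (hn : ω.Nondegenerate) (hχ : IsGaugeFunction ω θ χ) {ψ : L2Sections S}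
    {f : S → ℂ} (hf : IsHolomorphicSection ħ θ (complexStructure ω) f) (hψ : ψ =ᵐ[volume] f) :
    ψ ∈ eigenSubmodule (bochnerLaplacian ħ hθ e) (landauLevel ħ ϑ 0 : ℝ) := by
  have hk : ∀ i, ((ϑ i / (2 * ħ) : ℝ) : ℂ) ≠ 0 := fun i =>
    ofReal_ne_zero.2 (div_pos (hu.pos i) (by positivity)).ne'
  have hf2 : MemLp f 2 (volume : Measure S) := (memLp_congr_ae hψ).1 (Lp.memLp ψ)
  have hψ' : ψ = hf2.toLp f := Lp.ext (hψ.trans hf2.coeFn_toLp.symm)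
  rw [(eigenSubmodule_landauLevel_zero hu hħ hω hn hχ).1, hψ', Submodule.mem_orthogonal']
  suffices h : (⨆ (n : Fin N → ℕ) (_ : n ≠ 0),
      levelSpace (fun i => ((ϑ i / (2 * ħ) : ℝ) : ℂ)) n) ≤ LinearMap.ker
        ((innerSL ℂ (hf2.toLp f)).toLinearMap ∘ₗ polyToL2 hu hħ hω hn hχ.contDiff) by
    rintro _ ⟨p, hp, rfl⟩
    exact h hp
  refine iSup₂_le fun n hn0 p hp => ?_
  obtain ⟨i, q, rfl⟩ := exists_raiseOp_eq hk hn0 hp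
  exact inner_polyToL2_raiseOp_eq_zero hu hħ hω hn hθ hχ hf hf2 i q

end LowestLevel

/-! ### The spectrum -/

section LandauSpectrum

variable {N : ℕ} {ϑ : Fin N → ℝ} {ħ : ℝ}

/-- Each n_i ϑ_i is at most ħ times the level, so only finitely many n lie below a given bound. The
level map is thus proper on a discrete space, and its range is closed. -/
theorem isClosed_range_landauLevel (hħ : 0 < ħ) (hϑ : ∀ i, 0 < ϑ i) :
    IsClosed (Set.range (landauLevel ħ ϑ)) := by
  have h : Filter.Tendsto (landauLevel ħ ϑ) Filter.cofinite Filter.atTop := by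
    refine Filter.tendsto_atTop.2 fun b => ?_
    refine (Set.finite_Iic (fun i => ⌈b * ħ / ϑ i⌉₊)).subset fun n hn i => ?_
    replace hn : landauLevel ħ ϑ n < b := not_le.1 hn
    have h1 : (n i : ℝ) * ϑ i ≤ ∑ i, (2 * (n i : ℝ) + 1) * ϑ i := by
      refine le_trans ?_ (Finset.single_le_sum (f := fun i => (2 * (n i : ℝ) + 1) * ϑ i)
        (fun j _ => mul_nonneg (by positivity) (hϑ j).le) (Finset.mem_univ i))
      refine mul_le_mul_of_nonneg_right ?_ (hϑ i).le
      have : (0 : ℝ) ≤ n i := Nat.cast_nonneg _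
      linarith
    rw [landauLevel, one_div_mul_eq_div, div_lt_iff₀ hħ] at hn
    have h2 : (n i : ℝ) ≤ b * ħ / ϑ i := (le_div_iff₀ (hϑ i)).2 (h1.trans hn.le)
    exact_mod_cast h2.trans (Nat.le_ceil _)
  have hp : IsProperMap (landauLevel ħ ϑ) := by
    rw [isProperMap_iff_tendsto_cocompact, Filter.cocompact_eq_cofinite]
    exact ⟨continuous_of_discreteTopology, h.mono_right atTop_le_cocompact⟩
  exact hp.isClosedMap.isClosed_range

theorem isLeast_range_landauLevel (hħ : 0 < ħ) (hϑ : ∀ i, 0 < ϑ i) :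
    IsLeast (Set.range (landauLevel ħ ϑ)) (landauLevel ħ ϑ 0) := by
  refine ⟨⟨0, rfl⟩, ?_⟩
  rintro _ ⟨n, rfl⟩
  rcases eq_or_ne n 0 with rfl | hn
  · exact le_rfl
  · exact (landauLevel_lt hħ hϑ hn).le

theorem range_landauLevel_comp (ħ : ℝ) (ϑ : Fin N → ℝ) (σ : Equiv.Perm (Fin N)) :
    Set.range (landauLevel ħ (ϑ ∘ σ)) = Set.range (landauLevel ħ ϑ) := by
  have h : landauLevel ħ (ϑ ∘ σ) = landauLevel ħ ϑ ∘ (σ.arrowCongr (Equiv.refl ℕ)) := by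
    ext n
    simp only [landauLevel, Function.comp_apply]
    congr 1
    refine Eq.trans ?_ (Equiv.sum_comp σ _)
    simp
  rw [h, EquivLike.range_comp]

variable {S : Type*} [NormedAddCommGroup S] [InnerProductSpace ℝ S]
  {u : OrthonormalBasis (Fin N ⊕ Fin N) ℝ S} {ω : LinearMap.BilinForm ℝ S}
  {θ : S → S →L[ℝ] ℝ} {χ : S → ℝ}

theorem isGaugeFunction_zero (h : ∀ x v : S, θ x v = -(1 / 2) * ω x v) :
    IsGaugeFunction ω θ fun _ => 0 :=
  ⟨contDiff_const, fun x v => by rw [fderiv_fun_const, h]; simp⟩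

theorem isHolomorphicFunction_const_mul {J : Module.End ℝ S} {β : S → ℂ}
    (hβ : IsHolomorphicFunction J β) (c : ℂ) : IsHolomorphicFunction J fun x => c * β x := by
  refine ⟨contDiff_const.mul hβ.1, fun x v => ?_⟩
  rw [fderiv_const_mul (hβ.1.differentiable (by simp) x), smul_apply, smul_apply, hβ.2]
  simp only [smul_eq_mul]
  ring

/-- The kernel of evaluation is stable under ∂̄_i, a combination of real directional derivatives.
This is all that is needed to find nonzero eigenfunctions in every level. -/
theorem polyFun_pderiv_inr_eq_zero {p : MvPolynomial (Fin N ⊕ Fin N) ℂ}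
    (hp : ∀ x, polyFun u p x = 0) (i : Fin N) (x : S) :
    polyFun u (MvPolynomial.pderiv (Sum.inr i) p) x = 0 := by
  have h0 : polyFun u p = fun _ => 0 := funext hp
  have h1 := fderiv_polyFun_inl u p x i
  have h2 := fderiv_polyFun_inr u p x i
  rw [h0, fderiv_fun_const] at h1 h2
  rw [polyFun_add] at h1
  rw [polyFun_sub] at h2
  have h3 := (mul_eq_zero.1 h2.symm).resolve_left I_ne_zero
  have h4 : _ = (0 : ℂ) := h1.symm
  linear_combination (1 / 2 : ℂ) * h4 - (1 / 2 : ℂ) * h3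

variable [FiniteDimensional ℝ S]

theorem landauLevel_zero_eq_trace (hu : IsUnitaryFrame ω u ϑ) (hħ : 0 < ħ) (hω : ω.IsAlt)
    (hn : ω.Nondegenerate) :
    1 / (2 * ħ) * LinearMap.trace ℝ S (invModulus ω) = landauLevel ħ ϑ 0 := by
  rw [hu.trace_invModulus hω hn, landauLevel]
  simp
  field_simp

theorem gaugeGaussian_zero (ħ : ℝ) (ω : LinearMap.BilinForm ℝ S) (x : S) :
    gaugeGaussian ħ ω (fun _ => 0) x
      = ((Real.exp (-(1 / (4 * ħ)) * etaForm ω x x) : ℝ) : ℂ) := by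
  simp [gaugeGaussian]

variable [MeasurableSpace S] [BorelSpace S] {hθ : ContDiff ℝ (⊤ : ℕ∞) θ}
  {ι : Type*} [Fintype ι] {e : OrthonormalBasis ι ℝ S}

theorem polyFun_eq_zero_of_polyToL2_eq_zero (hu : IsUnitaryFrame ω u ϑ) (hħ : 0 < ħ)
    (hω : ω.IsAlt) (hn : ω.Nondegenerate) (hχ : ContDiff ℝ (⊤ : ℕ∞) χ)
    {p : MvPolynomial (Fin N ⊕ Fin N) ℂ} (hp : polyToL2 hu hħ hω hn hχ p = 0) (x : S) :
    polyFun u p x = 0 := by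
  have h1 : polySection u ħ ω χ p =ᵐ[volume] fun _ => 0 :=
    (coeFn_polyToL2 hu hħ hω hn hχ p).symm.trans (hp ▸ Lp.coeFn_zero ℂ 2 volume)
  have h2 := ((contDiff_polySection u ħ ω hχ p).continuous.ae_eq_iff_eq volume
    continuous_const).1 h1
  exact (mul_eq_zero.1 (congrFun h2 x)).resolve_right (gaugeGaussian_ne_zero ħ ω χ x)

theorem isOpEigenvalue_landauLevel (hu : IsUnitaryFrame ω u ϑ) (hħ : 0 < ħ) (hω : ω.IsAlt)
    (hn : ω.Nondegenerate) (hχ : IsGaugeFunction ω θ χ) (n : Fin N → ℕ) :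
    IsOpEigenvalue (bochnerLaplacian ħ hθ e) (landauLevel ħ ϑ n : ℝ) := by
  let Z : Submodule ℂ (MvPolynomial (Fin N ⊕ Fin N) ℂ) :=
    { carrier := {p | ∀ x, polyFun u p x = 0}
      add_mem' := fun {p q} hp hq x => by rw [polyFun_add, hp x, hq x, add_zero]
      zero_mem' := fun x => by simp [polyFun]
      smul_mem' := fun c p hp x => by rw [polyFun_smul, hp x, mul_zero] }
  obtain ⟨p, hp, hpZ⟩ := exists_mem_levelSpace_notMem
    (k := fun i => ((ϑ i / (2 * ħ) : ℝ) : ℂ))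
    (fun i => ofReal_ne_zero.2 (div_pos (hu.pos i) (by positivity)).ne') Z
    (fun i p hp x => polyFun_pderiv_inr_eq_zero hp i x)
    (fun h => by simpa [polyFun] using h 0) n
  refine ⟨polyToL2 hu hħ hω hn hχ.contDiff p, ?_, fun h => hpZ fun x =>
    polyFun_eq_zero_of_polyToL2_eq_zero hu hħ hω hn hχ.contDiff h x⟩
  rw [← coe_eigenSubmodule]
  exact polyToL2_mem_eigenSubmodule hu hħ hω hn hχ hp

theorem opSpectrum_bochnerLaplacian (hu : IsUnitaryFrame ω u ϑ) (hħ : 0 < ħ) (hω : ω.IsAlt)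
    (hn : ω.Nondegenerate) (hχ : IsGaugeFunction ω θ χ) :
    opSpectrum (bochnerLaplacian ħ hθ e)
      = (fun a : ℝ => (a : ℂ)) '' Set.range (landauLevel ħ ϑ) := by
  refine opSpectrum_eq_of_dense_eigenvectors isClosed_graph_bochnerLaplacian
    isSymmetricOp_bochnerLaplacian (isClosed_range_landauLevel hħ hu.pos) ?_ ?_
  · refine (dense_range_polyToL2 hu hħ hω hn hχ.contDiff).mono ?_
    have hk : ∀ i, ((ϑ i / (2 * ħ) : ℝ) : ℂ) ≠ 0 := fun i =>
      ofReal_ne_zero.2 (div_pos (hu.pos i) (by positivity)).ne'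
    have hle : ∀ n, (levelSpace (fun i => ((ϑ i / (2 * ħ) : ℝ) : ℂ)) n).map
        (polyToL2 hu hħ hω hn hχ.contDiff) ≤ ⨆ a ∈ Set.range (landauLevel ħ ϑ),
          eigenSubmodule (bochnerLaplacian ħ hθ e) (a : ℝ) := by
      rintro n _ ⟨p, hp, rfl⟩
      exact Submodule.mem_iSup_of_mem _ (Submodule.mem_iSup_of_mem ⟨n, rfl⟩
        (polyToL2_mem_eigenSubmodule hu hħ hω hn hχ hp))
    rw [SetLike.coe_subset_coe, ← Submodule.map_top,
      ← holomorphicPolynomials_sup_levelSpace hk, Submodule.map_sup]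
    refine sup_le ((Submodule.map_mono (holomorphicPolynomials_le_levelSpace _)).trans (hle 0)) ?_
    simp only [Submodule.map_iSup]
    exact iSup₂_le fun n _ => hle n
  · rintro _ ⟨n, rfl⟩
    exact isOpEigenvalue_landauLevel hu hħ hω hn hχ n

theorem setOf_mem_opSpectrum_bochnerLaplacian (hu : IsUnitaryFrame ω u ϑ) (hħ : 0 < ħ)
    (hω : ω.IsAlt) (hn : ω.Nondegenerate) (hχ : IsGaugeFunction ω θ χ) :
    {r : ℝ | (r : ℂ) ∈ opSpectrum (bochnerLaplacian ħ hθ e)} = Set.range (landauLevel ħ ϑ) := by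
  rw [opSpectrum_bochnerLaplacian hu hħ hω hn hχ]
  exact Set.preimage_image_eq _ ofReal_injective

theorem setOf_isOpEigenvalue_bochnerLaplacian (hu : IsUnitaryFrame ω u ϑ) (hħ : 0 < ħ)
    (hω : ω.IsAlt) (hn : ω.Nondegenerate) (hχ : IsGaugeFunction ω θ χ) :
    {r : ℝ | IsOpEigenvalue (bochnerLaplacian ħ hθ e) (r : ℂ)} = Set.range (landauLevel ħ ϑ) := by
  refine Set.Subset.antisymm (fun r hr => ?_) ?_
  · rw [← setOf_mem_opSpectrum_bochnerLaplacian (hθ := hθ) (e := e) hu hħ hω hn hχ]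
    exact mem_opSpectrum_of_isOpEigenvalue hr
  · rintro _ ⟨n, rfl⟩
    exact isOpEigenvalue_landauLevel hu hħ hω hn hχ n

end LandauSpectrum

end

/-! ### Assembly of the theorem. -/

theorem mainTheorem1 {S : Type*} [NormedAddCommGroup S] [InnerProductSpace ℝ S]
    [FiniteDimensional ℝ S] [MeasurableSpace S] [BorelSpace S]
    (N : ℕ) (hN : Module.finrank ℝ S = 2 * N)
    (ω : LinearMap.BilinForm ℝ S) (hω_alt : ω.IsAlt) (hω_nondeg : ω.Nondegenerate)
    (ħ : ℝ) (hħ : 0 < ħ)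
    (θ : S → S →L[ℝ] ℝ) (hθ : ContDiff ℝ (⊤ : ℕ∞) θ)
    (hθω : ∀ x u v : S, ω u v = -extDerivOne θ x u v)
    {ι : Type*} [Fintype ι] (e : OrthonormalBasis ι ℝ S) :
    -- complex coordinates diagonalizing `|E|⁻¹` and the metric exist
    (∃ (b : Module.Basis (Fin N ⊕ Fin N) ℝ S) (ϑ : Fin N → ℝ),
      IsDiagonalCoordinates ω b ϑ ∧ (∀ i, 0 < ϑ i) ∧
        ∀ i j, metricComponent b i j = if i = j then ((1 / ϑ i : ℝ) : ℂ) else 0) ∧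
    -- the spectrum, for the diagonal components in any such coordinates
    (∀ (b : Module.Basis (Fin N ⊕ Fin N) ℝ S) (ϑ : Fin N → ℝ),
      IsDiagonalCoordinates ω b ϑ →
        opSpectrum (bochnerLaplacian ħ hθ e) =
          {z : ℂ | ∃ n : Fin N → ℕ,
            z = ((1 / ħ * ∑ i, (2 * (n i : ℝ) + 1) * ϑ i : ℝ) : ℂ)}) ∧
    -- the lowest spectral value and lowest eigenvalue
    (IsLeast {r : ℝ | (r : ℂ) ∈ opSpectrum (bochnerLaplacian ħ hθ e)}
        (1 / (2 * ħ) * LinearMap.trace ℝ S (invModulus ω)) ∧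
      IsLeast {r : ℝ | IsOpEigenvalue (bochnerLaplacian ħ hθ e) (r : ℂ)}
        (1 / (2 * ħ) * LinearMap.trace ℝ S (invModulus ω))) ∧
    -- its eigenspace consists of the square-integrable holomorphic sections
    opEigenspace (bochnerLaplacian ħ hθ e)
        ((1 / (2 * ħ) * LinearMap.trace ℝ S (invModulus ω) : ℝ) : ℂ) =
      {ψ : L2Sections S | ∃ f : S → ℂ,
        IsHolomorphicSection ħ θ (complexStructure ω) f ∧ ψ =ᵐ[volume] f} ∧
    -- in the symmetric gauge, these are holomorphic functions times the Gaussian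
    ((∀ x v : S, θ x v = -(1 / 2) * ω x v) →
      opEigenspace (bochnerLaplacian ħ hθ e)
          ((1 / (2 * ħ) * LinearMap.trace ℝ S (invModulus ω) : ℝ) : ℂ) =
        {ψ : L2Sections S | ∃ α : S → ℂ,
          IsHolomorphicFunction (complexStructure ω) α ∧
            ψ =ᵐ[volume] fun x =>
              α x / ((√(2 * Real.pi * ħ) ^ N : ℝ) : ℂ) *
                ((Real.exp (-(1 / (4 * ħ)) * etaForm ω x x) : ℝ) : ℂ)}) := by
  obtain ⟨u, ϑ, hu⟩ := exists_isUnitaryFrame hN hω_alt hω_nondeg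
  obtain ⟨χ, hχ⟩ := exists_isGaugeFunction hω_alt hθ hθω
  rw [landauLevel_zero_eq_trace hu hħ hω_alt hω_nondeg]
  have hmem : ∀ ψ : L2Sections S,
      ψ ∈ opEigenspace (bochnerLaplacian ħ hθ e) (landauLevel ħ ϑ 0 : ℝ) ↔
        ψ ∈ eigenSubmodule (bochnerLaplacian ħ hθ e) (landauLevel ħ ϑ 0 : ℝ) := fun ψ => by
    rw [← coe_eigenSubmodule, SetLike.mem_coe]
  refine ⟨?_, fun b ϑ' hb => ?_, ⟨?_, ?_⟩, ?_, fun hsym => ?_⟩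
  · obtain ⟨b, hb, hmet⟩ := hu.exists_isDiagonalCoordinates hω_alt hω_nondeg
    exact ⟨b, ϑ, hb, hu.pos, hmet⟩
  -- Other diagonalizing coordinates only permute the components, and the set of levels is invariant
  -- under permutations.
  · obtain ⟨σ, rfl⟩ := hb.exists_perm (hu.isDiagonalCoordinates hω_alt hω_nondeg)
    rw [opSpectrum_bochnerLaplacian hu hħ hω_alt hω_nondeg hχ, ← range_landauLevel_comp ħ ϑ σ]
    ext z
    constructor
    · rintro ⟨_, ⟨n, rfl⟩, rfl⟩
      exact ⟨n, rfl⟩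
    · rintro ⟨n, rfl⟩
      exact ⟨_, ⟨n, rfl⟩, rfl⟩
  · rw [setOf_mem_opSpectrum_bochnerLaplacian hu hħ hω_alt hω_nondeg hχ]
    exact isLeast_range_landauLevel hħ hu.pos
  · rw [setOf_isOpEigenvalue_bochnerLaplacian hu hħ hω_alt hω_nondeg hχ]
    exact isLeast_range_landauLevel hħ hu.pos
  · ext ψ
    rw [hmem]
    constructor
    · intro hψ
      obtain ⟨β, hβ, hψβ⟩ := exists_isHolomorphicFunction_of_mem_eigenSubmodule hu hħ hω_alt
        hω_nondeg hχ hψ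
      exact ⟨_, (isHolomorphicSection_mul_gaugeGaussian_iff hħ hω_alt hω_nondeg hχ hβ.1).2 hβ, hψβ⟩
    · rintro ⟨f, hf, hψ⟩
      exact mem_eigenSubmodule_of_isHolomorphicSection hu hħ hω_alt hω_nondeg hχ hf hψ
  -- For the symmetric potential the gauge function may be taken to be 0. Then G is the real
  -- Gaussian, and the normalizing constant is absorbed into the holomorphic factor.
  · have hχ0 := isGaugeFunction_zero hsym
    have hc : ((√(2 * Real.pi * ħ) ^ N : ℝ) : ℂ) ≠ 0 :=
      ofReal_ne_zero.2 (pow_pos (Real.sqrt_pos.2 (by positivity)) N).ne'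
    ext ψ
    rw [hmem]
    constructor
    · intro hψ
      obtain ⟨β, hβ, hψβ⟩ := exists_isHolomorphicFunction_of_mem_eigenSubmodule hu hħ hω_alt
        hω_nondeg hχ0 hψ
      refine ⟨_, isHolomorphicFunction_const_mul hβ ((√(2 * Real.pi * ħ) ^ N : ℝ) : ℂ), ?_⟩
      filter_upwards [hψβ] with x hx
      rw [hx, gaugeGaussian_zero, mul_div_cancel_left₀ _ hc]
    · rintro ⟨α, hα, hψ⟩
      have hβ := isHolomorphicFunction_const_mul hα ((√(2 * Real.pi * ħ) ^ N : ℝ) : ℂ)⁻¹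
      refine mem_eigenSubmodule_of_isHolomorphicSection hu hħ hω_alt hω_nondeg hχ0
        ((isHolomorphicSection_mul_gaugeGaussian_iff hħ hω_alt hω_nondeg hχ0 hβ.1).2 hβ) ?_
      filter_upwards [hψ] with x hx
      rw [hx, gaugeGaussian_zero, div_eq_inv_mul]
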